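/- Let $A$ be the path algebra over $\mathbb F_2$ of the quiver with two vertices $\iota_0,\iota_1$ and arrows $\rho_1,\rho_3$ from $\iota_0$ to $\iota_1$ and $\rho_2,\rho_4$ from $\iota_1$ to $\iota_0$ (so $\rho_1=\iota_0\rho_1\iota_1$, etc.), modulo $\rho_2\rho_1=\rho_3\rho_2=\rho_4\rho_3=\rho_1\rho_4=0$. It has $\mathbb F_2$-basis $\iota_0,\iota_1$ and the chords $\rho_{i,i+1,\dots,i+n}=\rho_i\rho_{i+1}\cdots\rho_{i+n}$, $i\in\mathbb Z/4$, $n\ge 0$. Let $A[U]=A\otimes\mathbb F_2[U]$ and $K=\mathbb F_2[U]\iota_0\oplus\mathbb F_2[U]\iota_1\subset A[U]$. An $A_\infty$ deformation of $A$ over $\mathbb F_2[U]$ is a strictly unital $A_\infty$-algebra structure on $A[U]$ with $K$-bimodule operations $\mu_n\colon A[U]^{\otimes_K n}\to A[U]$, $n\ge 1$, such that $\mu_1=0$ and $\mu_2$ is the multiplication of $A[U]$. Let $G$ be the set of $(m;a,b)\in(\tfrac12\mathbb Z)^3$ with $a+b\in\mathbb Z$ and $m+\frac{(2a+1)(a+b+1)+1}{2}\in\mathbb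 Z$, with group law $(m;a,b)(n;c,d)=(m+n+ad-bc;a+c,b+d)$. Put $\Gamma=G\times\mathbb Z$, $\lambda=(1;0,0)\times 0$, and $$\gamma(\rho_1)=(-\tfrac12;\tfrac12,-\tfrac12)\times0,\quad \gamma(\rho_2)=(-\tfrac12;\tfrac12,\tfrac12)\times0,\quad \gamma(\rho_3)=(-\tfrac12;-\tfrac12,\tfrac12)\times0,\quad \gamma(\rho_4)=(-\tfrac32;-\tfrac12,-\tfrac12)\times1,$$ extended to basis elements of $A$ by $\gamma(\iota_0)=\gamma(\iota_1)=1$ and $\gamma(\rho_i\cdots\rho_{i+n})=\gamma(\rho_i)\cdots\gamma(\rho_{i+n})$. Given $u\in\Gamma$, an element of $A[U]$ is homogeneous of grading $g$ if it is an $\mathbb F_2$-linear combination of elements $U^kb$, $b$ a basis element of $A$, with $u^k\gamma(b)=g$. A deformation is $\Gamma$-graded with $\gamma(U)=u$ if, for all $n$ and all homogeneous $a_1,\dots,a_n$ of gradings $g_1,\dots,g_n$, the element $\mu_n(a_1,\dots,a_n)$ is homogeneous of grading $\lambda^{n-2}g_1\cdots g_n$. **Theorem.** Consider the conditions on an $A_\infty$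 deformation of $A$ over $\mathbb F_2[U]$: 1. it is $\Gamma$-graded (for some grading $\gamma(U)\in\Gamma$ of $U$); 2. $\mu_4(\rho_4,\rho_3,\rho_2,\rho_1)=U\iota_1$ and $\mu_4(\rho_3,\rho_2,\rho_1,\rho_4)=U\iota_0$. These conditions force $\gamma(U)=(-2;0,0)\times 1$. A deformation satisfying them exists, and it is unique up to isomorphism: for any two of them, $\mathcal A$ and $\mathcal B$, there is an invertible strictly unital $A_\infty$-homomorphism $f\colon\mathcal A\to\mathcal B$ over $K$ with $f_1=\mathrm{id}$, such that $f$ and its inverse are $\Gamma$-graded (their $n$-input components have degree $\lambda^{n-1}$). -/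

import Mathlib

open Polynomial

noncomputable section

/-! ### `A∞` deformations of associative algebras in characteristic two

A family of maps `φ_n : A^n → A`, `n ≥ 0`, is encoded as one function `φ : List A → A`; the map
`φ_n` is the restriction of `φ` to lists of length `n`. -/

namespace AInf

variable {A : Type} [Ring A]

/-- Every `φ_n` is a `K`-bimodule map `A ⊗_K ⋯ ⊗_K A → A`: additive in each input, `K`-balanced
between neighbouring inputs, left `K`-linear in the first and right `K`-linear in the last input.
The ground ring `K` is not assumed to be central in `A`. -/
structure IsMultilinear (K : Subring A) (φ : List A → A) : Prop where
  map_add : ∀ (xs ys : List A) (a b : A),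
    φ (xs ++ (a + b) :: ys) = φ (xs ++ a :: ys) + φ (xs ++ b :: ys)
  balanced : ∀ (xs ys : List A) (a b : A), ∀ k ∈ K,
    φ (xs ++ (a * k) :: b :: ys) = φ (xs ++ a :: (k * b) :: ys)
  map_left : ∀ (ys : List A) (a : A), ∀ k ∈ K, φ ((k * a) :: ys) = k * φ (a :: ys)
  map_right : ∀ (xs : List A) (a : A), ∀ k ∈ K, φ (xs ++ [a * k]) = φ (xs ++ [a]) * k

/-- The sum, over all nonempty blocks of consecutive inputs, of applying `ψ` to the block and then
`φ` to the resulting list: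
`∑ φ(a_1, …, a_i, ψ(a_{i+1}, …, a_{i+q+1}), a_{i+q+2}, …, a_n)`. -/
def insertion (φ ψ : List A → A) (l : List A) : A :=
  ∑ i ∈ Finset.range l.length, ∑ q ∈ Finset.range (l.length - i),
    φ (l.take i ++ ψ ((l.drop i).take (q + 1)) :: l.drop (i + q + 1))

/-- The sum, over all ways of cutting the input into consecutive nonempty blocks, of applying `φ`
to each block and then `ψ` to the list of results:
`∑ ψ(φ(a_1, …, a_{i_1}), φ(a_{i_1+1}, …, a_{i_1+i_2}), …, φ(…, a_n))`. -/
def compose (ψ φ : List A → A) (l : List A) : A :=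
  ∑ c : Composition l.length, ψ ((l.splitWrtComposition c).map φ)

/-- An `A∞` deformation, over the ground ring `K`, of the associative ring `A` of characteristic
two: a strictly unital `A∞`-algebra structure on `A` with `K`-multilinear operations `μ_n`, such
that `μ_0 = 0`, `μ_1 = 0` and `μ_2` is the multiplication of `A`. -/
structure Deformation (K : Subring A) where
  μ : List A → A
  multilinear : IsMultilinear K μ
  μ_zero : μ [] = 0
  μ_one : ∀ a, μ [a] = 0
  μ_two : ∀ a b, μ [a, b] = a * b
  unital : ∀ xs ys : List A, xs.length + ys.length ≠ 1 → μ (xs ++ 1 :: ys) = 0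
  relation : ∀ l, insertion μ μ l = 0

/-- `f = (f_n)` is a strictly unital homomorphism of `A∞`-algebras (in characteristic two, hence
without signs). -/
structure IsHom {K : Subring A} (D E : Deformation K) (f : List A → A) : Prop where
  multilinear : IsMultilinear K f
  f_zero : f [] = 0
  f_one : f [1] = 1
  unital : ∀ xs ys : List A, xs.length + ys.length ≠ 0 → f (xs ++ 1 :: ys) = 0
  relation : ∀ l, insertion f D.μ l = compose E.μ f l

/-- The identity homomorphism: `f_1` is the identity and all other `f_n` vanish. -/
def idHom : List A → A
  | [a] => a
  | _ => 0

/-- With respect to a notion `H a g` of "`a` is homogeneous of grading `g`" and a grading element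
`lam`, the map `φ_n` has degree `lam ^ (n - d)` for every `n`. -/
def HasDegree {Γ : Type} [Group Γ] (H : A → Γ → Prop) (lam : Γ) (d : ℤ) (φ : List A → A) : Prop :=
  ∀ l : List (A × Γ), (∀ p ∈ l, H p.1 p.2) →
    H (φ (l.map Prod.fst)) (lam ^ ((l.length : ℤ) - d) * (l.map Prod.snd).prod)

/-- A graded deformation: `μ_n` has degree `lam ^ (n - 2)`. -/
def Deformation.IsGraded {K : Subring A} (D : Deformation K) {Γ : Type} [Group Γ]
    (H : A → Γ → Prop) (lam : Γ) : Prop :=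
  HasDegree H lam 2 D.μ

/-- Graded isomorphism of deformations of `A`: there is a graded homomorphism `f` (so `f_n` has
degree `lam ^ (n - 1)`) whose linear part `f_1` is the identity of `A`, and which has a graded
two-sided inverse homomorphism `g`. -/
def GradedIsomorphic {K : Subring A} {Γ : Type} [Group Γ]
    (H : A → Γ → Prop) (lam : Γ) (D E : Deformation K) : Prop :=
  ∃ f g : List A → A,
    IsHom D E f ∧ IsHom E D g ∧ HasDegree H lam 1 f ∧ HasDegree H lam 1 g ∧
      (∀ a, f [a] = a) ∧ compose g f = idHom ∧ compose f g = idHom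

end AInf

/-! ### The associative torus algebra with coefficients in `𝔽₂[U]` -/

namespace Torus

/-- The ring `𝔽₂[U]`; the variable `U` is `Polynomial.X`. -/
abbrev F2U : Type := (ZMod 2)[X]

/-- Basic elements: the idempotents `ι_0`, `ι_1` and, for `i ∈ ℤ/4` and `n ≥ 0`, the chord
`chord i n = ρ_{i, i+1, …, i+n}` of length `n + 1`. Thus `ρ_4` is `chord 0 0`. -/
inductive Basic : Type
  | idem (x : ZMod 2)
  | chord (i : ZMod 4) (n : ℕ)

/-- `ρ_i` starts at the vertex `src i` and ends at `src (i + 1)`: `ρ_1` and `ρ_3` go from `ι_0`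
to `ι_1`, and `ρ_2` and `ρ_4` go from `ι_1` to `ι_0`. -/
def src (i : ZMod 4) : ZMod 2 := (i.val + 1 : ℕ)

/-- Product of basic elements in the path algebra of the quiver with vertices `ι_0`, `ι_1` and
arrows `ρ_1, …, ρ_4`, modulo `ρ_2ρ_1 = ρ_3ρ_2 = ρ_4ρ_3 = ρ_1ρ_4 = 0`; `none` stands for zero. -/
def Basic.mul : Basic → Basic → Option Basic
  | .idem x, .idem y => if x = y then some (.idem x) else none
  | .idem x, .chord i n => if x = src i then some (.chord i n) else none
  | .chord i n, .idem y => if y = src (i + n + 1) then some (.chord i n) else none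
  | .chord i n, .chord j m => if j = i + n + 1 then some (.chord i (n + m + 1)) else none

theorem Basic.mul_assoc (a b c : Basic) :
    (Basic.mul a b).bind (fun d => Basic.mul d c) =
      (Basic.mul b c).bind (fun d => Basic.mul a d) := by
  rcases a with x | ⟨i, n⟩ <;> rcases b with y | ⟨j, m⟩ <;> rcases c with z | ⟨k, p⟩ <;>
    simp only [Basic.mul]
  all_goals (try (split_ifs <;> simp_all; done))
  · by_cases h1 : y = z
    · subst h1
      by_cases h2 : y = src (i + n + 1) <;> simp [h2]
    · by_cases h2 : y = src (i + n + 1)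
      · subst h2
        simp [h1, Ne.symm h1]
      · simp [h1, h2]
  · by_cases h1 : k = i + n + 1
    · subst h1
      by_cases h2 : y = src (i + n + 1) <;> simp [h2]
    · by_cases h2 : y = src (i + n + 1)
      · subst h2
        by_cases h3 : src (i + n + 1) = src k <;> simp [h1, h3]
      · by_cases h3 : y = src k <;> simp [h1, h2, h3]
  · by_cases h1 : j = i + n + 1
    · subst h1
      by_cases h2 : z = src (i + n + 1 + m + 1)
      · simp [h2]; ring_nf
      · have h3 : ¬ z = src (i + (n + m + 1) + 1) := by
          intro h; apply h2; rw [h]; ring_nf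
        simp [h2, h3]
    · by_cases h2 : z = src (j + m + 1) <;> simp [h1, h2]
  · by_cases h1 : j = i + n + 1
    · subst h1
      by_cases h2 : k = i + n + 1 + m + 1
      · subst h2
        have h3 : i + (n : ZMod 4) + 1 + m + 1 = i + (n + m + 1) + 1 := by ring
        simp [h3]; ring
      · have h3 : ¬ k = i + (n + m + 1) + 1 := by
          intro h; apply h2; rw [h]; ring
        simp [h2, h3]
    · by_cases h2 : k = j + m + 1 <;> simp [h1, h2]

/-- The associative torus algebra over `𝔽₂[U]`: the free `𝔽₂[U]`-module on the basic elements. -/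
def Alg : Type := Basic →₀ F2U

namespace Alg

instance : AddCommGroup Alg := inferInstanceAs (AddCommGroup (Basic →₀ F2U))

instance : Module F2U Alg := inferInstanceAs (Module F2U (Basic →₀ F2U))

/-- A basic element, as an element of the algebra. -/
def of (b : Basic) : Alg := Finsupp.single b (1 : F2U)

/-- A basic element or zero, as an element of the algebra. -/
def ofOption (o : Option Basic) : Alg := o.elim 0 of

/-- The multiplication: the `𝔽₂[U]`-bilinear extension of the product of basic elements. -/
def mulHom : Alg →ₗ[F2U] Alg →ₗ[F2U] Alg :=
  Finsupp.linearCombination F2U fun b =>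
    (Finsupp.linearCombination F2U fun c => ofOption (Basic.mul b c) : (Basic →₀ F2U) →ₗ[F2U] Alg)

instance : Mul Alg := ⟨fun x y => mulHom x y⟩

instance : One Alg := ⟨of (.idem 0) + of (.idem 1)⟩

theorem mul_def (x y : Alg) : x * y = mulHom x y := rfl

theorem one_def : (1 : Alg) = of (.idem 0) + of (.idem 1) := rfl

theorem mulHom_of (b c : Basic) : mulHom (of b) (of c) = ofOption (Basic.mul b c) := by
  unfold mulHom of
  erw [Finsupp.linearCombination_single, one_smul, Finsupp.linearCombination_single, one_smul]

theorem hom_ext {M : Type} [AddCommMonoid M] [Module F2U M] {f g : Alg →ₗ[F2U] M}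
    (h : ∀ b, f (of b) = g (of b)) : f = g :=
  Finsupp.lhom_ext' fun b => LinearMap.ext_ring (h b)

theorem mulHom_ofOption_left (o : Option Basic) (c : Basic) :
    mulHom (ofOption o) (of c) = ofOption (o.bind fun d => Basic.mul d c) := by
  cases o with
  | none => simp [ofOption]
  | some d => exact mulHom_of d c

theorem mulHom_ofOption_right (o : Option Basic) (c : Basic) :
    mulHom (of c) (ofOption o) = ofOption (o.bind fun d => Basic.mul c d) := by
  cases o with
  | none => simp [ofOption]
  | some d => exact mulHom_of c d

theorem mulHom_assoc (x y z : Alg) : mulHom (mulHom x y) z = mulHom x (mulHom y z) := by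
  have h : mulHom.compr₂ mulHom =
      ((LinearMap.llcomp F2U Alg Alg Alg).comp mulHom).compl₂ mulHom := by
    refine hom_ext fun a => hom_ext fun b => hom_ext fun c => ?_
    change mulHom (mulHom (of a) (of b)) (of c) = mulHom (of a) (mulHom (of b) (of c))
    rw [mulHom_of, mulHom_of, mulHom_ofOption_left, mulHom_ofOption_right, Basic.mul_assoc]
  exact congrArg (fun k : Alg →ₗ[F2U] Alg →ₗ[F2U] Alg →ₗ[F2U] Alg => k x y z) h

theorem zmod_two_cases (x : ZMod 2) : x = 0 ∨ x = 1 := by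
  revert x; decide

theorem one_mulHom (x : Alg) : mulHom 1 x = x := by
  have h : mulHom 1 = LinearMap.id := by
    refine hom_ext fun b => ?_
    rw [one_def, map_add, LinearMap.add_apply, mulHom_of, mulHom_of]
    rcases b with x | ⟨i, n⟩
    · rcases zmod_two_cases x with rfl | rfl <;> simp [Basic.mul, ofOption]
    · rcases zmod_two_cases (src i) with h | h <;> simp [Basic.mul, ofOption, h]
  exact congrArg (fun k : Alg →ₗ[F2U] Alg => k x) h

theorem mulHom_one (x : Alg) : mulHom x 1 = x := by
  have h : mulHom.flip 1 = LinearMap.id := by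
    refine hom_ext fun b => ?_
    rw [LinearMap.flip_apply, one_def, map_add, mulHom_of, mulHom_of]
    rcases b with x | ⟨i, n⟩
    · rcases zmod_two_cases x with rfl | rfl <;> simp [Basic.mul, ofOption]
    · rcases zmod_two_cases (src (i + n + 1)) with h | h <;> simp [Basic.mul, ofOption, h]
  exact congrArg (fun k : Alg →ₗ[F2U] Alg => k x) h

instance : Ring Alg :=
  { (inferInstance : AddCommGroup Alg), (inferInstance : Mul Alg), (inferInstance : One Alg) with
    left_distrib := fun a b c => map_add (mulHom a) b c
    right_distrib := fun a b c => by simp only [mul_def, map_add, LinearMap.add_apply]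
    zero_mul := fun a => by simp only [mul_def, map_zero, LinearMap.zero_apply]
    mul_zero := fun a => map_zero (mulHom a)
    mul_assoc := mulHom_assoc
    one_mul := one_mulHom
    mul_one := mulHom_one }

instance : Algebra F2U Alg :=
  Algebra.ofModule (fun r x y => by simp only [mul_def, map_smul, LinearMap.smul_apply])
    (fun r x y => by simp only [mul_def, map_smul])

end Alg

/-- The idempotents `ι_0` and `ι_1`. -/
def iota (x : ZMod 2) : Alg := Alg.of (.idem x)

/-- The chords `ρ_i` of length one, indices modulo `4`. -/
def rho (i : ZMod 4) : Alg := Alg.of (.chord i 0)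

/-- The ground ring `𝔽₂[U]ι_0 ⊕ 𝔽₂[U]ι_1`, as a subring of the torus algebra. -/
def ground : Subring Alg := (Algebra.adjoin F2U {iota 0, iota 1}).toSubring

/-! ### The grading group `Γ = G × ℤ` and the grading `γ` -/

/-- Rational triples `(m; a, b)`. -/
@[ext]
structure Triple where
  m : ℚ
  a : ℚ
  b : ℚ

namespace Triple

instance : Mul Triple :=
  ⟨fun x y => ⟨x.m + y.m + x.a * y.b - x.b * y.a, x.a + y.a, x.b + y.b⟩⟩

instance : One Triple := ⟨⟨0, 0, 0⟩⟩

instance : Inv Triple := ⟨fun x => ⟨-x.m, -x.a, -x.b⟩⟩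

theorem mul_def (x y : Triple) :
    x * y = ⟨x.m + y.m + x.a * y.b - x.b * y.a, x.a + y.a, x.b + y.b⟩ := rfl

theorem one_def : (1 : Triple) = ⟨0, 0, 0⟩ := rfl

theorem inv_def (x : Triple) : x⁻¹ = ⟨-x.m, -x.a, -x.b⟩ := rfl

/-- The multiplication is `(m; a, b) (n; c, d) = (m + n + ad - bc; a + c, b + d)`. -/
instance : Group Triple :=
  Group.ofLeftAxioms
    (fun x y z => by ext <;> simp only [mul_def] <;> ring)
    (fun x => by ext <;> simp [mul_def, one_def])
    (fun x => by ext <;> simp only [mul_def, one_def, inv_def] <;> ring)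

end Triple

/-- A rational number is an integer. -/
def IsInt (q : ℚ) : Prop := ∃ n : ℤ, q = n

/-- The group `G` of all `(m; a, b) ∈ (½ℤ)³` such that `a + b ∈ ℤ` and
`m + ((2a + 1)(a + b + 1) + 1) / 2 ∈ ℤ`. -/
def G : Subgroup Triple where
  carrier := {x | IsInt (2 * x.m) ∧ IsInt (2 * x.a) ∧ IsInt (2 * x.b) ∧ IsInt (x.a + x.b) ∧
    IsInt (x.m + ((2 * x.a + 1) * (x.a + x.b + 1) + 1) / 2)}
  one_mem' := ⟨⟨0, by simp [Triple.one_def]⟩, ⟨0, by simp [Triple.one_def]⟩,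
    ⟨0, by simp [Triple.one_def]⟩, ⟨0, by simp [Triple.one_def]⟩,
    ⟨1, by rw [Triple.one_def]; norm_num⟩⟩
  mul_mem' := by
    rintro ⟨m, a, b⟩ ⟨n, c, d⟩ ⟨⟨m2, hm⟩, ⟨a2, ha⟩, ⟨b2, hb⟩, ⟨s, hs⟩, ⟨u, hu⟩⟩
      ⟨⟨n2, hn⟩, ⟨c2, hc⟩, ⟨d2, hd⟩, ⟨t, ht⟩, ⟨v, hv⟩⟩
    simp only [Triple.mul_def, Set.mem_ofPred_eq] at *
    obtain rfl : b = s - a := by linarith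
    obtain rfl : d = t - c := by linarith
    refine ⟨⟨m2 + n2 + a2 * t - s * c2, ?_⟩, ⟨a2 + c2, ?_⟩, ⟨b2 + d2, ?_⟩, ⟨s + t, ?_⟩,
      ⟨u + v + a2 * t - 1, ?_⟩⟩ <;> push_cast
    · rw [← hm, ← hn, ← ha, ← hc]; ring
    · rw [← ha, ← hc]; ring
    · rw [← hb, ← hd]; ring
    · ring
    · rw [← hu, ← hv, ← ha]; ring
  inv_mem' := by
    rintro ⟨m, a, b⟩ ⟨⟨m2, hm⟩, ⟨a2, ha⟩, ⟨b2, hb⟩, ⟨s, hs⟩, ⟨u, hu⟩⟩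
    simp only [Triple.inv_def, Set.mem_ofPred_eq] at *
    obtain rfl : b = s - a := by linarith
    refine ⟨⟨-m2, ?_⟩, ⟨-a2, ?_⟩, ⟨-b2, ?_⟩, ⟨-s, ?_⟩, ⟨-u + a2 * s + 2, ?_⟩⟩ <;> push_cast
    · rw [← hm]; ring
    · rw [← ha]; ring
    · rw [← hb]; ring
    · ring
    · rw [← hu, ← ha]; ring

/-- The grading group `Γ = G × ℤ`, the factor `ℤ` being written multiplicatively. -/
abbrev Gam : Type := G × Multiplicative ℤ

/-- The element `(m; a, b) × w` of `Γ`. -/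
def Gam.mk (m a b : ℚ) (h : (⟨m, a, b⟩ : Triple) ∈ G) (w : ℤ) : Gam :=
  (⟨⟨m, a, b⟩, h⟩, Multiplicative.ofAdd w)

/-- The distinguished central element `λ = (1; 0, 0) × 0`. -/
def lam : Gam := Gam.mk 1 0 0
  ⟨⟨2, by norm_num⟩, ⟨0, by norm_num⟩, ⟨0, by norm_num⟩, ⟨0, by norm_num⟩, ⟨2, by norm_num⟩⟩ 0

/-- The grading `(-2; 0, 0) × 1`. -/
def gamU : Gam := Gam.mk (-2) 0 0
  ⟨⟨-4, by norm_num⟩, ⟨0, by norm_num⟩, ⟨0, by norm_num⟩, ⟨0, by norm_num⟩, ⟨-1, by norm_num⟩⟩ 1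

/-- The gradings `γ(ρ_1) = (-1/2; 1/2, -1/2) × 0`, `γ(ρ_2) = (-1/2; 1/2, 1/2) × 0`,
`γ(ρ_3) = (-1/2; -1/2, 1/2) × 0`, `γ(ρ_4) = (-3/2; -1/2, -1/2) × 1`. -/
def gamRho (i : ZMod 4) : Gam :=
  if i = 1 then Gam.mk (-1 / 2) (1 / 2) (-1 / 2)
    ⟨⟨-1, by norm_num⟩, ⟨1, by norm_num⟩, ⟨-1, by norm_num⟩, ⟨0, by norm_num⟩, ⟨1, by norm_num⟩⟩ 0
  else if i = 2 then Gam.mk (-1 / 2) (1 / 2) (1 / 2)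
    ⟨⟨-1, by norm_num⟩, ⟨1, by norm_num⟩, ⟨1, by norm_num⟩, ⟨1, by norm_num⟩, ⟨2, by norm_num⟩⟩ 0
  else if i = 3 then Gam.mk (-1 / 2) (-1 / 2) (1 / 2)
    ⟨⟨-1, by norm_num⟩, ⟨-1, by norm_num⟩, ⟨1, by norm_num⟩, ⟨0, by norm_num⟩, ⟨0, by norm_num⟩⟩ 0
  else Gam.mk (-3 / 2) (-1 / 2) (-1 / 2)
    ⟨⟨-3, by norm_num⟩, ⟨-1, by norm_num⟩, ⟨-1, by norm_num⟩, ⟨-1, by norm_num⟩,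
      ⟨-1, by norm_num⟩⟩ 1

/-- The grading of basic elements: idempotents have trivial grading, and
`γ(ρ_{i, …, i+n}) = γ(ρ_i) γ(ρ_{i+1}) ⋯ γ(ρ_{i+n})`. -/
def gamBasic : Basic → Gam
  | .idem _ => 1
  | .chord i n => ((List.range (n + 1)).map fun k : ℕ => gamRho (i + k)).prod

/-- `x` is homogeneous of grading `g`, where `U` is given the grading `u`: the element `x` is an
`𝔽₂`-linear combination of elements `U^k b`, `b` basic, with `u^k γ(b) = g`. -/
def IsHomogeneous (u : Gam) (x : Alg) (g : Gam) : Prop :=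
  ∀ (b : Basic) (k : ℕ), ((show Basic →₀ F2U from x) b).coeff k ≠ 0 → u ^ k * gamBasic b = g

/-- `A∞` deformations of the torus algebra over `𝔽₂[U]`. -/
abbrev TorusDeformation : Type := AInf.Deformation ground

/-- The normalization `μ_4(ρ_4, ρ_3, ρ_2, ρ_1) = U ι_1` and `μ_4(ρ_3, ρ_2, ρ_1, ρ_4) = U ι_0`. -/
def IsNormalized (D : TorusDeformation) : Prop :=
  D.μ [rho 4, rho 3, rho 2, rho 1] = (X : F2U) • iota 1 ∧
    D.μ [rho 3, rho 2, rho 1, rho 4] = (X : F2U) • iota 0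

end Torus

end

/-! Operations and homomorphisms are built one arity at a time, by obstruction theory. In
characteristic two the `A∞` relation says that inserting `μ` into `μ` (`ins`) gives zero, and a
homomorphism `f` from `D` to `E` satisfies `ins f D = cmp E f`. If such a relation holds in fewer
than `n` inputs, its failure in `n` inputs is a Hochschild cocycle (`PreDeformation.delta_ins`,
`PreHom.delta_homObs`). Changing `μ` or `f` in `n - 1` inputs changes this failure by a coboundary
(`PreDeformation.ins_perturb`, `PreHom.homObs_perturb`). Obstructions to existence have degree `λ^(n
- 3)`, obstructions to uniqueness degree `λ^(n - 2)`.

The algebra is quadratic and monomial, hence Koszul, so its Hochschild cohomology is visible on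
critical lists, the lists of arrows whose consecutive products vanish. Concretely, a cocycle
vanishes if it is zero on critical lists and on "split" lists, in which a critical list is followed
by a chord composable with its last arrow (`Reduced.eq_zero`). Values on split lists can be removed
by the differential of a cochain which does not affect values on critical lists
(`exists_primitive`). Both facts are combined in `exists_correction`.

What remains is decided by the grading. A composable critical list is a descending sequence `ρ_j,
ρ_{j-1}, …`. Four descending arrows have grading `λ^(-2) γ(U)`, four ascending ones `γ(U)`, so the
degree almost determines the number of inputs (`rel_arrows`).

Existence: an obstruction can be nonzero only on five or seven critical arrows. In five inputs it is
the differential of `kappa`, whose values `U ι` make it vanish; in seven inputs the cocycle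
condition in eight inputs kills it (`eq_zero_on_crit`). Uniqueness: an obstruction lives on four
critical arrows, with values spanned by `U ι` and chords of length four. The normalization and the
cocycle condition leave one coefficient, which the differential of `zeta` removes
(`eq_zero_on_crit_four`). Since the value in each arity is eventually constant, the corrections
converge (`exists_limit`). The grading of `U` is read off from the first normalization. -/

noncomputable section

namespace AInf

/-! ### Sums over deconcatenations of a list -/

section SplitSum

variable {X B C : Type} [AddCommMonoid B] [AddCommMonoid C]

/-- The sum of `G u w` over all ways of writing a list as `u ++ w`. -/
def splitSum : (List X → List X → B) → List X → B
  | G, [] => G [] []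
  | G, x :: l => G [] (x :: l) + splitSum (fun u w => G (x :: u) w) l

theorem splitSum_nil (G : List X → List X → B) : splitSum G [] = G [] [] := rfl

theorem splitSum_cons (G : List X → List X → B) (x : X) (l : List X) :
    splitSum G (x :: l) = G [] (x :: l) + splitSum (fun u w => G (x :: u) w) l := rfl

theorem splitSum_congr {G H : List X → List X → B} {l : List X}
    (h : ∀ u w, u ++ w = l → G u w = H u w) : splitSum G l = splitSum H l := by
  induction l generalizing G H with
  | nil => exact h [] [] rfl
  | cons x l ih =>
    rw [splitSum_cons, splitSum_cons, h [] (x :: l) rfl,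
      ih (G := fun u w => G (x :: u) w) (H := fun u w => H (x :: u) w)
        fun u w huw => h _ _ (by rw [← huw]; rfl)]

theorem splitSum_zero (l : List X) : splitSum (fun _ _ => (0 : B)) l = 0 := by
  induction l with
  | nil => rfl
  | cons x l ih => rw [splitSum_cons, ih, add_zero]

theorem splitSum_eq_zero {G : List X → List X → B} {l : List X}
    (h : ∀ u w, u ++ w = l → G u w = 0) : splitSum G l = 0 :=
  (splitSum_congr h).trans (splitSum_zero l)

theorem splitSum_add (G H : List X → List X → B) (l : List X) :
    splitSum (fun u w => G u w + H u w) l = splitSum G l + splitSum H l := by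
  induction l generalizing G H with
  | nil => rfl
  | cons x l ih => simp only [splitSum_cons, ih]; abel

theorem map_splitSum (F : B →+ C) (G : List X → List X → B) (l : List X) :
    F (splitSum G l) = splitSum (fun u w => F (G u w)) l := by
  induction l generalizing G with
  | nil => rfl
  | cons x l ih => simp only [splitSum_cons, map_add, ih]

/-- Coassociativity of deconcatenation: both sides run over all ways of cutting `l` into three
pieces. -/
theorem splitSum_assoc (K : List X → List X → List X → B) (l : List X) :
    splitSum (fun u w => splitSum (fun u₁ u₂ => K u₁ u₂ w) u) l =
      splitSum (fun u w => splitSum (fun w₁ w₂ => K u w₁ w₂) w) l := by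
  induction l generalizing K with
  | nil => rfl
  | cons x l ih =>
    simp only [splitSum_cons, splitSum_nil]
    rw [splitSum_add, ih fun u₁ u₂ w => K (x :: u₁) u₂ w, add_assoc]

theorem splitSum_append_singleton (G : List X → List X → B) (l : List X) (x : X) :
    splitSum G (l ++ [x]) = splitSum (fun u w => G u (w ++ [x])) l + G (l ++ [x]) [] := by
  induction l generalizing G with
  | nil => rfl
  | cons y l ih => simp only [List.cons_append, splitSum_cons, ih, add_assoc]

theorem splitSum_eq_sum (G : List X → List X → B) (l : List X) :
    splitSum G l = ∑ q ∈ Finset.range (l.length + 1), G (l.take q) (l.drop q) := by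
  induction l generalizing G with
  | nil => simp [splitSum_nil]
  | cons x l ih =>
    rw [splitSum_cons, ih, List.length_cons, Finset.sum_range_succ' _ (l.length + 1), add_comm]
    simp

/-- A property that is closed under sums and holds for all summands holds for `splitSum`. -/
theorem splitSum_induction (p : B → Prop) (hadd : ∀ a b, p a → p b → p (a + b))
    {G : List X → List X → B} {l : List X} (h : ∀ u w, u ++ w = l → p (G u w)) :
    p (splitSum G l) := by
  induction l generalizing G with
  | nil => exact h [] [] rfl
  | cons x l ih =>
    exact hadd _ _ (h [] _ rfl) (ih fun u w huw => h _ _ (by rw [← huw]; rfl))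

end SplitSum

/-! ### Insertion and composition by recursion on lists -/

section Operations

variable {A B C : Type} [AddCommGroup B] [AddCommGroup C]

/-- Recursive form of `insertion`. -/
def ins : (List A → B) → (List A → A) → List A → B
  | _, _, [] => 0
  | φ, ψ, x :: l =>
    splitSum (fun u w => φ (ψ (x :: u) :: w)) l + ins (fun l' => φ (x :: l')) ψ l

theorem ins_nil (φ : List A → B) (ψ : List A → A) : ins φ ψ [] = 0 := rfl

theorem ins_cons (φ : List A → B) (ψ : List A → A) (x : A) (l : List A) :
    ins φ ψ (x :: l) =
      splitSum (fun u w => φ (ψ (x :: u) :: w)) l + ins (fun l' => φ (x :: l')) ψ l := rfl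

theorem ins_induction (p : B → Prop) (h0 : p 0) (hadd : ∀ a b, p a → p b → p (a + b))
    {φ : List A → B} {ψ : List A → A} {l : List A}
    (h : ∀ u v w, v ≠ [] → u ++ (v ++ w) = l → p (φ (u ++ ψ v :: w))) : p (ins φ ψ l) := by
  induction l generalizing φ with
  | nil => exact h0
  | cons x l ih =>
    refine hadd _ _ (splitSum_induction p hadd fun u w huw => ?_)
      (ih fun u v w hv huw => ?_)
    · exact h [] (x :: u) w (by simp) (by simp [huw])
    · exact h (x :: u) v w hv (by simp [huw])

theorem ins_congr {φ φ' : List A → B} {ψ ψ' : List A → A} {l : List A}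
    (h : ∀ u v w, v ≠ [] → u ++ (v ++ w) = l → φ (u ++ ψ v :: w) = φ' (u ++ ψ' v :: w)) :
    ins φ ψ l = ins φ' ψ' l := by
  induction l generalizing φ φ' with
  | nil => rfl
  | cons x l ih =>
    rw [ins_cons, ins_cons]
    congr 1
    · exact splitSum_congr fun u w huw => h [] (x :: u) w (by simp) (by simp [huw])
    · exact ih fun u v w hv huw => h (x :: u) v w hv (by simp [huw])

theorem ins_eq_zero {φ : List A → B} {ψ : List A → A} {l : List A}
    (h : ∀ u v w, v ≠ [] → u ++ (v ++ w) = l → φ (u ++ ψ v :: w) = 0) : ins φ ψ l = 0 :=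
  ins_induction (fun b : B => b = 0) rfl (fun a b ha hb => by rw [ha, hb, add_zero]) h

theorem ins_add_left (φ φ' : List A → B) (ψ : List A → A) (l : List A) :
    ins (fun l => φ l + φ' l) ψ l = ins φ ψ l + ins φ' ψ l := by
  induction l generalizing φ φ' with
  | nil => simp [ins_nil]
  | cons x l ih =>
    simp only [ins_cons]
    rw [splitSum_add, ih]; abel

theorem map_ins (F : B →+ C) (φ : List A → B) (ψ : List A → A) (l : List A) :
    F (ins φ ψ l) = ins (fun l => F (φ l)) ψ l := by
  induction l generalizing φ with
  | nil => exact map_zero F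
  | cons x l ih => simp only [ins_cons, map_add, map_splitSum, ih]

/-- Insertion is a coderivation with respect to the deconcatenation of lists. -/
theorem ins_splitSum (G : List A → List A → B) (ψ : List A → A) (l : List A) :
    ins (splitSum G) ψ l =
      splitSum (fun u w => ins (fun u' => G u' w) ψ u + ins (G u) ψ w) l := by
  induction l generalizing G with
  | nil => simp [ins_nil, splitSum_nil]
  | cons x l ih =>
    rw [ins_cons, splitSum_cons]
    simp only [ins_nil, zero_add, ins_cons, splitSum_cons]
    rw [ins_add_left, splitSum_add, splitSum_add, splitSum_add,
      ih fun u w => G (x :: u) w, splitSum_add,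
      splitSum_assoc fun u₁ u₂ w => G (ψ (x :: u₁) :: u₂) w]
    abel

/-- The part of `cmp` in which the first block has already begun; `g` is `f` with the first
inputs of that block filled in. -/
def cmpAux (f : List A → A) : (List A → B) → (List A → A) → List A → B
  | φ, g, [] => φ [g []]
  | φ, g, x :: l => cmpAux f (fun l' => φ (g [] :: l')) (fun u => f (x :: u)) l +
      cmpAux f φ (fun u => g (x :: u)) l

/-- Recursive form of `compose`. -/
def cmp (φ : List A → B) (f : List A → A) : List A → B
  | [] => φ []
  | x :: l => cmpAux f φ (fun u => f (x :: u)) l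

theorem cmp_nil (φ : List A → B) (f : List A → A) : cmp φ f [] = φ [] := rfl

/-- Splitting off the whole first block is not structural recursion, so `cmpAux` decides letter by
letter whether the current block ends. Summing over the place where it ends gives the usable form
`cmp_cons`. -/
theorem cmpAux_eq (φ : List A → B) (f g : List A → A) (l : List A) :
    cmpAux f φ g l = splitSum (fun u w => cmp (fun l' => φ (g u :: l')) f w) l := by
  induction l generalizing φ g with
  | nil => rfl
  | cons x l ih =>
    rw [cmpAux, splitSum_cons, ih φ]
    rfl

theorem cmp_cons (φ : List A → B) (f : List A → A) (x : A) (l : List A) :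
    cmp φ f (x :: l) = splitSum (fun u w => cmp (fun l' => φ (f (x :: u) :: l')) f w) l :=
  cmpAux_eq _ _ _ _

/-- The part of `cmpOne` in which the first block has already begun. -/
def cmpOneAux (f g : List A → A) : (List A → B) → (List A → A) → (List A → A) → List A → B
  | φ, _, k, [] => φ [k []]
  | φ, h, k, x :: l =>
    (cmpAux f (fun l' => φ (k [] :: l')) (fun u => f (x :: u)) l +
      cmpOneAux f g (fun l' => φ (h [] :: l')) (fun u => f (x :: u)) (fun u => g (x :: u)) l) +
      cmpOneAux f g φ (fun u => h (x :: u)) (fun u => k (x :: u)) l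

/-- The sum, over all ways of cutting the input into nonempty blocks and of choosing one of them,
of applying `g` to the chosen block, `f` to the others and `φ` to the results. -/
def cmpOne (φ : List A → B) (f g : List A → A) : List A → B
  | [] => 0
  | x :: l => cmpOneAux f g φ (fun u => f (x :: u)) (fun u => g (x :: u)) l

theorem cmpOneAux_eq (φ : List A → B) (f g h k : List A → A) (l : List A) :
    cmpOneAux f g φ h k l = splitSum (fun u w => cmp (fun l' => φ (k u :: l')) f w +
      cmpOne (fun l' => φ (h u :: l')) f g w) l := by
  induction l generalizing φ h k with
  | nil => exact (add_zero _).symm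
  | cons x l ih =>
    rw [cmpOneAux, splitSum_cons, ih φ]
    rfl

theorem cmpOne_nil (φ : List A → B) (f g : List A → A) : cmpOne φ f g [] = 0 := rfl

theorem cmpOne_cons (φ : List A → B) (f g : List A → A) (x : A) (l : List A) :
    cmpOne φ f g (x :: l) = splitSum (fun u w => cmp (fun l' => φ (g (x :: u) :: l')) f w +
      cmpOne (fun l' => φ (f (x :: u) :: l')) f g w) l :=
  cmpOneAux_eq _ _ _ _ _ _

theorem length_lt_of_append {u w l : List A} (h : u ++ w = l) (x : A) :
    w.length < (x :: l).length := by
  subst h; simp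

/-- What follows the first block is an arbitrary proper suffix; hence strong induction on the
length, here and below. -/
theorem cmp_add_left (φ φ' : List A → B) (f : List A → A) (l : List A) :
    cmp (fun l => φ l + φ' l) f l = cmp φ f l + cmp φ' f l := by
  induction h : l.length using Nat.strong_induction_on generalizing φ φ' l with
  | _ n ih =>
    subst h
    cases l with
    | nil => rfl
    | cons x l =>
      simp only [cmp_cons]
      rw [← splitSum_add]
      exact splitSum_congr fun u w huw => ih _ (length_lt_of_append huw x) _ _ _ rfl

theorem cmp_zero_left (f : List A → A) (l : List A) : cmp (fun _ => (0 : B)) f l = 0 := by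
  have h := cmp_add_left (fun _ => (0 : B)) (fun _ => 0) f l
  simp only [add_zero] at h
  exact left_eq_add.1 h

theorem map_cmp (F : B →+ C) (φ : List A → B) (f : List A → A) (l : List A) :
    F (cmp φ f l) = cmp (fun l => F (φ l)) f l := by
  induction h : l.length using Nat.strong_induction_on generalizing φ l with
  | _ n ih =>
    subst h
    cases l with
    | nil => rfl
    | cons x l =>
      simp only [cmp_cons, map_splitSum]
      exact splitSum_congr fun u w huw => ih _ (length_lt_of_append huw x) _ _ rfl

theorem cmp_congr {φ : List A → B} {f f' : List A → A} {l : List A}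
    (h : ∀ v, v ≠ [] → v.length ≤ l.length → f v = f' v) : cmp φ f l = cmp φ f' l := by
  induction hl : l.length using Nat.strong_induction_on generalizing φ l with
  | _ n ih =>
    subst hl
    cases l with
    | nil => rfl
    | cons x l =>
      simp only [cmp_cons]
      refine splitSum_congr fun u w huw => ?_
      have hw := length_lt_of_append huw x
      rw [h (x :: u) (by simp) (by subst huw; simp)]
      exact ih _ hw (fun v hv hle => h v hv (by omega)) rfl

/-- `cmp` is multiplicative with respect to the deconcatenation of lists. -/
theorem cmp_splitSum (K : List A → List A → B) (f : List A → A) (l : List A) :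
    cmp (splitSum K) f l = splitSum (fun u w => cmp (fun L => cmp (K L) f w) f u) l := by
  induction h : l.length using Nat.strong_induction_on generalizing K l with
  | _ n ih =>
    subst h
    cases l with
    | nil => rfl
    | cons x l =>
      have key : ∀ u w, u ++ w = l →
          cmp (fun l' => splitSum K (f (x :: u) :: l')) f w =
            cmp (fun l' => K [] (f (x :: u) :: l')) f w +
            splitSum (fun w₁ w₂ => cmp (fun L => cmp (K (f (x :: u) :: L)) f w₂) f w₁) w := by
        intro u w huw
        simp only [splitSum_cons]
        rw [cmp_add_left, ih _ (length_lt_of_append huw x) (fun L => K (f (x :: u) :: L)) _ rfl]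
      rw [cmp_cons, splitSum_congr key, splitSum_add, splitSum_cons, cmp_nil, cmp_cons,
        ← splitSum_assoc fun u w₁ w₂ => cmp (fun L => cmp (K (f (x :: u) :: L)) f w₂) f w₁]
      simp only [cmp_cons]

/-- Additivity in each input. -/
def Additive [Add A] (φ : List A → B) : Prop :=
  ∀ (xs ys : List A) (a b : A), φ (xs ++ (a + b) :: ys) = φ (xs ++ a :: ys) + φ (xs ++ b :: ys)

end Operations

/-! ### Pre-Lie identity, and compatibility of insertion with composition -/

section Identities

variable {A B : Type} [AddCommGroup A] [AddCommGroup B]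

theorem Additive.cons {φ : List A → B} (h : Additive φ) (x : A) :
    Additive fun l => φ (x :: l) := fun xs ys a b => h (x :: xs) ys a b

theorem Additive.map_zero {φ : List A → B} (h : Additive φ) (xs ys : List A) :
    φ (xs ++ 0 :: ys) = 0 := by
  have := h xs ys 0 0
  rwa [add_zero, left_eq_add] at this

/-- The first input of an additive map, the others being fixed. -/
def Additive.head {φ : List A → B} (h : Additive φ) (l : List A) : A →+ B :=
  AddMonoidHom.mk' (fun a => φ (a :: l)) fun a b => h [] l a b

theorem Additive.head_apply {φ : List A → B} (h : Additive φ) (l : List A) (a : A) :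
    h.head l a = φ (a :: l) := rfl

/-- The first input of an additive map, the others being composed with `f`. -/
def Additive.cmpHead {φ : List A → B} (h : Additive φ) (f : List A → A) (l : List A) : A →+ B :=
  AddMonoidHom.mk' (fun a => cmp (fun l' => φ (a :: l')) f l) fun a b => by
    rw [← cmp_add_left]
    congr 1
    funext l'
    exact h [] l' a b

theorem Additive.cmpHead_apply {φ : List A → B} (h : Additive φ) (f : List A → A) (l : List A)
    (a : A) : h.cmpHead f l a = cmp (fun l' => φ (a :: l')) f l := rfl

theorem ins_add_right {φ : List A → B} (hφ : Additive φ) (ψ ψ' : List A → A) (l : List A) :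
    ins φ (fun l => ψ l + ψ' l) l = ins φ ψ l + ins φ ψ' l := by
  induction l generalizing φ with
  | nil => simp [ins_nil]
  | cons x l ih =>
    simp only [ins_cons]
    have h : splitSum (fun u w => φ ((ψ (x :: u) + ψ' (x :: u)) :: w)) l =
        splitSum (fun u w => φ (ψ (x :: u) :: w)) l +
          splitSum (fun u w => φ (ψ' (x :: u) :: w)) l := by
      rw [← splitSum_add]
      exact splitSum_congr fun u w _ => hφ [] w _ _
    rw [ih (hφ.cons x), h]
    abel

/-- The pre-Lie identity in characteristic two. -/
theorem ins_ins (hB : ∀ b : B, b + b = 0) {φ : List A → B} (hφ : Additive φ) (μ : List A → A)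
    (l : List A) : ins (ins φ μ) μ l = ins φ (ins μ μ) l := by
  induction l generalizing φ with
  | nil => rfl
  | cons x l ih =>
    have h1 : ins (fun l' => ins φ μ (x :: l')) μ l =
        splitSum (fun u w => φ (ins (fun u' => μ (x :: u')) μ u :: w)) l +
          splitSum (fun u w => ins (fun w' => φ (μ (x :: u) :: w')) μ w) l +
          ins (fun l' => φ (x :: l')) (ins μ μ) l := by
      rw [← ih (hφ.cons x), ← splitSum_add]
      simp only [ins_cons φ]
      rw [ins_add_left, ins_splitSum]
      congr 1
      refine splitSum_congr fun u w _ => ?_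
      rw [← hφ.head_apply w, map_ins]
      rfl
    have h2 : splitSum (fun u w => ins φ μ (μ (x :: u) :: w)) l =
        splitSum (fun u w => φ (splitSum (fun u₁ u₂ => μ (μ (x :: u₁) :: u₂)) u :: w)) l +
          splitSum (fun u w => ins (fun w' => φ (μ (x :: u) :: w')) μ w) l := by
      simp only [ins_cons φ]
      rw [splitSum_add, ← splitSum_assoc fun u₁ u₂ w => φ (μ (μ (x :: u₁) :: u₂) :: w)]
      congr 1
      refine splitSum_congr fun u w _ => ?_
      rw [← hφ.head_apply w, map_splitSum]
      rfl
    have h3 : splitSum (fun u w => φ (ins μ μ (x :: u) :: w)) l =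
        splitSum (fun u w => φ (splitSum (fun u₁ u₂ => μ (μ (x :: u₁) :: u₂)) u :: w)) l +
        splitSum (fun u w => φ (ins (fun u' => μ (x :: u')) μ u :: w)) l := by
      rw [← splitSum_add]
      exact splitSum_congr fun u w _ => hφ [] w _ _
    rw [ins_cons, ins_cons, h1, h2, h3]
    -- Here `s` collects the insertions into two disjoint blocks, the earlier one containing `x`.
    -- Each occurs twice, once for either order of the insertions, and cancels in characteristic
    -- two.
    have h4 : ∀ a b c s : B, a + s + (b + s + c) = a + b + c := fun a b c s => by
      rw [show a + s + (b + s + c) = a + b + c + (s + s) by abel, hB, add_zero]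
    exact h4 _ _ _ _

/-- The output of `μ` lies in exactly one block of the decomposition; this block carries `ins f μ`
and the others carry `f`. -/
theorem ins_cmp {φ : List A → B} (hφ : Additive φ) (f μ : List A → A) (l : List A) :
    ins (cmp φ f) μ l = cmpOne φ f (ins f μ) l := by
  induction h : l.length using Nat.strong_induction_on generalizing φ l with
  | _ n ih =>
    subst h
    cases l with
    | nil => rfl
    | cons x l =>
      simp only [ins_cons (cmp φ f), cmp_cons φ, cmpOne_cons]
      rw [ins_splitSum,
        ← splitSum_assoc fun u₁ u₂ w => cmp (fun l' => φ (f (μ (x :: u₁) :: u₂) :: l')) f w,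
        ← splitSum_add]
      refine splitSum_congr fun u w huw => ?_
      rw [ih _ (length_lt_of_append huw x) (hφ.cons _) _ rfl, ← add_assoc]
      congr 1
      simp only [← hφ.cmpHead_apply]
      rw [← map_splitSum, ← map_ins, ← map_add]
      rfl

/-- The consecutive blocks whose images enter `μ` are united into one chosen block, which then
carries `cmp μ f`. -/
theorem cmp_ins {φ : List A → B} (hφ : Additive φ) (f μ : List A → A) (l : List A) :
    cmp (ins φ μ) f l = cmpOne φ f (cmp μ f) l := by
  induction h : l.length using Nat.strong_induction_on generalizing φ l with
  | _ n ih =>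
    subst h
    cases l with
    | nil => rfl
    | cons x l =>
      simp only [cmp_cons (ins φ μ), ins_cons φ, cmpOne_cons]
      rw [splitSum_add]
      have h1 : ∀ u w, u ++ w = l → cmp (fun l' => splitSum (fun u_1 w =>
          φ (μ (f (x :: u) :: u_1) :: w)) l' + ins (fun l'_1 => φ (f (x :: u) :: l'_1)) μ l') f w =
          splitSum (fun w₁ w₂ => hφ.cmpHead f w₂ (cmp (fun L => μ (f (x :: u) :: L)) f w₁)) w +
          cmpOne (fun l' => φ (f (x :: u) :: l')) f (cmp μ f) w := by
        intro u w huw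
        rw [cmp_add_left, ih _ (length_lt_of_append huw x) (hφ.cons _) _ rfl,
          cmp_splitSum (fun u_1 w => φ (μ (f (x :: u) :: u_1) :: w))]
        congr 1
        refine splitSum_congr fun w₁ w₂ _ => ?_
        rw [map_cmp]
        rfl
      rw [splitSum_congr h1, splitSum_add, ← splitSum_assoc fun u w₁ w₂ =>
        hφ.cmpHead f w₂ (cmp (fun L => μ (f (x :: u) :: L)) f w₁)]
      congr 1
      refine splitSum_congr fun u w _ => ?_
      rw [← hφ.cmpHead_apply, cmp_cons, map_splitSum]

/-- Both sides are sums over decompositions into blocks that are themselves decomposed into blocks.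
-/
theorem cmp_cmp {φ : List A → B} (hφ : Additive φ) (f g : List A → A) (l : List A) :
    cmp (cmp φ f) g l = cmp φ (cmp f g) l := by
  induction h : l.length using Nat.strong_induction_on generalizing φ l with
  | _ n ih =>
    subst h
    cases l with
    | nil => rfl
    | cons x l =>
      simp only [cmp_cons (cmp φ f), cmp_cons φ]
      have h1 : ∀ u w, u ++ w = l → cmp (fun l' => splitSum (fun u_1 w =>
          cmp (fun l'_1 => φ (f (g (x :: u) :: u_1) :: l'_1)) f w) l') g w =
          splitSum (fun w₁ w₂ => hφ.cmpHead (cmp f g) w₂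
            (cmp (fun L => f (g (x :: u) :: L)) g w₁)) w := by
        intro u w huw
        rw [cmp_splitSum (fun u_1 w => cmp (fun l'_1 => φ (f (g (x :: u) :: u_1) :: l'_1)) f w)]
        refine splitSum_congr fun w₁ w₂ hw => ?_
        rw [map_cmp]
        congr 1
        funext L
        refine ih _ ?_ (hφ.cons _) _ rfl
        subst hw huw
        simp; omega
      rw [splitSum_congr h1, ← splitSum_assoc fun u w₁ w₂ => hφ.cmpHead (cmp f g) w₂
            (cmp (fun L => f (g (x :: u) :: L)) g w₁)]
      refine splitSum_congr fun u w _ => ?_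
      rw [← hφ.cmpHead_apply, cmp_cons, map_splitSum]

end Identities

end AInf

namespace AInf

/-! ### Agreement of the recursive forms with the defining sums -/

section Bridge

variable {A : Type} [Ring A]

theorem insertion_eq_ins (φ ψ : List A → A) (l : List A) : insertion φ ψ l = ins φ ψ l := by
  induction l generalizing φ with
  | nil => simp [insertion, ins_nil]
  | cons x l ih =>
    rw [ins_cons, ← ih, splitSum_eq_sum, insertion, List.length_cons, Finset.sum_range_succ',
      add_comm]
    simp [insertion, add_right_comm _ 1]

/-- A composition of `n + 1`, from its first block and the composition formed by the others. -/
def consComposition {n : ℕ} (p : Σ q : Fin (n + 1), Composition (n - q)) : Composition (n + 1) where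
  blocks := (p.1 + 1 : ℕ) :: p.2.blocks
  blocks_pos := by
    intro i hi
    rcases List.mem_cons.1 hi with rfl | hi
    · exact Nat.succ_pos _
    · exact p.2.blocks_pos hi
  blocks_sum := by
    rw [List.sum_cons, p.2.blocks_sum]
    have := p.1.2
    omega

theorem consComposition_bijective (n : ℕ) : Function.Bijective (consComposition (n := n)) := by
  constructor
  · rintro ⟨q, c⟩ ⟨q', c'⟩ h
    have hb : (q + 1 : ℕ) :: c.blocks = (q' + 1 : ℕ) :: c'.blocks :=
      congrArg Composition.blocks h
    obtain ⟨h1, h2⟩ := List.cons.inj hb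
    obtain rfl : q = q' := Fin.ext (by omega)
    obtain rfl : c = c' := Composition.ext h2
    rfl
  · intro c
    obtain ⟨blocks, pos, sum⟩ := c
    cases blocks with
    | nil => simp at sum
    | cons b bs =>
      have hb : 0 < b := pos (by simp)
      rw [List.sum_cons] at sum
      refine ⟨⟨⟨b - 1, by omega⟩, ⟨bs, fun hi => pos (by simp [hi]), by simp; omega⟩⟩, ?_⟩
      apply Composition.ext
      change (b - 1 + 1) :: bs = b :: bs
      rw [Nat.sub_add_cancel hb]

/-- Splitting off the first block of a composition reproduces the recursion `cmp_cons`. The number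
`n` is kept apart from `l.length` so that the induction can pass to `l.drop q`. -/
theorem sum_composition_eq_cmp (ψ φ : List A → A) (n : ℕ) (l : List A) (hl : l.length = n) :
    ∑ c : Composition n, ψ ((l.splitWrtCompositionAux c.blocks).map φ) = cmp ψ φ l := by
  induction n using Nat.strong_induction_on generalizing ψ l with
  | _ n ih =>
    cases l with
    | nil =>
      obtain rfl : n = 0 := hl.symm
      have h : ∀ c : Composition 0, c.blocks = [] := by
        intro c
        have := c.blocks_sum
        rcases hb : c.blocks with _ | ⟨b, bs⟩
        · rfl
        · have hb' := c.blocks_pos (i := b) (by simp [hb])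
          rw [hb, List.sum_cons] at this
          omega
      rw [Finset.sum_congr rfl fun c _ => by rw [h c], Finset.sum_const, Finset.card_univ,
        composition_card]
      exact one_smul _ _
    | cons x l =>
      obtain rfl : n = l.length + 1 := hl.symm
      rw [← (consComposition_bijective l.length).sum_comp, Fintype.sum_sigma, cmp_cons,
        splitSum_eq_sum, ← Fin.sum_univ_eq_sum_range
          fun q => cmp (fun l' => ψ (φ (x :: l.take q) :: l')) φ (l.drop q)]
      refine Finset.sum_congr rfl fun q _ => ?_
      rw [← ih (l.length - q) (by omega) _ _ (by simp)]
      refine Finset.sum_congr rfl fun c _ => ?_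
      simp [consComposition, List.splitWrtCompositionAux_cons]

theorem compose_eq_cmp (ψ φ : List A → A) (l : List A) : compose ψ φ l = cmp ψ φ l :=
  sum_composition_eq_cmp ψ φ _ l rfl

end Bridge

end AInf

namespace AInf

/-! ### Cases in which few terms survive -/

section Single

variable {X A B : Type} [AddCommGroup B]

theorem splitSum_eq_first {G : List X → List X → B} {l : List X}
    (h : ∀ u w, u ++ w = l → u ≠ [] → G u w = 0) : splitSum G l = G [] l := by
  cases l with
  | nil => rfl
  | cons x l =>
    rw [splitSum_cons, splitSum_eq_zero, add_zero]
    exact fun u w huw => h _ _ (by rw [← huw]; rfl) (by simp)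

theorem splitSum_eq_last {G : List X → List X → B} {l : List X}
    (h : ∀ u w, u ++ w = l → w ≠ [] → G u w = 0) : splitSum G l = G l [] := by
  induction l generalizing G with
  | nil => rfl
  | cons x l ih =>
    rw [splitSum_cons, h [] (x :: l) rfl (by simp), zero_add,
      ih fun u w huw => h _ _ (by rw [← huw]; rfl)]

/-- Every list is empty, a singleton, or has distinct first and last entries. -/
theorem list_cases (l : List X) : l = [] ∨ (∃ x, l = [x]) ∨ ∃ x l' y, l = x :: (l' ++ [y]) := by
  rcases l with _ | ⟨x, l⟩
  · exact Or.inl rfl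
  · rcases List.eq_nil_or_concat l with rfl | ⟨l', y, rfl⟩
    · exact Or.inr (Or.inl ⟨x, rfl⟩)
    · exact Or.inr (Or.inr ⟨x, l', y, by simp⟩)

theorem ins_of_unary {φ : List A → B} (h : ∀ l, l.length ≠ 1 → φ l = 0) (ψ : List A → A)
    {l : List A} (hl : l ≠ []) : ins φ ψ l = φ [ψ l] := by
  cases l with
  | nil => exact absurd rfl hl
  | cons x l =>
    rw [ins_cons, splitSum_eq_last, ins_eq_zero, add_zero]
    · intro u v w _ _
      exact h _ (by simp)
    · intro u w _ hw
      exact h _ (by simpa using hw)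

theorem cmp_singleton (φ : List A → B) (f : List A → A) (x : A) : cmp φ f [x] = φ [f [x]] := rfl

theorem cmp_eq_zero {φ : List A → B} {f : List A → A} {l : List A}
    (h : ∀ L, L.length ≤ l.length → φ L = 0) : cmp φ f l = 0 := by
  induction hl : l.length using Nat.strong_induction_on generalizing φ l with
  | _ n ih =>
    subst hl
    cases l with
    | nil => exact h [] le_rfl
    | cons x l =>
      rw [cmp_cons]
      refine splitSum_eq_zero fun u w huw => ?_
      have hw := length_lt_of_append huw x
      refine ih _ hw (fun L hL => h _ ?_) rfl
      simp only [List.length_cons] at hw ⊢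
      omega

theorem cmp_of_unary {φ : List A → B} (h : ∀ l, l.length ≠ 1 → φ l = 0) (f : List A → A)
    {l : List A} (hl : l ≠ []) : cmp φ f l = φ [f l] := by
  cases l with
  | nil => exact absurd rfl hl
  | cons x l =>
    rw [cmp_cons, splitSum_eq_last]
    · rfl
    · intro u w _ hw
      cases w with
      | nil => exact absurd rfl hw
      | cons y w =>
        rw [cmp_cons]
        refine splitSum_eq_zero fun u' w' _ => ?_
        rw [← cmp_zero_left f w']
        congr 1
        funext l'
        exact h _ (by simp)

/-- If `φ` vanishes on lists shorter than `l` and `f_1` is the identity, only the finest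
decomposition of `l` contributes to `cmp φ f l`. -/
theorem cmp_finest {φ : List A → B} {f : List A → A} (hf : ∀ a, f [a] = a) {l : List A}
    (h : ∀ L, L.length < l.length → φ L = 0) : cmp φ f l = φ l := by
  induction l generalizing φ with
  | nil => rfl
  | cons x l ih =>
    rw [cmp_cons, splitSum_eq_first, hf, ih]
    · exact fun L hL => h _ (by simpa using hL)
    · intro u w huw hu
      refine cmp_eq_zero fun L hL => h _ ?_
      have := List.length_pos_iff.2 hu
      subst huw
      simp; omega

variable [AddCommGroup A]

theorem cmpOne_eq_zero {φ : List A → B} (hφ : Additive φ) {f g : List A → A} {l : List A}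
    (h : ∀ v, v ≠ [] → v.length ≤ l.length → g v = 0) : cmpOne φ f g l = 0 := by
  induction hl : l.length using Nat.strong_induction_on generalizing φ l with
  | _ n ih =>
    subst hl
    cases l with
    | nil => rfl
    | cons x l =>
      rw [cmpOne_cons]
      refine splitSum_eq_zero fun u w huw => ?_
      have hw := length_lt_of_append huw x
      rw [ih _ hw (hφ.cons _) (fun v hv hle => h v hv (by omega)) rfl, ← hφ.cmpHead_apply,
        h (x :: u) (by simp) (by subst huw; simp), map_zero, zero_add]

theorem cmpOne_unary {φ : List A → B} (hφ : Additive φ) {f g : List A → A} {l : List A}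
    (hl : l ≠ []) (h : ∀ v, v.length < l.length → g v = 0) : cmpOne φ f g l = φ [g l] := by
  cases l with
  | nil => exact absurd rfl hl
  | cons x l =>
    rw [cmpOne_cons, splitSum_eq_last, cmpOne_nil, add_zero, cmp_nil]
    intro u w huw hw
    have h1 := length_lt_of_append huw x
    have h2 := List.length_pos_iff.2 hw
    rw [cmpOne_eq_zero (hφ.cons _) fun v _ hv => h v (by omega), ← hφ.cmpHead_apply,
      h (x :: u) (by subst huw; simp; omega), map_zero, zero_add]

/-- The block of `g` must omit at most one letter of the list. If it is the whole list, `φ` has a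
single input and vanishes; otherwise it omits the first or the last letter. -/
theorem cmpOne_binary {φ : List A → B} (hφ : Additive φ) (h1 : ∀ a, φ [a] = 0)
    {f g : List A → A} {x y : A} {l : List A} (h : ∀ v, v.length ≤ l.length → g v = 0) :
    cmpOne φ f g (x :: (l ++ [y])) = φ [f [x], g (l ++ [y])] + φ [g (x :: l), f [y]] := by
  rw [cmpOne_cons, splitSum_append_singleton, cmpOne_nil, cmp_nil, h1, add_zero, add_zero,
    splitSum_add, add_comm]
  congr 1
  · rw [splitSum_eq_first, cmpOne_unary (hφ.cons _) (by simp)]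
    · exact fun v hv => h v (by simpa [Nat.lt_succ_iff] using hv)
    · intro u w huw hu
      refine cmpOne_eq_zero (hφ.cons _) fun v _ hv => h v ?_
      have := List.length_pos_iff.2 hu
      subst huw
      simp at hv ⊢; omega
  · rw [splitSum_eq_last, List.nil_append, cmp_singleton]
    intro u w huw hw
    rw [← hφ.cmpHead_apply, h, map_zero]
    have := List.length_pos_iff.2 hw
    subst huw
    simp; omega

theorem cmpOne_add {φ : List A → B} (hφ : Additive φ) (f g g' : List A → A) (l : List A) :
    cmpOne φ f (fun l => g l + g' l) l = cmpOne φ f g l + cmpOne φ f g' l := by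
  induction hl : l.length using Nat.strong_induction_on generalizing φ l with
  | _ n ih =>
    subst hl
    cases l with
    | nil => exact (add_zero _).symm
    | cons x l =>
      simp only [cmpOne_cons]
      rw [← splitSum_add]
      refine splitSum_congr fun u w huw => ?_
      rw [ih _ (length_lt_of_append huw x) (hφ.cons _) _ rfl]
      simp only [← hφ.cmpHead_apply, map_add]
      abel

/-- Changing `f` on lists of the length of `l` only. -/
theorem cmp_perturb_unary {φ : List A → B} (hφ : Additive φ) {f ψ : List A → A} {l : List A}
    (hl : l ≠ []) (hψ : ∀ v, v.length ≠ l.length → ψ v = 0) :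
    cmp φ (fun v => f v + ψ v) l = cmp φ f l + φ [ψ l] := by
  cases l with
  | nil => exact absurd rfl hl
  | cons x l =>
    -- The extra term is written as a sum over splittings concentrated at `w = []`, so that the two
    -- sides can be compared termwise.
    have key : splitSum (fun u w => if w = [] then φ [ψ (x :: u)] else 0) l = φ [ψ (x :: l)] := by
      rw [splitSum_eq_last (by intro u w _ hw; rw [if_neg hw]), if_pos rfl]
    rw [cmp_cons, cmp_cons, ← key, ← splitSum_add]
    refine splitSum_congr fun u w huw => ?_
    split_ifs with hw
    · subst hw
      exact hφ [] [] _ _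
    · have h1 := length_lt_of_append huw x
      have h2 := List.length_pos_iff.2 hw
      rw [hψ (x :: u) (by subst huw; simp; omega), add_zero, add_zero]
      exact cmp_congr fun v _ hv => by rw [hψ v (by omega), add_zero]

end Single

end AInf

namespace AInf

/-! ### The Hochschild differential and normalized cochains -/

section Hochschild

variable {A : Type} [Ring A]

/-- The multiplication, as a family of maps whose only nonzero member is the binary one. -/
def mul2 : List A → A
  | [a, b] => a * b
  | _ => 0

theorem mul2_pair (a b : A) : mul2 [a, b] = a * b := rfl

theorem mul2_of_length {l : List A} (h : l.length ≠ 2) : mul2 l = 0 := by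
  match l with
  | [] => rfl
  | [_] => rfl
  | [_, _] => exact absurd rfl h
  | _ :: _ :: _ :: _ => rfl

theorem mul2_additive : Additive (mul2 : List A → A) := by
  intro xs ys a b
  match xs, ys with
  | [], [] => simp [mul2]
  | [], [y] => exact add_mul a b y
  | [], _ :: _ :: _ => simp [mul2]
  | [x], [] => exact mul_add x a b
  | [x], _ :: _ => simp [mul2]
  | _ :: _ :: _, _ =>
    rw [mul2_of_length (by simp), mul2_of_length (by simp),
      mul2_of_length (by simp), add_zero]

theorem mul2_map_zero (xs ys : List A) : mul2 (xs ++ 0 :: ys) = 0 := mul2_additive.map_zero xs ys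

theorem idHom_of_length {l : List A} (h : l.length ≠ 1) : idHom l = 0 := by
  match l with
  | [] => rfl
  | [_] => exact absurd rfl h
  | _ :: _ :: _ => rfl

/-- The Hochschild differential, in characteristic two. -/
def delta (φ : List A → A) (l : List A) : A := ins mul2 φ l + ins φ mul2 l

theorem ins_mul2_left_singleton (φ : List A → A) (x : A) : ins mul2 φ [x] = 0 := by
  simp [ins_cons, ins_nil, splitSum_nil, mul2]

theorem ins_mul2_left (φ : List A → A) (x y : A) (l : List A) :
    ins mul2 φ (x :: (l ++ [y])) = x * φ (l ++ [y]) + φ (x :: l) * y := by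
  rw [ins_cons, splitSum_append_singleton, splitSum_eq_last,
    ins_of_unary (fun l hl => mul2_of_length (by simpa using hl)) _ (by simp)]
  · rw [show mul2 [φ (x :: (l ++ [y]))] = 0 from rfl, add_zero, add_comm]
    rfl
  · intro u w _ hw
    exact mul2_of_length (by simpa using hw)

theorem ins_mul2_right_cons {φ : List A → A} (hφ : Additive φ) (x y : A) (l : List A) :
    ins φ mul2 (x :: y :: l) = φ (x * y :: l) + ins (fun l' => φ (x :: l')) mul2 (y :: l) := by
  rw [ins_cons, splitSum_cons, splitSum_eq_first]
  · rw [show mul2 [x] = 0 from rfl, show φ (0 :: y :: l) = 0 from hφ.map_zero [] _, zero_add]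
    rfl
  · intro u w _ hu
    have := List.length_pos_iff.2 hu
    rw [mul2_of_length (by simp; omega)]
    exact hφ.map_zero [] _

theorem ins_mul2_right_singleton {φ : List A → A} (hφ : Additive φ) (x : A) :
    ins φ mul2 [x] = 0 := by
  rw [ins_cons, ins_nil, splitSum_nil, add_zero]
  exact hφ.map_zero [] _

/-- Vanishing on all lists that contain `1`. -/
def Normal (φ : List A → A) : Prop := ∀ l, 1 ∈ l → φ l = 0

theorem Normal.cons {φ : List A → A} (h : Normal φ) (x : A) : Normal fun l => φ (x :: l) :=
  fun _ hl => h _ (List.mem_cons_of_mem x hl)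

theorem Normal.add {φ ψ : List A → A} (hφ : Normal φ) (hψ : Normal ψ) :
    Normal fun l => φ l + ψ l := fun l hl => by
  simp only [hφ l hl, hψ l hl, add_zero]

theorem Normal.ins {φ ψ : List A → A} (hφ : Normal φ) (ha : Additive φ) (hψ : Normal ψ) :
    Normal (ins φ ψ) := fun _ hl => ins_eq_zero fun u v w _ h => by
  rw [← h, List.mem_append, List.mem_append] at hl
  by_cases hv : 1 ∈ v
  · rw [hψ v hv]
    exact ha.map_zero u w
  · exact hφ _ (by simp only [List.mem_append, List.mem_cons]; tauto)

theorem Normal.cmp {φ f : List A → A} (hφ : Normal φ) (ha : Additive φ)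
    (hf : ∀ l, 1 ∈ l → l.length ≠ 1 → f l = 0) (hf1 : f [1] = 1) : Normal (cmp φ f) := by
  intro l
  induction hl : l.length using Nat.strong_induction_on generalizing φ l with
  | _ n ih =>
    subst hl
    intro h1
    cases l with
    | nil => exact hφ [] h1
    | cons x l =>
      rw [cmp_cons]
      refine splitSum_eq_zero fun u w huw => ?_
      by_cases hw : 1 ∈ w
      · exact ih _ (length_lt_of_append huw x) (hφ.cons _) (ha.cons _) _ rfl hw
      · have hxu : 1 ∈ x :: u := by
          rw [← huw, List.mem_cons, List.mem_append] at h1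
          rw [List.mem_cons]; tauto
        by_cases hu : u = []
        · subst hu
          obtain rfl : 1 = x := by simpa using hxu
          rw [hf1, ← cmp_zero_left f w]
          congr 1
          funext l'
          exact hφ _ (by simp)
        · rw [← ha.cmpHead_apply, hf _ hxu (by simpa using hu), map_zero]

variable (h2 : ∀ a : A, a + a = 0)
include h2

/-- Multiplying `1` into its left and into its right neighbour gives the same list, so these terms
cancel. Only a `1` in last position, which has no right neighbour, leaves a term. -/
theorem ins_mul2_right_one {φ : List A → A} (ha : Additive φ) (hφ : Normal φ) (x : A)
    (xs ys : List A) :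
    ins φ mul2 (x :: (xs ++ 1 :: ys)) = if ys = [] then φ (x :: xs) else 0 := by
  induction xs generalizing φ x with
  | nil =>
    rw [List.nil_append, ins_mul2_right_cons ha, mul_one]
    cases ys with
    | nil => rw [ins_mul2_right_singleton (ha.cons x), add_zero, if_pos rfl]
    | cons y ys =>
      rw [ins_mul2_right_cons (ha.cons x), one_mul, if_neg (by simp), ← add_assoc, h2, zero_add]
      exact ins_eq_zero fun _ _ _ _ _ => hφ _ (by simp)
  | cons x' xs ih =>
    rw [List.cons_append, ins_mul2_right_cons ha, hφ (x * x' :: (xs ++ 1 :: ys)) (by simp),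
      zero_add, ih (ha.cons x) (hφ.cons x)]

/-- An inner `1` cancels between its two neighbours; a `1` at either end cancels against the
corresponding outer multiplication. -/
theorem Normal.delta {φ : List A → A} (ha : Additive φ) (hφ : Normal φ) : Normal (delta φ) := by
  intro l hl
  obtain ⟨xs, ys, rfl⟩ := List.append_of_mem hl
  unfold AInf.delta
  cases xs with
  | nil =>
    rcases List.eq_nil_or_concat' ys with rfl | ⟨ys', y, rfl⟩
    · rw [List.nil_append, ins_mul2_left_singleton, ins_mul2_right_singleton ha, add_zero]
    · have h3 : AInf.ins (fun l' => φ (1 :: l')) mul2 (ys' ++ [y]) = 0 :=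
        ins_eq_zero fun _ _ _ _ _ => hφ _ (by simp)
      rw [List.nil_append, ins_mul2_left, one_mul, hφ (1 :: ys') (by simp), zero_mul, add_zero]
      cases ys' with
      | nil =>
        rw [List.nil_append] at h3 ⊢
        rw [ins_mul2_right_cons ha, h3, one_mul, add_zero, h2]
      | cons z zs =>
        rw [List.cons_append] at h3 ⊢
        rw [ins_mul2_right_cons ha, h3, one_mul, add_zero, h2]
  | cons x xs =>
    rw [List.cons_append, ins_mul2_right_one h2 ha hφ]
    rcases List.eq_nil_or_concat' ys with rfl | ⟨ys', y, rfl⟩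
    · rw [ins_mul2_left, hφ (xs ++ [1]) (by simp), mul_zero, zero_add, mul_one, if_pos rfl, h2]
    · rw [show xs ++ 1 :: (ys' ++ [y]) = (xs ++ 1 :: ys') ++ [y] by simp, ins_mul2_left, if_neg (by simp),
        hφ ((xs ++ 1 :: ys') ++ [y]) (by simp), hφ (x :: (xs ++ 1 :: ys')) (by simp), mul_zero,
        zero_mul, add_zero, add_zero]

omit h2 in
theorem Additive.add {φ ψ : List A → A} (hφ : Additive φ) (hψ : Additive ψ) :
    Additive fun l => φ l + ψ l := fun xs ys a b => by
  simp only [hφ xs ys, hψ xs ys]; abel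

theorem ins_mul2_mul2 (l : List A) : ins mul2 mul2 l = 0 := by
  rcases list_cases l with rfl | ⟨x, rfl⟩ | ⟨x, l, y, rfl⟩
  · rfl
  · exact ins_mul2_left_singleton _ _
  · match l with
    | [] =>
      rw [ins_mul2_left, mul2_of_length (by simp), mul2_of_length (by simp), mul_zero, zero_mul,
        add_zero]
    | [z] =>
      rw [ins_mul2_left, List.singleton_append, mul2_pair, mul2_pair, mul_assoc, h2]
    | _ :: _ :: _ =>
      rw [ins_mul2_left, mul2_of_length (by simp), mul2_of_length (by simp), mul_zero, zero_mul,
        add_zero]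

end Hochschild

end AInf

namespace AInf

/-! ### Obstructions are normalized cocycles -/

section Obstruction

variable {A : Type} [Ring A]

/-- The conditions on the operations of a strictly unital deformation, except for `K`-linearity
and the `A∞` relations. -/
structure PreDeformation (μ : List A → A) : Prop where
  additive : Additive μ
  nil : μ [] = 0
  one : ∀ a, μ [a] = 0
  two : ∀ a b, μ [a, b] = a * b
  normal : ∀ l, 1 ∈ l → l.length ≠ 2 → μ l = 0

/-- The conditions on the components of a strictly unital homomorphism with identical linear part,
except for `K`-linearity and the `A∞` relations. -/
structure PreHom (f : List A → A) : Prop where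
  additive : Additive f
  nil : f [] = 0
  one : ∀ a, f [a] = a
  normal : ∀ l, 1 ∈ l → l.length ≠ 1 → f l = 0

theorem PreDeformation.eq_mul2 {μ : List A → A} (h : PreDeformation μ) {l : List A}
    (hl : l.length ≤ 2) : μ l = mul2 l := by
  match l with
  | [] => exact h.nil
  | [a] => exact h.one a
  | [a, b] => exact h.two a b
  | _ :: _ :: _ :: _ => simp at hl

theorem idHom_additive : Additive (idHom : List A → A) := by
  intro xs ys a b
  match xs, ys with
  | [], [] => rfl
  | [], _ :: _ => simp [idHom]
  | _ :: _, _ =>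
    rw [idHom_of_length (by simp), idHom_of_length (by simp), idHom_of_length (by simp), add_zero]

theorem Additive.sub {φ ψ : List A → A} (hφ : Additive φ) (hψ : Additive ψ) :
    Additive fun l => φ l - ψ l := fun xs ys a b => by
  simp only [hφ xs ys, hψ xs ys]; abel

theorem PreDeformation.normal_sub {μ : List A → A} (h : PreDeformation μ) :
    Normal fun l => μ l - mul2 l := fun l hl => by
  by_cases h2 : l.length = 2
  · simp only [h.eq_mul2 h2.le, sub_self]
  · simp only [h.normal l hl h2, mul2_of_length h2, sub_self]

theorem PreHom.eq_idHom {f : List A → A} (h : PreHom f) {l : List A} (hl : l.length = 1) :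
    f l = idHom l := by
  match l with
  | [a] => exact h.one a

theorem PreHom.normal_sub {f : List A → A} (h : PreHom f) :
    Normal fun l => f l - idHom l := fun l hl => by
  by_cases h1 : l.length = 1
  · simp only [h.eq_idHom h1, sub_self]
  · simp only [h.normal l hl h1, idHom_of_length h1, sub_self]

/-- The sum of `f(u) g(w)` over all ways of writing a list as `u ++ w`. -/
def cup (f g : List A → A) (l : List A) : A := splitSum (fun u w => f u * g w) l

theorem cup_add_left (f f' g : List A → A) (l : List A) :
    cup (fun l => f l + f' l) g l = cup f g l + cup f' g l := by
  simp only [cup, add_mul, splitSum_add]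

theorem cup_add_right (f g g' : List A → A) (l : List A) :
    cup f (fun l => g l + g' l) l = cup f g l + cup f g' l := by
  simp only [cup, mul_add, splitSum_add]

theorem cup_idHom_left (g : List A → A) (x : A) (l : List A) :
    cup idHom g (x :: l) = x * g l := by
  rw [cup, splitSum_cons, splitSum_eq_first]
  · rw [idHom_of_length (by simp), zero_mul, zero_add]
    rfl
  · intro u w _ hu
    rw [idHom_of_length (by simpa using hu), zero_mul]

theorem cup_idHom_right (f : List A → A) (y : A) (l : List A) :
    cup f idHom (l ++ [y]) = f l * y := by
  rw [cup, splitSum_append_singleton, splitSum_eq_last]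
  · rw [idHom_of_length (l := []) (by simp), mul_zero, add_zero]
    rfl
  · intro u w _ hw
    rw [idHom_of_length (by simpa using hw), mul_zero]

/-- The two cup products with the identity are the two outer terms of the Hochschild differential.
-/
theorem cup_idHom {φ : List A → A} (h0 : φ [] = 0) (l : List A) :
    cup idHom φ l + cup φ idHom l = ins mul2 φ l := by
  rcases list_cases l with rfl | ⟨x, rfl⟩ | ⟨x, l, y, rfl⟩
  · simp [cup, splitSum_nil, ins_nil, h0]
  · rw [ins_mul2_left_singleton, cup_idHom_left, h0, mul_zero, zero_add]
    have := cup_idHom_right φ x []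
    rw [List.nil_append] at this
    rw [this, h0, zero_mul]
  · rw [cup_idHom_left, ← List.cons_append, cup_idHom_right, List.cons_append, ins_mul2_left]

theorem cup_idHom_idHom (l : List A) : cup idHom idHom l = mul2 l := by
  match l with
  | [] => simp [cup, splitSum_nil, idHom, mul2]
  | [x] => rw [cup_idHom_left, idHom_of_length (by simp), mul_zero]; rfl
  | [x, y] => rw [cup_idHom_left]; rfl
  | x :: y :: z :: l => rw [cup_idHom_left, idHom_of_length (by simp), mul_zero]; rfl

theorem Normal.cup {f g : List A → A} (hf : Normal f) (hg : Normal g) : Normal (cup f g) :=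
  fun l hl => splitSum_eq_zero fun u w h => by
    rw [← h, List.mem_append] at hl
    rcases hl with hl | hl
    · rw [hf u hl, zero_mul]
    · rw [hg w hl, mul_zero]

theorem cmp_mul2 {f : List A → A} (h0 : f [] = 0) (l : List A) : cmp mul2 f l = cup f f l := by
  cases l with
  | nil => simp [cmp_nil, cup, splitSum_nil, h0, mul2]
  | cons x l =>
    rw [cmp_cons, cup, splitSum_cons, h0, zero_mul, zero_add]
    refine splitSum_congr fun u w _ => ?_
    cases w with
    | nil => rw [h0, mul_zero]; rfl
    | cons y w =>
      rw [cmp_of_unary (fun l hl => mul2_of_length (by simpa using hl)) _ (by simp)]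
      rfl

theorem ins_idHom (ψ : List A → A) {l : List A} (hl : l ≠ []) : ins idHom ψ l = ψ l :=
  ins_of_unary (fun _ h => idHom_of_length h) ψ hl

theorem cmp_idHom {f : List A → A} (h0 : f [] = 0) (l : List A) : cmp idHom f l = f l := by
  cases l with
  | nil => exact h0.symm
  | cons x l => exact cmp_of_unary (fun _ h => idHom_of_length h) f (by simp)

/-- The failure of the `A∞` relation for a homomorphism. -/
def homObs (f D E : List A → A) (l : List A) : A := ins f D l + cmp E f l

variable (h2 : ∀ a : A, a + a = 0)
include h2

/-- With `μ = mul2 + ν`, the insertion of `μ` into itself is `delta ν + ins ν ν`, since the purely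
binary term is the associator. Both summands are normal because `ν` is. -/
theorem PreDeformation.normal_ins {μ : List A → A} (h : PreDeformation μ) : Normal (ins μ μ) := by
  intro l hl
  obtain ⟨ν, hν⟩ : ∃ ν : List A → A, ν = fun l => μ l - mul2 l := ⟨_, rfl⟩
  have hμ : μ = fun l => mul2 l + ν l := by funext l; simp [hν]
  have hn : Normal ν := hν ▸ h.normal_sub
  have ha : Additive ν := hν ▸ h.additive.sub mul2_additive
  rw [hμ, ins_add_left, ins_add_right mul2_additive, ins_add_right ha, ins_mul2_mul2 h2, zero_add,
    ← add_assoc, hn.ins ha hn l hl, add_zero]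
  exact hn.delta h2 ha l hl

/-- After subtracting `mul2` from `D` and `E` and the identity from `f`, the remainders are normal.
On a list containing `1` the terms built from products of remainders vanish, the two copies of
`mul2` cancel, and `delta` of the remainder of `f` is left. -/
theorem PreHom.normal_homObs {f D E : List A → A} (hf : PreHom f) (hD : PreDeformation D)
    (hE : PreDeformation E) : Normal (homObs f D E) := by
  intro l hl
  obtain ⟨ν, hν⟩ : ∃ ν : List A → A, ν = fun l => D l - mul2 l := ⟨_, rfl⟩
  have hD' : D = fun l => mul2 l + ν l := by funext l; simp [hν]
  have hνn : Normal ν := hν ▸ hD.normal_sub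
  have hνa : Additive ν := hν ▸ hD.additive.sub mul2_additive
  obtain ⟨ε, hε⟩ : ∃ ε : List A → A, ε = fun l => E l - mul2 l := ⟨_, rfl⟩
  have hE' : E = fun l => mul2 l + ε l := by funext l; simp [hε]
  have hεn : Normal ε := hε ▸ hE.normal_sub
  have hεa : Additive ε := hε ▸ hE.additive.sub mul2_additive
  obtain ⟨g, hg⟩ : ∃ g : List A → A, g = fun l => f l - idHom l := ⟨_, rfl⟩
  have hf' : f = fun l => idHom l + g l := by funext l; simp [hg]
  have hgn : Normal g := hg ▸ hf.normal_sub
  have hga : Additive g := hg ▸ hf.additive.sub idHom_additive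
  have hg0 : g [] = 0 := by simp [hg, hf.nil, idHom]
  have hl0 : l ≠ [] := by rintro rfl; simp at hl
  have e1 : ins f D l = mul2 l + ins g mul2 l := by
    rw [hD', ins_add_right hf.additive, hf', ins_add_left, ins_add_left, ins_idHom _ hl0,
      ins_idHom _ hl0, hgn.ins hga hνn l hl, hνn l hl, add_zero, add_zero]
  have e2 : cmp E f l = mul2 l + ins mul2 g l := by
    rw [hE', cmp_add_left, hεn.cmp hεa hf.normal (hf.one 1) l hl, add_zero, cmp_mul2 hf.nil, hf',
      cup_add_left, cup_add_right, cup_add_right, cup_idHom_idHom, hgn.cup hgn l hl, add_zero,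
      add_assoc, cup_idHom hg0]
  have e3 := hgn.delta h2 hga l hl
  rw [delta, add_comm] at e3
  rw [homObs, e1, e2, add_add_add_comm, h2, zero_add, e3]

/-- A Bianchi identity: by the pre-Lie identity, inserting `μ` into the obstruction equals inserting
the obstruction into `μ`. In `n + 1` inputs the obstruction must take at least `n` of them, so only
the binary part of `μ` contributes on either side. -/
theorem PreDeformation.delta_ins {μ : List A → A} (h : PreDeformation μ) {l : List A} {n : ℕ}
    (hn : ∀ l, l.length < n → ins μ μ l = 0) (hl : l.length = n + 1) : delta (ins μ μ) l = 0 := by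
  have e1 : ins (ins μ μ) μ l = ins (ins μ μ) mul2 l := ins_congr fun u v w hv huw => by
    by_cases hv2 : v.length ≤ 2
    · rw [h.eq_mul2 hv2]
    · rw [← huw] at hl
      simp only [List.length_append] at hl
      rw [hn _ (by simp; omega), hn _ (by simp; omega)]
  have e2 : ins μ (ins μ μ) l = ins mul2 (ins μ μ) l := ins_congr fun u v w hv huw => by
    by_cases hv2 : v.length < n
    · rw [hn v hv2, h.additive.map_zero, mul2_map_zero]
    · rw [← huw] at hl
      simp only [List.length_append] at hl
      exact h.eq_mul2 (by simp; omega)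
  rw [delta, ← e1, ← e2, ins_ins h2 h.additive, h2]

/-- Inserting `D` into the obstruction equals putting the obstruction into one block below `E`: the
terms containing `ins D D` and `ins E E` vanish, and the mixed ones agree by `ins_cmp`. For reasons
of length both sides reduce to multiplication, and they form the two halves of `delta`. -/
theorem PreHom.delta_homObs {f D E : List A → A} (hf : PreHom f) (hD : PreDeformation D)
    (hE : PreDeformation E) (hDD : ∀ l, ins D D l = 0) (hEE : ∀ l, ins E E l = 0) {l : List A}
    {n : ℕ} (hn : ∀ l, l.length < n → homObs f D E l = 0) (hl : l.length = n + 1) :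
    delta (homObs f D E) l = 0 := by
  have e1 : ins (homObs f D E) D l = ins (homObs f D E) mul2 l :=
    ins_congr fun u v w hv huw => by
      by_cases hv2 : v.length ≤ 2
      · rw [hD.eq_mul2 hv2]
      · rw [← huw] at hl
        simp only [List.length_append] at hl
        rw [hn _ (by simp; omega), hn _ (by simp; omega)]
  have e2 : cmpOne E f (homObs f D E) l = ins mul2 (homObs f D E) l := by
    rcases list_cases l with rfl | ⟨x, rfl⟩ | ⟨x, l, y, rfl⟩
    · rfl
    · rw [ins_mul2_left_singleton, cmpOne_cons, splitSum_nil, cmp_nil, cmpOne_nil, hE.one,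
        add_zero]
    · rw [cmpOne_binary hE.additive hE.one, ins_mul2_left, hE.two, hE.two, hf.one, hf.one]
      intro v hv
      simp at hl
      exact hn v (by omega)
  have e3 : ins (homObs f D E) D l = cmpOne E f (homObs f D E) l := by
    have z1 : ins f (ins D D) l = 0 := ins_eq_zero fun u v w _ _ => by
      rw [hDD, hf.additive.map_zero]
    have z2 : cmpOne E f (cmp E f) l = 0 := by
      rw [← cmp_ins hE.additive, show ins E E = fun _ => 0 from funext hEE, cmp_zero_left]
    unfold homObs
    rw [ins_add_left, ins_ins h2 hf.additive, z1, zero_add, ins_cmp hE.additive,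
      cmpOne_add hE.additive, z2, add_zero]
  rw [delta, ← e1, e3, e2, h2]

end Obstruction

/-! ### Changing one component changes the obstruction by a coboundary -/

section Perturbation

variable {A : Type} [Ring A]

theorem delta_of_length_le {ψ : List A → A} (ha : Additive ψ) {m : ℕ}
    (hψ : ∀ l, l.length ≠ m → ψ l = 0) {l : List A} (hl : l.length ≤ m) : delta ψ l = 0 := by
  rw [delta, ins_eq_zero, ins_eq_zero, add_zero]
  · intro u v w hv huw
    have := List.length_pos_iff.2 hv
    by_cases h1 : v.length = 2
    · subst huw
      simp only [List.length_append] at hl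
      exact hψ _ (by simp; omega)
    · rw [mul2_of_length h1, ha.map_zero]
  · intro u v w hv huw
    by_cases h1 : v.length = m
    · subst huw
      simp only [List.length_append] at hl
      exact mul2_of_length (by simp; omega)
    · rw [hψ v h1, mul2_map_zero]

theorem ins_eq_ins_mul2_left {μ ψ : List A → A} (h : PreDeformation μ) {m : ℕ}
    (hψ : ∀ l, l.length ≠ m → ψ l = 0) {l : List A} (hl : l.length ≤ m + 1) :
    ins μ ψ l = ins mul2 ψ l := ins_congr fun u v w _ huw => by
  by_cases h1 : v.length = m
  · subst huw
    simp only [List.length_append] at hl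
    exact h.eq_mul2 (by simp; omega)
  · rw [hψ v h1, h.additive.map_zero, mul2_map_zero]

theorem ins_eq_ins_mul2_right {μ ψ : List A → A} (h : PreDeformation μ) {m : ℕ}
    (hψ : ∀ l, l.length ≠ m → ψ l = 0) {l : List A} (hl : l.length ≤ m + 1) :
    ins ψ μ l = ins ψ mul2 l := ins_congr fun u v w _ huw => by
  by_cases h1 : v.length ≤ 2
  · rw [h.eq_mul2 h1]
  · subst huw
    simp only [List.length_append] at hl
    rw [hψ _ (by simp; omega), hψ _ (by simp; omega)]

/-- The quadratic term in `ψ` needs `2m - 1` inputs, which exceeds `m + 1` for `m ≥ 3`. In the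
linear terms there is room only for the binary part of `μ`. -/
theorem PreDeformation.ins_perturb {μ ψ : List A → A} (h : PreDeformation μ) (ha : Additive ψ)
    {m : ℕ} (hm : 3 ≤ m) (hψ : ∀ l, l.length ≠ m → ψ l = 0) {l : List A}
    (hl : l.length ≤ m + 1) :
    ins (fun l => μ l + ψ l) (fun l => μ l + ψ l) l = ins μ μ l + delta ψ l := by
  have h0 : ins ψ ψ l = 0 := ins_eq_zero fun u v w _ huw => by
    by_cases h1 : v.length = m
    · subst huw
      simp only [List.length_append] at hl
      exact hψ _ (by simp; omega)
    · rw [hψ v h1, ha.map_zero]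
  rw [ins_add_left, ins_add_right h.additive, ins_add_right ha, h0, add_zero, add_assoc,
    ins_eq_ins_mul2_left h hψ hl, ins_eq_ins_mul2_right h hψ hl, delta]

theorem cmp_perturb_of_length_le {φ f ψ : List A → A} (hφ : Additive φ) {m : ℕ} {l : List A}
    (hl : l ≠ []) (hψ : ∀ v, v.length ≠ m → ψ v = 0) (hm : l.length ≤ m) :
    cmp φ (fun v => f v + ψ v) l = cmp φ f l + φ [ψ l] := by
  by_cases h : l.length = m
  · exact cmp_perturb_unary hφ hl fun v hv => hψ v (by omega)
  · rw [hψ l h, show φ [0] = 0 from hφ.map_zero [] [], add_zero]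
    exact cmp_congr fun v _ hv => by rw [hψ v (by omega), add_zero]

/-- Two blocks carrying `ψ` would need `2m > m + 1` inputs. One such block leaves at most one
further letter, and `E` has no unary part, so only the product of `ψ` with that letter appears. -/
theorem cmp_perturb {E f ψ : List A → A} (hE : PreDeformation E) (hf : ∀ a, f [a] = a) {m : ℕ}
    (hm : 2 ≤ m) (hψ : ∀ l, l.length ≠ m → ψ l = 0) {l : List A} (hl : l.length ≤ m + 1) :
    cmp E (fun l => f l + ψ l) l = cmp E f l + ins mul2 ψ l := by
  have hψ1 : ∀ a, ψ [a] = 0 := fun a => hψ _ (by simp; omega)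
  rcases list_cases l with rfl | ⟨x, rfl⟩ | ⟨x, l, y, rfl⟩
  · simp [cmp_nil, ins_nil]
  · rw [cmp_singleton, cmp_singleton, ins_mul2_left_singleton, hE.one, hE.one, add_zero]
  · simp only [List.length_cons, List.length_append, List.length_nil] at hl
    have k1 : splitSum (fun u w => if u = [] then x * ψ (w ++ [y]) else 0) l =
        x * ψ (l ++ [y]) := by
      rw [splitSum_eq_first (by intro u w _ hu; rw [if_neg hu]), if_pos rfl]
    have k2 : splitSum (fun u w => if w = [] then ψ (x :: u) * y else 0) l =
        ψ (x :: l) * y := by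
      rw [splitSum_eq_last (by intro u w _ hu; rw [if_neg hu]), if_pos rfl]
    rw [ins_mul2_left, cmp_cons, cmp_cons, splitSum_append_singleton, splitSum_append_singleton,
      cmp_nil, cmp_nil, hE.one, hE.one, add_zero, add_zero, ← k1, ← k2, ← splitSum_add,
      ← splitSum_add]
    refine splitSum_congr fun u w huw => ?_
    subst huw
    simp only [List.length_append] at hl
    rcases u with _ | ⟨a, u⟩ <;> rcases w with _ | ⟨b, w⟩
    · simp only [List.nil_append, List.length_nil] at hl ⊢
      simp [cmp_singleton, hψ1, hE.two]
    · simp only [List.length_nil, List.length_cons] at hl ⊢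
      rw [if_pos trivial, if_neg (by simp), add_zero, hψ1, add_zero,
        cmp_perturb_of_length_le (hE.additive.cons _) (by simp) hψ (by simp; omega), hE.two, hf]
    · simp only [List.nil_append]
      rw [cmp_singleton, cmp_singleton, hE.two, hE.two, if_neg (by simp), if_pos trivial, hψ1,
        add_zero, zero_add, hf, add_mul]
    · simp only [List.length_cons] at hl
      rw [if_neg (by simp), if_neg (by simp), add_zero, add_zero,
        hψ (x :: a :: u) (by simp; omega), add_zero]
      exact cmp_congr fun v _ hv => by
        rw [hψ v (by simp at hv; omega), add_zero]

theorem PreHom.homObs_perturb {f D E ψ : List A → A} (hf : PreHom f) (hD : PreDeformation D)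
    (hE : PreDeformation E) {m : ℕ} (hm : 2 ≤ m) (hψ : ∀ l, l.length ≠ m → ψ l = 0) {l : List A}
    (hl : l.length ≤ m + 1) :
    homObs (fun l => f l + ψ l) D E l = homObs f D E l + delta ψ l := by
  rw [homObs, homObs, delta, cmp_perturb hE hf.one hm hψ hl, ins_add_left,
    ins_eq_ins_mul2_right hD hψ hl]
  abel

end Perturbation

end AInf

namespace AInf

/-! ### Limits of successive corrections -/

section Limit

variable {X B : Type}

/-- If functions satisfying `P n` can be improved to satisfy `P (n + 1)` by changing their values
on lists of length `n` only, there is a function which agrees, on lists of any bounded length, with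
functions satisfying `P n` for some large `n`. -/
theorem exists_limit {P : ℕ → (List X → B) → Prop} {N : ℕ} {f₀ : List X → B} (h₀ : P N f₀)
    (step : ∀ n, N ≤ n → ∀ f, P n f → ∃ g, P (n + 1) g ∧ ∀ l, l.length ≠ n → g l = f l) :
    ∃ f : List X → B, (∀ l, l.length < N → f l = f₀ l) ∧
      ∀ m, ∃ n, m ≤ n ∧ N ≤ n ∧ ∃ g, P n g ∧ ∀ l, l.length < n → f l = g l := by
  choose! next hnext hagree using step
  let F : ℕ → List X → B := fun k => Nat.rec f₀ (fun k f => next (N + k) f) k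
  have hF : ∀ k, P (N + k) (F k) := by
    intro k
    induction k with
    | zero => exact h₀
    | succ k ih => exact hnext (N + k) (by omega) _ ih
  have hstep : ∀ k l, l.length < N + k → F (k + 1) l = F k l := fun k l hl =>
    hagree (N + k) (by omega) _ (hF k) l (by omega)
  have hstab : ∀ k j l, l.length < N + k → F (k + j) l = F k l := by
    intro k j l hl
    induction j with
    | zero => rfl
    | succ j ih => rw [← add_assoc, hstep _ _ (by omega), ih]
  have hlim : ∀ k l, l.length < N + k → F (l.length + 1 - N) l = F k l := by
    intro k l hl
    obtain ⟨j, rfl⟩ : ∃ j, k = l.length + 1 - N + j := ⟨k - (l.length + 1 - N), by omega⟩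
    rw [hstab _ _ _ (by omega)]
  -- From stage `k` on, values on lists shorter than `N + k` no longer change, so this is a final
  -- stage for `l`. Truncated subtraction gives stage `0` for lists shorter than `N`.
  refine ⟨fun l => F (l.length + 1 - N) l, fun l hl => hlim 0 l hl, fun m => ?_⟩
  exact ⟨N + m, by omega, by omega, F m, hF m, hlim m⟩

end Limit

/-! ### Left inverses of homomorphisms -/

section Inverse

variable {A : Type} [Ring A]

theorem ins_congr_of_length {φ φ' ψ ψ' : List A → A} {n : ℕ}
    (h : ∀ l, l.length < n → φ l = φ' l) (h' : ∀ l, l.length < n → ψ l = ψ' l) {l : List A}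
    (hl : l.length < n) : ins φ ψ l = ins φ' ψ' l := ins_congr fun u v w hv huw => by
  have := List.length_pos_iff.2 hv
  subst huw
  simp only [List.length_append] at hl
  rw [h' v (by omega), h _ (by simp; omega)]

theorem cmp_congr_left {φ φ' f : List A → A} {l : List A}
    (h : ∀ L, L.length ≤ l.length → φ L = φ' L) : cmp φ f l = cmp φ' f l := by
  induction hl : l.length using Nat.strong_induction_on generalizing φ φ' l with
  | _ n ih =>
    subst hl
    cases l with
    | nil => exact h [] le_rfl
    | cons x l =>
      simp only [cmp_cons]
      refine splitSum_congr fun u w huw => ?_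
      have hw := length_lt_of_append huw x
      exact ih _ hw (fun L hL => h _ (by simp at hw ⊢; omega)) rfl

/-- An `A∞` homomorphism with identical linear part has a left inverse. The properties `Q n`
are those to be inherited by the inverse. -/
theorem exists_cmp_eq_idHom {f : List A → A} (hf : ∀ a, f [a] = a) {Q : (List A → A) → Prop}
    (hQ : Q idHom)
    (step : ∀ n, 2 ≤ n → ∀ g, Q g → (∀ l, l.length < n → cmp g f l = idHom l) →
      Q fun l => g l + if l.length = n then idHom l - cmp g f l else 0) :
    ∃ g, cmp g f = idHom ∧ ∀ m, ∃ g', Q g' ∧ ∀ l, l.length ≤ m → g l = g' l := by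
  obtain ⟨g, -, hg⟩ := exists_limit
    (P := fun n g => Q g ∧ ∀ l, l.length < n → cmp g f l = idHom l) (N := 2) (f₀ := idHom)
    ⟨hQ, fun l hl => by
      match l with
      | [] => rfl
      | [a] => exact hf a⟩ (by
    rintro n hn g ⟨hg, hgf⟩
    refine ⟨_, ⟨step n hn g hg hgf, fun l hl => ?_⟩, fun l hl => by rw [if_neg hl, add_zero]⟩
    -- The correction vanishes in fewer than `n` inputs and `f_1` is the identity, so on at most `n`
    -- inputs only the finest decomposition sees it; the defect is cancelled exactly.
    rw [cmp_add_left, cmp_finest (φ := fun l => if l.length = n then _ else _) hf]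
    · split_ifs with h
      · abel
      · rw [add_zero, hgf l (by omega)]
    · exact fun L hL => if_neg (by omega))
  refine ⟨g, funext fun l => ?_, fun m => ?_⟩
  · obtain ⟨n, hn, -, g', ⟨-, h1⟩, h2⟩ := hg (l.length + 1)
    rw [← h1 l hn]
    exact cmp_congr_left fun L hL => h2 L (by omega)
  · obtain ⟨n, hn, -, g', ⟨h1, -⟩, h2⟩ := hg (m + 1)
    exact ⟨g', h1, fun l hl => h2 l (by omega)⟩

end Inverse

/-! ### Additivity and scalar equivariance of insertion and composition -/

section Multilinear

variable {A B : Type} [AddCommGroup A] [AddCommGroup B]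

theorem splitSum_additive {G : List A → List A → B} (h₁ : ∀ w, Additive fun u => G u w)
    (h₂ : ∀ u, Additive (G u)) : Additive (splitSum G) := by
  intro xs ys a b
  induction xs generalizing G with
  | nil =>
    simp only [List.nil_append, splitSum_cons]
    rw [show G [] ((a + b) :: ys) = G [] (a :: ys) + G [] (b :: ys) from h₂ [] [] ys a b,
      show splitSum (fun u w => G ((a + b) :: u) w) ys = splitSum (fun u w => G (a :: u) w) ys +
        splitSum (fun u w => G (b :: u) w) ys from
          (splitSum_congr fun u w _ => h₁ w [] u a b).trans (splitSum_add _ _ _)]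
    abel
  | cons x xs ih =>
    simp only [List.cons_append, splitSum_cons]
    rw [ih (G := fun u w => G (x :: u) w) (fun w => (h₁ w).cons x) fun u => h₂ (x :: u),
      show G [] (x :: (xs ++ (a + b) :: ys)) = _ from h₂ [] (x :: xs) ys a b]
    simp only [List.cons_append]
    abel

theorem Additive.ins {φ : List A → B} {ψ : List A → A} (hφ : Additive φ) (hψ : Additive ψ) :
    Additive (ins φ ψ) := by
  intro xs ys a b
  induction xs generalizing φ with
  | nil =>
    simp only [List.nil_append, ins_cons]
    have h1 : (fun l' => φ ((a + b) :: l')) = fun l' => φ (a :: l') + φ (b :: l') :=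
      funext fun l' => hφ [] l' a b
    have h2 : splitSum (fun u w => φ (ψ ((a + b) :: u) :: w)) ys =
        splitSum (fun u w => φ (ψ (a :: u) :: w)) ys +
          splitSum (fun u w => φ (ψ (b :: u) :: w)) ys := by
      rw [← splitSum_add]
      refine splitSum_congr fun u w _ => ?_
      rw [show ψ ((a + b) :: u) = _ from hψ [] u a b]
      exact hφ [] w _ _
    rw [h1, ins_add_left, h2]
    abel
  | cons x xs ih =>
    simp only [List.cons_append, ins_cons]
    rw [ih (hφ.cons x), splitSum_additive (G := fun u w => φ (ψ (x :: u) :: w))]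
    · abel
    · intro w us vs a b
      beta_reduce
      rw [show ψ (x :: (us ++ (a + b) :: vs)) = _ from hψ (x :: us) vs a b]
      exact hφ [] w _ _
    · exact fun u => hφ.cons _

theorem Additive.cmpAux {φ : List A → B} {f g : List A → A} (hφ : Additive φ) (hf : Additive f)
    (hg : Additive g) : Additive (cmpAux f φ g) := by
  intro xs ys a b
  induction xs generalizing φ g with
  | nil =>
    have key : ∀ {ψ : List A → B} {h : List A → A}, Additive ψ → Additive h →
        AInf.cmpAux f ψ (fun u => h ((a + b) :: u)) ys =
          AInf.cmpAux f ψ (fun u => h (a :: u)) ys + AInf.cmpAux f ψ (fun u => h (b :: u)) ys := by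
      intro ψ h hψ hh
      rw [cmpAux_eq, cmpAux_eq, cmpAux_eq, ← splitSum_add]
      refine splitSum_congr fun u w _ => ?_
      rw [show h ((a + b) :: u) = _ from hh [] u a b]
      exact map_add (hψ.cmpHead f w) _ _
    simp only [List.nil_append, AInf.cmpAux]
    rw [key (hφ.cons _) hf, key hφ hg]
    abel
  | cons x xs ih =>
    simp only [List.cons_append, AInf.cmpAux]
    rw [ih (hφ.cons _) (hf.cons x), ih hφ (hg.cons x)]
    abel

theorem Additive.cmp {φ : List A → B} {f : List A → A} (hφ : Additive φ) (hf : Additive f) :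
    Additive (cmp φ f) := by
  intro xs ys a b
  cases xs with
  | nil =>
    simp only [List.nil_append, cmp_cons]
    rw [← splitSum_add]
    refine splitSum_congr fun u w _ => ?_
    rw [show f ((a + b) :: u) = _ from hf [] u a b]
    exact map_add (hφ.cmpHead f w) _ _
  | cons x xs => exact hφ.cmpAux hf (hf.cons x) xs ys a b

/-- Applying `T` to any input amounts to applying `S` to the output. -/
def Equivariant (T : A →+ A) (S : B →+ B) (φ : List A → B) : Prop :=
  ∀ (xs ys : List A) (a : A), φ (xs ++ T a :: ys) = S (φ (xs ++ a :: ys))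

variable {T : A →+ A} {S : B →+ B}

theorem Equivariant.cons {φ : List A → B} (h : Equivariant T S φ) (x : A) :
    Equivariant T S fun l => φ (x :: l) := fun xs ys a => h (x :: xs) ys a

theorem splitSum_equivariant {G : List A → List A → B} (h₁ : ∀ w, Equivariant T S fun u => G u w)
    (h₂ : ∀ u, Equivariant T S (G u)) : Equivariant T S (splitSum G) := by
  intro xs ys a
  induction xs generalizing G with
  | nil =>
    simp only [List.nil_append, splitSum_cons, map_add, map_splitSum]
    rw [show G [] (T a :: ys) = S (G [] (a :: ys)) from h₂ [] [] ys a]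
    congr 1
    exact splitSum_congr fun u w _ => h₁ w [] u a
  | cons x xs ih =>
    simp only [List.cons_append, splitSum_cons, map_add]
    rw [ih (G := fun u w => G (x :: u) w) (fun w => (h₁ w).cons x) fun u => h₂ (x :: u),
      show G [] (x :: (xs ++ T a :: ys)) = _ from h₂ [] (x :: xs) ys a]
    rfl

theorem Equivariant.ins {φ : List A → B} {ψ : List A → A} (hφ : Equivariant T S φ)
    (hψ : Equivariant T T ψ) : Equivariant T S (ins φ ψ) := by
  intro xs ys a
  induction xs generalizing φ with
  | nil =>
    simp only [List.nil_append, ins_cons, map_add, map_splitSum, map_ins]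
    congr 1
    · refine splitSum_congr fun u w _ => ?_
      rw [show ψ (T a :: u) = _ from hψ [] u a]
      exact hφ [] w _
    · congr 1
      exact funext fun l' => hφ [] l' a
  | cons x xs ih =>
    simp only [List.cons_append, ins_cons, map_add]
    rw [ih (hφ.cons x), splitSum_equivariant (G := fun u w => φ (ψ (x :: u) :: w))]
    · intro w us vs a
      beta_reduce
      rw [show ψ (x :: (us ++ T a :: vs)) = _ from hψ (x :: us) vs a]
      exact hφ [] w _
    · exact fun u => hφ.cons _

theorem Equivariant.cmpAux {φ : List A → B} {f g : List A → A} (hφ : Equivariant T S φ)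
    (hf : Equivariant T T f) (hg : Equivariant T T g) :
    Equivariant T S (cmpAux f φ g) := by
  intro xs ys a
  induction xs generalizing φ g with
  | nil =>
    have key : ∀ {ψ : List A → B} {h : List A → A}, Equivariant T S ψ → Equivariant T T h →
        AInf.cmpAux f ψ (fun u => h (T a :: u)) ys =
          S (AInf.cmpAux f ψ (fun u => h (a :: u)) ys) := by
      intro ψ h hψ hh
      rw [cmpAux_eq, cmpAux_eq, map_splitSum]
      refine splitSum_congr fun u w _ => ?_
      rw [show h (T a :: u) = _ from hh [] u a, map_cmp]
      congr 1
      exact funext fun l' => hψ [] l' _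
    simp only [List.nil_append, AInf.cmpAux, map_add]
    rw [key (hφ.cons _) hf, key hφ hg]
  | cons x xs ih =>
    simp only [List.cons_append, AInf.cmpAux, map_add]
    rw [ih (hφ.cons _) (hf.cons x), ih hφ (hg.cons x)]

theorem Equivariant.cmp {φ : List A → B} {f : List A → A} (hφ : Equivariant T S φ)
    (hf : Equivariant T T f) : Equivariant T S (cmp φ f) := by
  intro xs ys a
  cases xs with
  | nil =>
    simp only [List.nil_append, cmp_cons, map_splitSum]
    refine splitSum_congr fun u w _ => ?_
    rw [show f (T a :: u) = _ from hf [] u a, map_cmp]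
    congr 1
    exact funext fun l' => hφ [] l' _
  | cons x xs => exact hφ.cmpAux hf (hf.cons x) xs ys a

end Multilinear

/-! ### The inverse of a homomorphism is a homomorphism -/

section InverseHom

variable {A : Type} [Ring A]

theorem cmp_idHom_right {φ : List A → A} (hφ : Additive φ) (l : List A) : cmp φ idHom l = φ l := by
  induction l generalizing φ with
  | nil => rfl
  | cons x l ih =>
    rw [cmp_cons, splitSum_eq_first]
    · exact ih (hφ.cons x)
    · intro u w _ hu
      rw [← hφ.cmpHead_apply, idHom_of_length (by simpa using hu), map_zero]

/-- If `f` is a homomorphism from `D` to `E` with two-sided inverse `g`, then `g` is a homomorphism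
from `E` to `D`. -/
theorem ins_eq_cmp_of_inverse {f g D E : List A → A} (hg : Additive g) (hE : Additive E)
    (hD0 : D [] = 0) (hgf : cmp g f = idHom) (hfg : cmp f g = idHom) (h : ins f D = cmp E f) :
    ins g E = cmp D g := by
  -- Composing `ins g E` with `f` replaces `cmp E f` by `ins f D` in one block, which is `D`
  -- inserted into `cmp g f = idHom`. Composing the resulting identity with `g` then removes `f`.
  have h1 : cmp (ins g E) f = D := by
    funext l
    rw [cmp_ins hg, ← h, ← ins_cmp hg, hgf]
    cases l with
    | nil => exact hD0.symm
    | cons x l => exact ins_idHom _ (by simp)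
  funext l
  rw [← cmp_idHom_right (hg.ins hE) l, ← hfg, ← cmp_cmp (hg.ins hE), h1]

end InverseHom

end AInf

namespace Torus

open AInf

/-! ### Coefficients in the torus algebra -/

section Coefficients

/-- The coefficient of a basic element, as a linear form. -/
def co (b : Basic) : Alg →ₗ[F2U] F2U := Finsupp.lapply (R := F2U) (M := F2U) b

/-- The coefficient of `U^k b`. -/
def cf (x : Alg) (b : Basic) (k : ℕ) : ZMod 2 := (co b x).coeff k

theorem cf_zero (b : Basic) (k : ℕ) : cf 0 b k = 0 := by
  rw [cf, map_zero, coeff_zero]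

theorem cf_add (x y : Alg) (b : Basic) (k : ℕ) : cf (x + y) b k = cf x b k + cf y b k := by
  rw [cf, map_add, coeff_add]; rfl

theorem alg_ext {x y : Alg} (h : ∀ b, co b x = co b y) : x = y :=
  Finsupp.ext (M := F2U) h

theorem alg_ext_cf {x y : Alg} (h : ∀ b k, cf x b k = cf y b k) : x = y :=
  alg_ext fun b => Polynomial.ext fun k => h b k

theorem eq_zero_of_cf {x : Alg} (h : ∀ b k, cf x b k = 0) : x = 0 :=
  alg_ext_cf fun b k => by rw [h, cf_zero]

open Classical in
theorem co_of (b c : Basic) : co b (Alg.of c) = if c = b then 1 else 0 :=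
  Finsupp.single_apply (M := F2U)

open Classical in
theorem cf_of (b c : Basic) (k : ℕ) : cf (Alg.of c) b k = if c = b ∧ k = 0 then 1 else 0 := by
  rw [cf, co_of]
  by_cases h : c = b <;> simp [h, coeff_one]

open Classical in
theorem cf_smul_of (r : F2U) (b c : Basic) (k : ℕ) :
    cf (r • Alg.of c) b k = if c = b then r.coeff k else 0 := by
  rw [cf, map_smul, co_of]
  by_cases h : c = b <;> simp [h]

theorem alg_induction {p : Alg → Prop} (hof : ∀ b, p (Alg.of b))
    (hadd : ∀ x y, p x → p y → p (x + y)) (hsmul : ∀ (r : F2U) x, p x → p (r • x)) (x : Alg) :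
    p x := by
  have h0 : p 0 := by
    have := hsmul 0 _ (hof (.idem 0))
    rwa [zero_smul] at this
  refine Finsupp.induction_linear (motive := p) (x : Basic →₀ F2U) h0 hadd fun b r => ?_
  have := hsmul r _ (hof b)
  rwa [show r • Alg.of b = Finsupp.single b r by
    rw [Alg.of]; erw [Finsupp.smul_single_one]] at this

theorem add_self (x : Alg) : x + x = 0 := by
  rw [← two_smul F2U x, show (2 : F2U) = 0 from CharTwo.two_eq_zero, zero_smul]

/-- Expand `x` in basic elements and multiply polynomials: a nonzero coefficient requires a nonzero
summand. Gradings are traced through composite operations in this way. -/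
theorem exists_cf_of_linear (L : Alg →ₗ[F2U] Alg) {x : Alg} {b : Basic} {k : ℕ}
    (h : cf (L x) b k ≠ 0) :
    ∃ c i j, i + j = k ∧ cf x c i ≠ 0 ∧ cf (L (Alg.of c)) b j ≠ 0 := by
  by_contra! hne
  apply h
  have hx : co b (L x) = ∑ c ∈ (show Basic →₀ F2U from x).support,
      co c x * co b (L (Alg.of c)) := by
    have h : (co b).comp L = (Finsupp.linearCombination F2U (fun c => co b (L (Alg.of c))) :
        (Basic →₀ F2U) →ₗ[F2U] F2U) := by
      refine Alg.hom_ext fun c => Eq.symm ?_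
      exact (Finsupp.linearCombination_single F2U 1 c).trans (one_smul _ _)
    exact congrArg (fun F : Alg →ₗ[F2U] F2U => F x) h
  rw [cf, hx, finsetSum_coeff]
  refine Finset.sum_eq_zero fun c _ => ?_
  rw [coeff_mul]
  refine Finset.sum_eq_zero fun p hp => ?_
  by_cases h0 : cf x c p.1 = 0
  · exact mul_eq_zero_of_left h0 _
  · exact mul_eq_zero_of_right _ (hne c p.1 p.2 (Finset.HasAntidiagonal.mem_antidiagonal.1 hp) h0)

theorem of_mul_of (a b : Basic) : Alg.of a * Alg.of b = Alg.ofOption (Basic.mul a b) :=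
  Alg.mulHom_of a b

theorem smul_mul (r : F2U) (x y : Alg) : (r • x) * y = r • (x * y) := Algebra.smul_mul_assoc r x y

theorem mul_smul' (r : F2U) (x y : Alg) : x * (r • y) = r • (x * y) := Algebra.mul_smul_comm r x y

end Coefficients

/-! ### Multilinear maps over `𝔽₂[U]` and their values on basic elements -/

section Multilinear

/-- `𝔽₂[U]`-linearity in each input. -/
structure Mlin (φ : List Alg → Alg) : Prop where
  add : Additive φ
  smul : ∀ (xs ys : List Alg) (r : F2U) (a : Alg), φ (xs ++ (r • a) :: ys) = r • φ (xs ++ a :: ys)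

/-- Multiplication by a scalar, as an additive map. -/
def smulHom (r : F2U) : Alg →+ Alg := DistribSMul.toAddMonoidHom Alg r

theorem Mlin.equivariant {φ : List Alg → Alg} (h : Mlin φ) (r : F2U) :
    Equivariant (smulHom r) (smulHom r) φ := fun xs ys a => h.smul xs ys r a

theorem Mlin.mk' {φ : List Alg → Alg} (h : Additive φ)
    (h' : ∀ r, Equivariant (smulHom r) (smulHom r) φ) : Mlin φ :=
  ⟨h, fun xs ys r a => h' r xs ys a⟩

theorem Mlin.ins {φ ψ : List Alg → Alg} (hφ : Mlin φ) (hψ : Mlin ψ) : Mlin (ins φ ψ) :=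
  .mk' (hφ.add.ins hψ.add) fun r => (hφ.equivariant r).ins (hψ.equivariant r)

theorem Mlin.cmp {φ f : List Alg → Alg} (hφ : Mlin φ) (hf : Mlin f) : Mlin (cmp φ f) :=
  .mk' (hφ.add.cmp hf.add) fun r => (hφ.equivariant r).cmp (hf.equivariant r)

theorem Mlin.cons {φ : List Alg → Alg} (hφ : Mlin φ) (x : Alg) : Mlin fun l => φ (x :: l) :=
  ⟨hφ.add.cons x, fun xs ys r a => hφ.smul (x :: xs) ys r a⟩

theorem Mlin.sum {φ ψ : List Alg → Alg} (hφ : Mlin φ) (hψ : Mlin ψ) :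
    Mlin fun l => φ l + ψ l :=
  ⟨hφ.add.add hψ.add, fun xs ys r a => by simp only [hφ.smul, hψ.smul, smul_add]⟩

theorem mlin_mul2 : Mlin mul2 where
  add := mul2_additive
  smul xs ys r a := by
    match xs, ys with
    | [], [] => exact (smul_zero r).symm
    | [], [y] => exact smul_mul r a y
    | [], _ :: _ :: _ => exact (smul_zero r).symm
    | [x], [] => exact mul_smul' r x a
    | [x], _ :: _ => exact (smul_zero r).symm
    | _ :: _ :: _, _ =>
      rw [mul2_of_length (by simp), mul2_of_length (by simp), smul_zero]

theorem mlin_idHom : Mlin idHom where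
  add := idHom_additive
  smul xs ys r a := by
    match xs, ys with
    | [], [] => rfl
    | [], _ :: _ => exact (smul_zero r).symm
    | _ :: _, _ => rw [idHom_of_length (by simp), idHom_of_length (by simp), smul_zero]

/-- One input of a multilinear map, the others being fixed. -/
def Mlin.slot {φ : List Alg → Alg} (h : Mlin φ) (xs ys : List Alg) : Alg →ₗ[F2U] Alg where
  toFun a := φ (xs ++ a :: ys)
  map_add' a b := h.add xs ys a b
  map_smul' r a := h.smul xs ys r a

theorem Mlin.exists_cf {φ : List Alg → Alg} (h : Mlin φ) {xs ys : List Alg} {a : Alg} {b : Basic}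
    {k : ℕ} (hb : cf (φ (xs ++ a :: ys)) b k ≠ 0) :
    ∃ c i j, i + j = k ∧ cf a c i ≠ 0 ∧ cf (φ (xs ++ Alg.of c :: ys)) b j ≠ 0 :=
  exists_cf_of_linear (h.slot xs ys) hb

/-- The entries are expanded from left to right, the prefix already consisting of basic elements. -/
theorem list_induction {Q : List Alg → Prop} (hof : ∀ bs : List Basic, Q (bs.map Alg.of))
    (hadd : ∀ xs ys a b, Q (xs ++ a :: ys) → Q (xs ++ b :: ys) → Q (xs ++ (a + b) :: ys))
    (hsmul : ∀ xs ys (r : F2U) a, Q (xs ++ a :: ys) → Q (xs ++ (r • a) :: ys)) (l : List Alg) :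
    Q l := by
  have key : ∀ (l : List Alg) (bs : List Basic), Q (bs.map Alg.of ++ l) := by
    intro l
    induction l with
    | nil => intro bs; rw [List.append_nil]; exact hof bs
    | cons a l ih =>
      intro bs
      refine alg_induction (p := fun a => Q (bs.map Alg.of ++ a :: l)) (fun b => ?_)
        (fun x y => hadd _ _ x y) (fun r x => hsmul _ _ r x) a
      have := ih (bs ++ [b])
      rwa [List.map_append, List.append_assoc] at this
  exact key l []

/-- Linear extension of a function of one basic element. -/
def extLin (F : Basic → Alg) : Alg →ₗ[F2U] Alg :=
  (Finsupp.linearCombination F2U F : (Basic →₀ F2U) →ₗ[F2U] Alg)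

theorem extLin_of (F : Basic → Alg) (b : Basic) : extLin F (Alg.of b) = F b := by
  unfold extLin Alg.of
  erw [Finsupp.linearCombination_single, one_smul]

theorem extLin_add (F G : Basic → Alg) (x : Alg) :
    extLin (fun b => F b + G b) x = extLin F x + extLin G x := by
  have h : extLin (fun b => F b + G b) = extLin F + extLin G :=
    Alg.hom_ext fun b => by rw [LinearMap.add_apply, extLin_of, extLin_of, extLin_of]
  rw [h, LinearMap.add_apply]

theorem extLin_smul (r : F2U) (F : Basic → Alg) (x : Alg) :
    extLin (fun b => r • F b) x = r • extLin F x := by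
  have h : extLin (fun b => r • F b) = r • extLin F :=
    Alg.hom_ext fun b => by rw [LinearMap.smul_apply, extLin_of, extLin_of]
  rw [h, LinearMap.smul_apply]

/-- Multilinear extension of a function of lists of basic elements. -/
def ext : (List Basic → Alg) → List Alg → Alg
  | F, [] => F []
  | F, a :: l => extLin (fun b => ext (fun bs => F (b :: bs)) l) a

theorem ext_of (F : List Basic → Alg) (bs : List Basic) : ext F (bs.map Alg.of) = F bs := by
  induction bs generalizing F with
  | nil => rfl
  | cons b bs ih => rw [List.map_cons, ext, extLin_of, ih]

theorem mlin_ext (F : List Basic → Alg) : Mlin (ext F) where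
  add xs ys a b := by
    induction xs generalizing F with
    | nil => exact map_add _ a b
    | cons x xs ih =>
      simp only [List.cons_append, ext, ih]
      exact extLin_add _ _ x
  smul xs ys r a := by
    induction xs generalizing F with
    | nil => exact map_smul _ r a
    | cons x xs ih =>
      simp only [List.cons_append, ext, ih]
      exact extLin_smul _ _ x

theorem ext_zero {n : ℕ} {F : List Basic → Alg} (h : ∀ bs, bs.length = n → F bs = 0)
    {l : List Alg} (hl : l.length = n) : ext F l = 0 := by
  induction l generalizing F n with
  | nil => exact h [] hl
  | cons a l ih =>
    subst hl
    -- The zero function is written as a scalar multiple so that `extLin_smul` applies.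
    rw [ext, show (fun b => ext (fun bs => F (b :: bs)) l) = fun _ => (0 : F2U) • (0 : Alg) from
      funext fun b => by
        rw [zero_smul]
        exact ih (n := l.length) (fun bs hbs => h _ (by simpa using hbs)) rfl,
      extLin_smul, zero_smul]

end Multilinear

end Torus

namespace Torus

open AInf

/-! ### Paths, gradings and the support relation -/

section Grading

/-- Elements with `a = b = 0` are central, because the cocycle `ad - bc` vanishes on them. Powers of
`λ` and of `γ(U)` can therefore be moved through all products of gradings. -/
theorem lam_comm (g : Gam) : Commute lam g := by
  obtain ⟨⟨⟨m, a, b⟩, h⟩, w⟩ := g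
  refine Prod.ext (Subtype.ext (Triple.ext ?_ ?_ ?_)) (mul_comm _ _) <;>
    simp [lam, Gam.mk, Triple.mul_def] <;> ring

theorem gamU_comm (g : Gam) : Commute gamU g := by
  obtain ⟨⟨⟨m, a, b⟩, h⟩, w⟩ := g
  refine Prod.ext (Subtype.ext (Triple.ext ?_ ?_ ?_)) (mul_comm _ _) <;>
    simp [gamU, Gam.mk, Triple.mul_def] <;> ring

/-- The initial vertex of a basic element. -/
def sB : Basic → ZMod 2
  | .idem x => x
  | .chord i _ => src i

/-- The final vertex of a basic element. -/
def tB : Basic → ZMod 2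
  | .idem x => x
  | .chord i n => src (i + n + 1)

theorem gamBasic_chord_split (i : ZMod 4) (n m : ℕ) :
    gamBasic (.chord i (n + m + 1)) =
      gamBasic (.chord i n) * gamBasic (.chord (i + n + 1) m) := by
  simp only [gamBasic]
  rw [show n + m + 1 + 1 = (n + 1) + (m + 1) by ring, List.range_add, List.map_append,
    List.prod_append, List.map_map]
  congr 3
  funext k
  simp only [Function.comp_apply]
  push_cast
  ring_nf

theorem mul_eq_some {a b c : Basic} (h : Basic.mul a b = some c) :
    tB a = sB b ∧ sB c = sB a ∧ tB c = tB b ∧ gamBasic c = gamBasic a * gamBasic b := by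
  rcases a with x | ⟨i, n⟩ <;> rcases b with y | ⟨j, m⟩ <;> simp only [Basic.mul] at h <;>
    split_ifs at h with h' <;> simp only [Option.some.injEq] at h <;> subst h <;> subst h'
  · exact ⟨rfl, rfl, rfl, (one_mul _).symm⟩
  · exact ⟨rfl, rfl, rfl, (one_mul _).symm⟩
  · exact ⟨rfl, rfl, rfl, (mul_one _).symm⟩
  · refine ⟨rfl, rfl, ?_, gamBasic_chord_split i n m⟩
    simp only [tB]
    push_cast
    ring_nf

/-- The list of basic elements is composable and leads from `x` to `y`. -/
def IsPath : ZMod 2 → List Basic → ZMod 2 → Prop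
  | x, [], y => x = y
  | x, b :: l, y => x = sB b ∧ IsPath (tB b) l y

theorem isPath_append {x z : ZMod 2} {u w : List Basic} :
    IsPath x (u ++ w) z ↔ ∃ y, IsPath x u y ∧ IsPath y w z := by
  induction u generalizing x with
  | nil => simp [IsPath]
  | cons b u ih => simp only [List.cons_append, IsPath, ih]; tauto

/-- The inputs `l` and the output `U^k b` are compatible with the action of the idempotents and
with the gradings, for maps of degree `λ^(n - d)` in `n` inputs. -/
def Rel (d : ℤ) (l : List Basic) (k : ℕ) (b : Basic) : Prop :=
  IsPath (sB b) l (tB b) ∧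
    gamU ^ k * gamBasic b = lam ^ ((l.length : ℤ) - d) * (l.map gamBasic).prod

/-- Insertion replaces one input, so the total number of inputs is one less than the sum of the two
arities; this accounts for the degree `d + e - 1`. -/
theorem Rel.insert {d e : ℤ} {u v w : List Basic} {c b : Basic} {i j : ℕ}
    (h : Rel d (u ++ c :: w) i b) (h' : Rel e v j c) : Rel (d + e - 1) (u ++ (v ++ w)) (j + i) b := by
  obtain ⟨h1, h2⟩ := h
  obtain ⟨h3, h4⟩ := h'
  constructor
  · obtain ⟨y, hy, rfl, hw⟩ := isPath_append.1 h1
    exact isPath_append.2 ⟨_, hy, isPath_append.2 ⟨_, h3, hw⟩⟩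
  · have hU : Commute (gamU ^ j) (u.map gamBasic).prod := (gamU_comm _).pow_left j
    have hL : ∀ z : ℤ, ∀ g, Commute (lam ^ z) g := fun z g => (lam_comm g).zpow_left z
    rw [pow_add, mul_assoc, h2]
    simp only [List.map_append, List.map_cons, List.prod_append, List.prod_cons,
      List.length_append, List.length_cons]
    calc gamU ^ j * (lam ^ (((u.length + (w.length + 1) : ℕ) : ℤ) - d) *
          ((u.map gamBasic).prod * (gamBasic c * (w.map gamBasic).prod)))
        = lam ^ (((u.length + (w.length + 1) : ℕ) : ℤ) - d) *
          ((u.map gamBasic).prod * ((gamU ^ j * gamBasic c) * (w.map gamBasic).prod)) := by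
          rw [← mul_assoc, ← (hL _ _).eq, mul_assoc, ← mul_assoc (gamU ^ j), hU.eq]
          simp only [mul_assoc]
      _ = _ := by
          rw [h4, mul_assoc (lam ^ _) _ (List.prod _), ← mul_assoc (List.prod _) (lam ^ _),
            ← (hL _ (u.map gamBasic).prod).eq, mul_assoc (lam ^ _) (List.prod _), ← mul_assoc,
            ← zpow_add]
          congr 2
          push_cast
          ring

theorem rel_singleton (b : Basic) : Rel 1 [b] 0 b :=
  ⟨⟨rfl, rfl⟩, by simp⟩

end Grading

/-! ### Graded cochains are closed under insertion and composition -/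

section Cochains

/-- The nonzero coefficients of `φ` on lists of basic elements satisfy `P`. -/
def Supp (P : List Basic → ℕ → Basic → Prop) (φ : List Alg → Alg) : Prop :=
  ∀ l b k, cf (φ (l.map Alg.of)) b k ≠ 0 → P l k b

/-- Multilinear families of maps compatible with the idempotents and gradings, of degree
`λ^(n - d)` in `n` inputs. -/
structure Coch (d : ℤ) (φ : List Alg → Alg) : Prop where
  mlin : Mlin φ
  nil : φ [] = 0
  supp : Supp (Rel d) φ

theorem Coch.sum {d : ℤ} {φ ψ : List Alg → Alg} (hφ : Coch d φ) (hψ : Coch d ψ) :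
    Coch d fun l => φ l + ψ l where
  mlin := hφ.mlin.sum hψ.mlin
  nil := by rw [hφ.nil, hψ.nil, add_zero]
  supp l b k h := by
    rw [cf_add] at h
    by_cases h1 : cf (φ (l.map Alg.of)) b k = 0
    · exact hψ.supp l b k (by rwa [h1, zero_add] at h)
    · exact hφ.supp l b k h1

theorem Coch.ins {d e : ℤ} {φ ψ : List Alg → Alg} (hφ : Coch d φ) (hψ : Coch e ψ) :
    Coch (d + e - 1) (ins φ ψ) where
  mlin := hφ.mlin.ins hψ.mlin
  nil := rfl
  supp l b k h := by
    by_contra hR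
    refine h (ins_induction (fun x => cf x b k = 0) (cf_zero b k)
      (fun x y hx hy => by rw [cf_add, hx, hy, add_zero]) fun u v w _ huvw => ?_)
    obtain ⟨u, l', rfl, rfl, h1⟩ := List.append_eq_map_iff.1 huvw
    obtain ⟨v, w, rfl, rfl, rfl⟩ := List.map_eq_append_iff.1 h1
    by_contra hne
    obtain ⟨c, i, j, rfl, hc, hb⟩ := hφ.mlin.exists_cf hne
    have h3 := hφ.supp (u ++ c :: w) b j (by simpa using hb)
    exact hR (h3.insert (hψ.supp v c i hc))

/-- The predicate `P` varies in the induction: once a first block is used, it becomes `P` with that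
block prefixed, and `hst` is stable under prefixing. -/
theorem supp_cmp {P : List Basic → ℕ → Basic → Prop} {φ f : List Alg → Alg} (hφ : Mlin φ)
    (hP : Supp P φ) (hf : Coch 1 f)
    (hst : ∀ u v w c i j b, P (u ++ c :: w) i b → Rel 1 v j c → P (u ++ (v ++ w)) (j + i) b) :
    Supp P (cmp φ f) := by
  intro l
  induction hl : l.length using Nat.strong_induction_on generalizing P φ l with
  | _ n ih =>
    subst hl
    intro b k h
    cases l with
    | nil => exact hP [] b k h
    | cons x l =>
      by_contra hR
      refine h ?_
      rw [List.map_cons, cmp_cons]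
      refine splitSum_induction (fun x => cf x b k = 0)
        (fun x y hx hy => by rw [cf_add, hx, hy, add_zero]) fun u w huw => ?_
      obtain ⟨u, w, rfl, rfl, rfl⟩ := List.append_eq_map_iff.1 huw
      by_contra hne
      refine hR (ih w.length (by simp)
        (P := fun L k b => P ((x :: u) ++ L) k b)
        (φ := fun l' => φ (f (Alg.of x :: u.map Alg.of) :: l')) (hφ.cons _) ?_ ?_ w rfl b k hne)
      · intro L b k hL
        obtain ⟨c, i, j, rfl, hc, hb⟩ := hφ.exists_cf (xs := []) hL
        exact hst [] (x :: u) L c j i b (hP (c :: L) b j hb) (hf.supp (x :: u) c i hc)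
      · intro u' v w' c i j b h1 h2
        have := hst (x :: u ++ u') v w' c i j b (by simpa using h1) h2
        simpa using this

theorem Coch.cmp {d : ℤ} {φ f : List Alg → Alg} (hφ : Coch d φ) (hf : Coch 1 f) :
    Coch d (cmp φ f) where
  mlin := hφ.mlin.cmp hf.mlin
  nil := hφ.nil
  supp := supp_cmp hφ.mlin hφ.supp hf fun u v w c i j b h h' => by
    have := h.insert h'
    rwa [add_sub_cancel_right] at this

theorem Coch.congr {d : ℤ} {φ : List Alg → Alg}
    (h : ∀ m, ∃ ψ, Coch d ψ ∧ ∀ l, l.length ≤ m → φ l = ψ l) : Coch d φ where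
  mlin := by
    constructor
    · intro xs ys a b
      obtain ⟨ψ, h1, h2⟩ := h (xs.length + ys.length + 1)
      rw [h2 _ (by simp; omega), h2 _ (by simp; omega), h2 _ (by simp; omega), h1.mlin.add]
    · intro xs ys r a
      obtain ⟨ψ, h1, h2⟩ := h (xs.length + ys.length + 1)
      rw [h2 _ (by simp; omega), h2 _ (by simp; omega), h1.mlin.smul]
  nil := by
    obtain ⟨ψ, h1, h2⟩ := h 0
    rw [h2 [] (by simp), h1.nil]
  supp l b k hb := by
    obtain ⟨ψ, h1, h2⟩ := h l.length
    rw [h2 _ (by simp)] at hb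
    exact h1.supp l b k hb

theorem coch_mul2 : Coch 2 mul2 where
  mlin := mlin_mul2
  nil := rfl
  supp l b k h := by
    match l with
    | [] => exact absurd (cf_zero b k) h
    | [x] => exact absurd (cf_zero b k) h
    | [x, y] =>
      simp only [List.map_cons, List.map_nil, mul2_pair, of_mul_of] at h
      cases hm : Basic.mul x y with
      | none => rw [hm] at h; exact absurd (cf_zero b k) h
      | some c =>
        rw [hm] at h
        have h' : cf (Alg.of c) b k ≠ 0 := h
        rw [cf_of] at h'
        obtain ⟨rfl, rfl⟩ : c = b ∧ k = 0 := by
          by_contra hc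
          exact h' (if_neg hc)
        obtain ⟨h1, h2, h3, h4⟩ := mul_eq_some hm
        refine ⟨⟨h2, h1, h3.symm⟩, ?_⟩
        simp [h4]
    | x :: y :: z :: l => exact absurd (cf_zero b k) h

theorem coch_idHom : Coch 1 idHom where
  mlin := mlin_idHom
  nil := rfl
  supp l b k h := by
    match l with
    | [] => exact absurd (cf_zero b k) h
    | [x] =>
      have h' : cf (Alg.of x) b k ≠ 0 := h
      rw [cf_of] at h'
      obtain ⟨rfl, rfl⟩ : x = b ∧ k = 0 := by
        by_contra hc
        exact h' (if_neg hc)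
      exact rel_singleton x
    | x :: y :: l => exact absurd (cf_zero b k) h

end Cochains

end Torus

namespace Torus

open AInf

/-! ### The action of the ground ring -/

section Ground

theorem iota_mem_ground (x : ZMod 2) : iota x ∈ ground := by
  apply Algebra.subset_adjoin
  rcases Alg.zmod_two_cases x with rfl | rfl <;> simp

theorem algebraMap_mem_ground (r : F2U) : algebraMap F2U Alg r ∈ ground :=
  Subalgebra.algebraMap_mem (Algebra.adjoin F2U {iota 0, iota 1}) r

theorem ground_induction {p : Alg → Prop} (hi : ∀ x, p (iota x))
    (hr : ∀ r, p (algebraMap F2U Alg r)) (hadd : ∀ x y, p x → p y → p (x + y))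
    (hmul : ∀ x y, p x → p y → p (x * y)) {k : Alg} (hk : k ∈ ground) : p k := by
  refine Algebra.adjoin_induction (p := fun x _ => p x) ?_ hr (fun x y _ _ => hadd x y)
    (fun x y _ _ => hmul x y) hk
  rintro x (rfl | rfl)
  · exact hi 0
  · exact hi 1

theorem mul_idem_left (x : ZMod 2) (c : Basic) :
    Basic.mul (.idem x) c = if x = sB c then some c else none := by
  cases c with
  | idem y =>
    by_cases h : x = y
    · subst h; simp [Basic.mul, sB]
    · simp [Basic.mul, sB, h]
  | chord i n => rfl

theorem mul_idem_right (y : ZMod 2) (c : Basic) :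
    Basic.mul c (.idem y) = if y = tB c then some c else none := by
  cases c with
  | idem x =>
    by_cases h : x = y
    · subst h; simp [Basic.mul, tB]
    · simp [Basic.mul, tB, h, Ne.symm h]
  | chord i n => rfl

theorem iota_mul_of (x : ZMod 2) (c : Basic) :
    iota x * Alg.of c = if x = sB c then Alg.of c else 0 := by
  rw [iota, of_mul_of, mul_idem_left]
  split_ifs <;> rfl

theorem of_mul_iota (x : ZMod 2) (c : Basic) :
    Alg.of c * iota x = if x = tB c then Alg.of c else 0 := by
  rw [iota, of_mul_of, mul_idem_right]
  split_ifs <;> rfl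

theorem co_iota_mul (x : ZMod 2) (a : Alg) (b : Basic) :
    co b (iota x * a) = if sB b = x then co b a else 0 := by
  induction a using alg_induction with
  | hadd s t hs ht => rw [mul_add, map_add, hs, ht, map_add]; split_ifs <;> simp
  | hsmul r s hs => rw [mul_smul', map_smul, hs, map_smul]; split_ifs <;> simp
  | hof c =>
    rw [iota_mul_of]
    by_cases hc : c = b
    · subst hc
      simp only [eq_comm, apply_ite (co c), map_zero]
    · split_ifs <;> simp [co_of, hc]

theorem co_mul_iota (x : ZMod 2) (a : Alg) (b : Basic) :
    co b (a * iota x) = if tB b = x then co b a else 0 := by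
  induction a using alg_induction with
  | hadd s t hs ht => rw [add_mul, map_add, hs, ht, map_add]; split_ifs <;> simp
  | hsmul r s hs => rw [smul_mul, map_smul, hs, map_smul]; split_ifs <;> simp
  | hof c =>
    rw [of_mul_iota]
    by_cases hc : c = b
    · subst hc
      simp only [eq_comm, apply_ite (co c), map_zero]
    · split_ifs <;> simp [co_of, hc]

theorem iota_mul (x : ZMod 2) {a : Alg} (h : ∀ b k, cf a b k ≠ 0 → sB b = x) :
    iota x * a = a := by
  refine alg_ext fun b => ?_
  rw [co_iota_mul]
  split_ifs with hx
  · rfl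
  · refine (Polynomial.ext fun k => ?_).symm
    by_contra hb
    exact hx (h b k hb)

theorem mul_iota (x : ZMod 2) {a : Alg} (h : ∀ b k, cf a b k ≠ 0 → tB b = x) :
    a * iota x = a := by
  refine alg_ext fun b => ?_
  rw [co_mul_iota]
  split_ifs with hx
  · rfl
  · refine (Polynomial.ext fun k => ?_).symm
    by_contra hb
    exact hx (h b k hb)

theorem cf_iota_mul {x : ZMod 2} {a : Alg} {b : Basic} {k : ℕ} (h : cf (iota x * a) b k ≠ 0) :
    sB b = x ∧ cf a b k ≠ 0 := by
  rw [cf, co_iota_mul] at h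
  split_ifs at h with hx
  · exact ⟨hx, h⟩
  · exact absurd (coeff_zero k) h

theorem cf_mul_iota {x : ZMod 2} {a : Alg} {b : Basic} {k : ℕ} (h : cf (a * iota x) b k ≠ 0) :
    tB b = x ∧ cf a b k ≠ 0 := by
  rw [cf, co_mul_iota] at h
  split_ifs at h with hx
  · exact ⟨hx, h⟩
  · exact absurd (coeff_zero k) h

end Ground

/-! ### Graded bimodule maps are cochains -/

section FromBimoduleMaps

variable {φ : List Alg → Alg}

/-- Scalars are central and lie in the ground ring: a scalar is passed from input to input by
balancing and leaves at the right end. -/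
theorem mlin_of_isMultilinear (h : IsMultilinear ground φ) : Mlin φ where
  add := h.map_add
  smul xs ys r a := by
    have e1 : ∀ x : Alg, x * algebraMap F2U Alg r = r • x := fun x => by
      rw [← Algebra.commutes, ← Algebra.smul_def]
    induction ys generalizing xs a with
    | nil => rw [← e1, h.map_right xs a _ (algebraMap_mem_ground r), e1]
    | cons b ys ih =>
      rw [← e1 a, h.balanced xs ys a b _ (algebraMap_mem_ground r), Algebra.commutes, e1]
      have := ih (xs ++ [a]) b
      simpa using this

/-- Each basic element absorbs the idempotents at its ends. Moving these across the tensor signs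
kills non-composable lists, and moving them out of the first and last inputs fixes the ends of the
output. -/
theorem isPath_of_isMultilinear (h : IsMultilinear ground φ) (h0 : φ [] = 0) {l : List Basic}
    {b : Basic} {k : ℕ} (hb : cf (φ (l.map Alg.of)) b k ≠ 0) : IsPath (sB b) l (tB b) := by
  have key : ∀ (l : List Basic) (xs : List Alg) (c : Basic),
      cf (φ (xs ++ Alg.of c :: l.map Alg.of)) b k ≠ 0 → IsPath (tB c) l (tB b) := by
    intro l
    induction l with
    | nil =>
      intro xs c hb
      have e : Alg.of c = Alg.of c * iota (tB c) := by rw [of_mul_iota, if_pos rfl]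
      rw [List.map_nil, e, h.map_right xs _ _ (iota_mem_ground _)] at hb
      exact (cf_mul_iota hb).1.symm
    | cons c' l ih =>
      intro xs c hb
      constructor
      · by_contra hc
        have e : Alg.of c = Alg.of c * iota (tB c) := by rw [of_mul_iota, if_pos rfl]
        rw [List.map_cons, e, h.balanced xs _ _ _ _ (iota_mem_ground _), iota_mul_of,
          if_neg hc, ← List.singleton_append, ← List.append_assoc] at hb
        rw [(mlin_of_isMultilinear h).add.map_zero, cf_zero] at hb
        exact hb rfl
      · exact ih (xs ++ [Alg.of c]) c' (by simpa using hb)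
  cases l with
  | nil => rw [List.map_nil, h0, cf_zero] at hb; exact absurd rfl hb
  | cons c l =>
    refine ⟨?_, key l [] c hb⟩
    have e : Alg.of c = iota (sB c) * Alg.of c := by rw [iota_mul_of, if_pos rfl]
    rw [List.map_cons, e, h.map_left _ _ _ (iota_mem_ground _)] at hb
    exact (cf_iota_mul hb).1

theorem isHomogeneous_of (u : Gam) (c : Basic) : IsHomogeneous u (Alg.of c) (gamBasic c) := by
  intro b k h
  have h' : cf (Alg.of c) b k ≠ 0 := h
  rw [cf_of] at h'
  obtain ⟨rfl, rfl⟩ : c = b ∧ k = 0 := by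
    by_contra hc
    exact h' (if_neg hc)
  rw [pow_zero, one_mul]

theorem hasDegree_basic {u : Gam} {d : ℤ} (h : HasDegree (IsHomogeneous u) lam d φ)
    {l : List Basic} {b : Basic} {k : ℕ} (hb : cf (φ (l.map Alg.of)) b k ≠ 0) :
    u ^ k * gamBasic b = lam ^ ((l.length : ℤ) - d) * (l.map gamBasic).prod := by
  have := h (l.map fun c => (Alg.of c, gamBasic c)) (by
    intro p hp
    obtain ⟨c, -, rfl⟩ := List.mem_map.1 hp
    exact isHomogeneous_of u c)
  simp only [List.map_map, List.length_map, Function.comp_def] at this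
  exact this b k hb

theorem coch_of_isMultilinear (h : IsMultilinear ground φ) (h0 : φ [] = 0) {d : ℤ}
    (hd : HasDegree (IsHomogeneous gamU) lam d φ) : Coch d φ where
  mlin := mlin_of_isMultilinear h
  nil := h0
  supp _ _ _ hb := ⟨isPath_of_isMultilinear h h0 hb, hasDegree_basic hd hb⟩

end FromBimoduleMaps

/-! ### Cochains are graded bimodule maps -/

section ToBimoduleMaps

variable {φ : List Alg → Alg} {d : ℤ}

theorem Coch.eq_zero (h : Coch d φ) {l : List Basic}
    (hl : ∀ b : Basic, ¬ IsPath (sB b) l (tB b)) : φ (l.map Alg.of) = 0 :=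
  eq_zero_of_cf fun b k => by
    by_contra hb
    exact hl b (h.supp l b k hb).1

/-- On basic inputs `ι_x` acts as one or zero. The two sides could differ only if `a` and `b` are
not composable, and then both vanish by the support condition. -/
theorem Coch.balanced_iota (h : Coch d φ) (x : ZMod 2) (xs ys : List Alg) (a b : Alg) :
    φ (xs ++ (a * iota x) :: b :: ys) = φ (xs ++ a :: (iota x * b) :: ys) := by
  have m := h.mlin
  induction xs using list_induction generalizing a b ys with
  | hadd us vs s t hs ht =>
    simp only [List.append_assoc, List.cons_append] at hs ht ⊢
    rw [m.add, m.add, hs, ht]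
  | hsmul us vs r s hs =>
    simp only [List.append_assoc, List.cons_append] at hs ⊢
    rw [m.smul, m.smul, hs]
  | hof us =>
    induction a using alg_induction generalizing b ys with
    | hadd s t hs ht => rw [add_mul, m.add, m.add, hs, ht]
    | hsmul r s hs => rw [smul_mul, m.smul, m.smul, hs]
    | hof a =>
      have e1 : ∀ (z w : Alg) (zs : List Alg), us.map Alg.of ++ z :: w :: zs =
          (us.map Alg.of ++ [z]) ++ w :: zs := by simp
      induction b using alg_induction generalizing ys with
      | hadd s t hs ht =>
        specialize hs ys
        specialize ht ys
        rw [e1, e1 (Alg.of a)] at hs ht ⊢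
        rw [mul_add, m.add, m.add, hs, ht]
      | hsmul r s hs =>
        specialize hs ys
        rw [e1, e1 (Alg.of a)] at hs ⊢
        rw [mul_smul', m.smul, m.smul, hs]
      | hof b =>
        have e2 : ∀ (z w s : Alg) (vs ws : List Alg), us.map Alg.of ++ z :: w :: (vs ++ s :: ws) =
            (us.map Alg.of ++ z :: w :: vs) ++ s :: ws := by simp
        induction ys using list_induction with
        | hadd vs ws s t hs ht => rw [e2] at hs ht ⊢; rw [e2] at hs ht ⊢; rw [m.add, m.add, hs, ht]
        | hsmul vs ws r s hs => rw [e2] at hs ⊢; rw [e2] at hs ⊢; rw [m.smul, m.smul, hs]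
        | hof vs =>
          rw [of_mul_iota, iota_mul_of]
          by_cases hx : tB a = sB b
          · by_cases hx' : x = sB b
            · rw [if_pos (hx'.trans hx.symm), if_pos hx']
            · rw [if_neg (fun h => hx' (h.trans hx)), if_neg hx', m.add.map_zero, e1,
                m.add.map_zero]
          · have hz : φ (us.map Alg.of ++ Alg.of a :: Alg.of b :: vs.map Alg.of) = 0 := by
              have := h.eq_zero (l := us ++ a :: b :: vs) (by
                intro c hc
                obtain ⟨y, -, -, h3, -⟩ := isPath_append.1 hc
                exact hx h3)
              simpa using this
            split_ifs
            · exact rfl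
            · rw [hz, e1, m.add.map_zero]
            · rw [hz, m.add.map_zero]
            · rw [e1 (Alg.of a) 0, m.add.map_zero, m.add.map_zero]

theorem Coch.left_iota (h : Coch d φ) (x : ZMod 2) (ys : List Alg) (a : Alg) :
    φ ((iota x * a) :: ys) = iota x * φ (a :: ys) := by
  have m := h.mlin
  induction a using alg_induction generalizing ys with
  | hadd s t hs ht =>
    rw [mul_add]
    have e := m.add [] ys
    simp only [List.nil_append] at e
    rw [e, e, hs, ht, mul_add]
  | hsmul r s hs =>
    rw [mul_smul']
    have e := m.smul [] ys
    simp only [List.nil_append] at e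
    rw [e, e, hs, mul_smul']
  | hof a =>
    induction ys using list_induction with
    | hadd vs ws s t hs ht =>
      simp only [← List.cons_append] at hs ht ⊢
      rw [m.add, m.add, hs, ht, mul_add]
    | hsmul vs ws r s hs =>
      simp only [← List.cons_append] at hs ⊢
      rw [m.smul, m.smul, hs, mul_smul']
    | hof vs =>
      rw [iota_mul_of]
      have hs : ∀ b k, cf (φ (Alg.of a :: vs.map Alg.of)) b k ≠ 0 → sB b = sB a :=
        fun b k hb => (h.supp (a :: vs) b k hb).1.1
      split_ifs with hx
      · subst hx
        exact (iota_mul _ hs).symm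
      · rw [show φ (0 :: vs.map Alg.of) = 0 from m.add.map_zero [] _]
        refine (eq_zero_of_cf fun b k => ?_).symm
        by_contra hb
        obtain ⟨h1, h2⟩ := cf_iota_mul hb
        exact hx (h1.symm.trans (hs b k h2))

theorem Coch.right_iota (h : Coch d φ) (x : ZMod 2) (xs : List Alg) (a : Alg) :
    φ (xs ++ [a * iota x]) = φ (xs ++ [a]) * iota x := by
  have m := h.mlin
  induction a using alg_induction generalizing xs with
  | hadd s t hs ht => rw [add_mul, m.add, m.add, hs, ht, add_mul]
  | hsmul r s hs => rw [smul_mul, m.smul, m.smul, hs, smul_mul]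
  | hof a =>
    induction xs using list_induction with
    | hadd vs ws s t hs ht =>
      simp only [List.append_assoc, List.cons_append] at hs ht ⊢
      rw [m.add, m.add, hs, ht, add_mul]
    | hsmul vs ws r s hs =>
      simp only [List.append_assoc, List.cons_append] at hs ⊢
      rw [m.smul, m.smul, hs, smul_mul]
    | hof vs =>
      rw [of_mul_iota]
      have hs : ∀ b k, cf (φ (vs.map Alg.of ++ [Alg.of a])) b k ≠ 0 → tB b = tB a := by
        intro b k hb
        obtain ⟨y, -, -, h3⟩ := isPath_append.1 (h.supp (vs ++ [a]) b k (by simpa using hb)).1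
        exact Eq.symm h3
      split_ifs with hx
      · subst hx
        exact (mul_iota _ hs).symm
      · rw [m.add.map_zero]
        refine (eq_zero_of_cf fun b k => ?_).symm
        by_contra hb
        obtain ⟨h1, h2⟩ := cf_mul_iota hb
        exact hx (h1.symm.trans (hs b k h2))

theorem Coch.isMultilinear (h : Coch d φ) : IsMultilinear ground φ where
  map_add := h.mlin.add
  balanced xs ys a b k hk := by
    revert a b
    refine ground_induction (p := fun k => ∀ a b,
      φ (xs ++ (a * k) :: b :: ys) = φ (xs ++ a :: (k * b) :: ys))
      (fun x => h.balanced_iota x xs ys) (fun r a b => ?_) (fun s t hs ht a b => ?_)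
      (fun s t hs ht a b => ?_) hk
    · rw [← Algebra.commutes, ← Algebra.smul_def, ← Algebra.smul_def, h.mlin.smul]
      have := h.mlin.smul (xs ++ [a]) ys r b
      simpa using this.symm
    · have := h.mlin.add (xs ++ [a]) ys (s * b) (t * b)
      simp only [List.append_assoc, List.singleton_append] at this
      rw [mul_add, h.mlin.add, hs, ht, add_mul, this]
    · rw [← mul_assoc, ht, hs, mul_assoc]
  map_left ys a k hk := by
    revert a
    refine ground_induction (p := fun k => ∀ a, φ ((k * a) :: ys) = k * φ (a :: ys))
      (fun x => h.left_iota x ys) (fun r a => ?_) (fun s t hs ht a => ?_)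
      (fun s t hs ht a => ?_) hk
    · rw [← Algebra.smul_def, ← Algebra.smul_def]
      exact h.mlin.smul [] ys r a
    · rw [add_mul, add_mul, ← hs, ← ht]
      exact h.mlin.add [] ys _ _
    · rw [mul_assoc, hs, ht, mul_assoc]
  map_right xs a k hk := by
    revert a
    refine ground_induction (p := fun k => ∀ a, φ (xs ++ [a * k]) = φ (xs ++ [a]) * k)
      (fun x => h.right_iota x xs) (fun r a => ?_) (fun s t hs ht a => ?_)
      (fun s t hs ht a => ?_) hk
    · rw [← Algebra.commutes, ← Algebra.smul_def, ← Algebra.commutes, ← Algebra.smul_def]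
      exact h.mlin.smul xs [] r a
    · rw [mul_add, mul_add, ← hs, ← ht]
      exact h.mlin.add xs [] _ _
    · rw [← mul_assoc, ht, hs, mul_assoc]

/-- The homogeneous inputs are replaced one after another by monomials `U^i c` occurring in them,
which have the same grading, until the support condition on basic inputs applies. -/
theorem Coch.hasDegree (h : Coch d φ) : HasDegree (IsHomogeneous gamU) lam d φ := by
  have key : ∀ (l : List (Alg × Gam)), (∀ p ∈ l, IsHomogeneous gamU p.1 p.2) →
      ∀ (pre : List Basic) (b : Basic) (k : ℕ),
        cf (φ (pre.map Alg.of ++ l.map Prod.fst)) b k ≠ 0 →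
        gamU ^ k * gamBasic b = lam ^ (((pre.length + l.length : ℕ) : ℤ) - d) *
          ((pre.map gamBasic).prod * (l.map Prod.snd).prod) := by
    intro l
    induction l with
    | nil =>
      intro _ pre b k hb
      simpa using (h.supp pre b k (by simpa using hb)).2
    | cons p l ih =>
      intro hl pre b k hb
      obtain ⟨c, i, j, rfl, hc, hb'⟩ := h.mlin.exists_cf hb
      have h1 := ih (fun q hq => hl q (by simp [hq])) (pre ++ [c]) b j (by simpa using hb')
      have h2 : gamU ^ i * gamBasic c = p.2 := hl p (by simp) c i hc
      have hU : ∀ g, Commute (gamU ^ i) g := fun g => (gamU_comm g).pow_left i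
      rw [pow_add, mul_assoc, h1, List.map_cons, List.prod_cons, ← h2]
      simp only [List.map_append, List.prod_append, List.map_cons, List.map_nil, List.prod_cons,
        List.prod_nil, mul_one, List.length_append, List.length_cons, List.length_nil]
      rw [← mul_assoc, (hU _).eq, mul_assoc, ← mul_assoc (gamU ^ i), ← mul_assoc (gamU ^ i),
        (hU _).eq]
      simp only [mul_assoc]
      congr 3
      omega
  intro l hl b k hb
  have := key l hl [] b k hb
  simpa using this

end ToBimoduleMaps

end Torus

/-! ### Strict units on basic elements; passage to and from `TorusDeformation` -/

namespace Torus

open AInf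

theorem normal_of_basic {φ : List Alg → Alg} (m : Mlin φ)
    (h : ∀ (bs : List Basic) (x : ZMod 2), Basic.idem x ∈ bs → φ (bs.map Alg.of) = 0) :
    Normal φ := by
  have key : ∀ (x : ZMod 2) (xs ys : List Alg), φ (xs ++ iota x :: ys) = 0 := by
    intro x xs ys
    induction xs using list_induction with
    | hadd us vs s t hs ht =>
      simp only [List.append_assoc, List.cons_append] at hs ht ⊢
      rw [m.add, hs, ht, add_zero]
    | hsmul us vs r s hs =>
      simp only [List.append_assoc, List.cons_append] at hs ⊢
      rw [m.smul, hs, smul_zero]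
    | hof us =>
      have e : ∀ (s : Alg) (vs ws : List Alg), us.map Alg.of ++ iota x :: (vs ++ s :: ws) =
          (us.map Alg.of ++ iota x :: vs) ++ s :: ws := by simp
      induction ys using list_induction with
      | hadd vs ws s t hs ht => rw [e] at hs ht ⊢; rw [m.add, hs, ht, add_zero]
      | hsmul vs ws r s hs => rw [e] at hs ⊢; rw [m.smul, hs, smul_zero]
      | hof vs =>
        have := h (us ++ .idem x :: vs) x (by simp)
        rwa [List.map_append, List.map_cons] at this
  intro l hl
  obtain ⟨xs, ys, rfl⟩ := List.append_of_mem hl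
  rw [Alg.one_def, m.add]
  exact (congrArg₂ _ (key 0 xs ys) (key 1 xs ys)).trans (add_zero 0)

/-- Write `ι_x` as a product of `ι_x` and `1`, and let the factor `ι_x` move to the left neighbour
or out of the operation. An input `1` remains. -/
theorem eq_zero_of_idem {φ : List Alg → Alg} (m : IsMultilinear ground φ)
    (h : Normal φ) {bs : List Basic} {x : ZMod 2} (hx : Basic.idem x ∈ bs) :
    φ (bs.map Alg.of) = 0 := by
  obtain ⟨us, vs, rfl⟩ := List.append_of_mem hx
  rw [List.map_append, List.map_cons, show Alg.of (.idem x) = iota x * 1 from (mul_one _).symm]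
  rcases List.eq_nil_or_concat' us with rfl | ⟨us, c, rfl⟩
  · rw [List.map_nil, List.nil_append, m.map_left _ _ _ (iota_mem_ground x), h _ (by simp), mul_zero]
  · rw [List.map_append, List.map_cons, List.map_nil, List.append_assoc, List.singleton_append,
      ← m.balanced _ _ _ _ _ (iota_mem_ground x), h _ (by simp)]

theorem preDeformation (D : TorusDeformation) : PreDeformation D.μ where
  additive := D.multilinear.map_add
  nil := D.μ_zero
  one := D.μ_one
  two := D.μ_two
  normal l hl h := by
    obtain ⟨xs, ys, rfl⟩ := List.append_of_mem hl
    refine D.unital xs ys fun h' => h ?_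
    rw [List.length_append, List.length_cons]
    omega

theorem coch_of_isGraded {D : TorusDeformation} (h : D.IsGraded (IsHomogeneous gamU) lam) :
    Coch 2 D.μ := coch_of_isMultilinear D.multilinear D.μ_zero h

theorem ins_self_eq_zero (D : TorusDeformation) (l : List Alg) : ins D.μ D.μ l = 0 := by
  rw [← insertion_eq_ins, D.relation]

/-- The deformation with given operations. -/
def toDeformation {μ : List Alg → Alg} (h : PreDeformation μ) (hc : Coch 2 μ)
    (hr : ∀ l, ins μ μ l = 0) : TorusDeformation where
  μ := μ
  multilinear := hc.isMultilinear
  μ_zero := h.nil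
  μ_one := h.one
  μ_two := h.two
  unital xs ys hl := h.normal _ (by simp) (by
    rw [List.length_append, List.length_cons]
    omega)
  relation l := by rw [insertion_eq_ins, hr]

theorem isHom_of_ins_eq_cmp {D E : TorusDeformation} {f : List Alg → Alg} (h : PreHom f)
    (hc : Coch 1 f) (hr : ins f D.μ = cmp E.μ f) : IsHom D E f where
  multilinear := hc.isMultilinear
  f_zero := h.nil
  f_one := h.one 1
  unital xs ys hl := h.normal _ (by simp) (by
    rw [List.length_append, List.length_cons]
    omega)
  relation l := by rw [insertion_eq_ins, compose_eq_cmp, hr]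

end Torus

namespace Torus

open AInf

/-! ### Critical lists, split lists and the vanishing of reduced cocycles -/

section Homotopy

/-- A list of arrows `ρ_i`. -/
def arrows (c : List (ZMod 4)) : List Basic := c.map fun i => .chord i 0

/-- Consecutive arrows have product zero. -/
def Crit (c : List (ZMod 4)) : Prop := c.IsChain fun i j => j ≠ i + 1

theorem Crit.tail {i : ZMod 4} {c : List (ZMod 4)} (h : Crit (i :: c)) : Crit c :=
  List.IsChain.tail h

theorem Crit.rel {i j : ZMod 4} {c : List (ZMod 4)} (h : Crit (i :: j :: c)) : j ≠ i + 1 :=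
  (List.isChain_cons_cons.1 h).1

theorem Crit.left {c c' : List (ZMod 4)} (h : Crit (c ++ c')) : Crit c :=
  List.IsChain.left_of_append h

theorem arrows_append (c c' : List (ZMod 4)) : arrows (c ++ c') = arrows c ++ arrows c' :=
  List.map_append

theorem arrows_cons (i : ZMod 4) (c : List (ZMod 4)) : arrows (i :: c) = .chord i 0 :: arrows c :=
  rfl

/-- A list of chords either consists of arrows with vanishing consecutive products, or after
such arrows there is first a chord which is not an arrow, or first a nonzero product. -/
theorem trichotomy (l : List Basic) (hl : ∀ x, Basic.idem x ∉ l) :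
    (∃ c, Crit c ∧ l = arrows c) ∨
    (∃ c i m w, Crit (c ++ [i]) ∧ l = arrows c ++ .chord i 0 :: .chord (i + 1) m :: w) ∨
    (∃ c i m w, Crit (c ++ [i]) ∧ l = arrows c ++ .chord i (m + 1) :: w) := by
  induction l using List.reverseRecOn with
  | nil => exact Or.inl ⟨[], List.isChain_nil, rfl⟩
  | append_singleton l b ih =>
    rcases ih fun x hx => hl x (by simp [hx]) with
      ⟨c, hc, rfl⟩ | ⟨c, i, m, w, hc, rfl⟩ | ⟨c, i, m, w, hc, rfl⟩
    · rcases b with x | ⟨j, m⟩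
      · exact absurd (by simp) (hl x)
      · by_cases h : Crit (c ++ [j])
        · cases m with
          | zero => exact Or.inl ⟨c ++ [j], h, by rw [arrows_append]; rfl⟩
          | succ m => exact Or.inr (Or.inr ⟨c, j, m, [], h, rfl⟩)
        · rcases List.eq_nil_or_concat' c with rfl | ⟨c, i, rfl⟩
          · exact absurd (List.isChain_singleton j) h
          · refine Or.inr (Or.inl ⟨c, i, m, [], hc, ?_⟩)
            have hj : j = i + 1 := by
              by_contra hj
              refine h (List.isChain_append.2 ⟨hc, List.isChain_singleton j, ?_⟩)
              intro x hx y hy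
              simp only [List.getLast?_append, List.getLast?_singleton, Option.some_or,
                Option.mem_def, Option.some.injEq, List.head?_cons] at hx hy
              subst hx hy
              exact hj
            rw [arrows_append, hj, List.append_assoc]
            rfl
    · exact Or.inr (Or.inl ⟨c, i, m, w ++ [b], hc, by simp⟩)
    · exact Or.inr (Or.inr ⟨c, i, m, w ++ [b], hc, by simp⟩)

theorem chord_mul_succ (i : ZMod 4) (m : ℕ) :
    Basic.mul (.chord i 0) (.chord (i + 1) m) = some (.chord i (m + 1)) := by
  simp [Basic.mul]

theorem chord_mul_none {i j : ZMod 4} (h : j ≠ i + 1) (m : ℕ) :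
    Basic.mul (.chord i 0) (.chord j m) = none := by
  simp [Basic.mul, h]

theorem chord_mul (i : ZMod 4) (m : ℕ) (b : Basic) :
    Basic.mul (.chord i m) b = none ∨ ∃ m', Basic.mul (.chord i m) b = some (.chord i m') := by
  rcases b with x | ⟨j, n⟩ <;> simp only [Basic.mul] <;> split_ifs <;> simp

variable {χ : List Alg → Alg}

theorem ins_mul2_basic_eq_zero (hχ : Mlin χ) {w : List Basic}
    (h : ∀ w' : List Basic, w'.length + 1 = w.length → χ (w'.map Alg.of) = 0) :
    ins χ mul2 (w.map Alg.of) = 0 := by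
  refine ins_eq_zero fun u v w' _ huvw => ?_
  obtain ⟨u, l', rfl, rfl, h1⟩ := List.append_eq_map_iff.1 huvw
  obtain ⟨v, w', rfl, rfl, rfl⟩ := List.map_eq_append_iff.1 h1
  match v with
  | [a, b] =>
    rw [List.map_cons, List.map_cons, List.map_nil, mul2_pair, of_mul_of]
    cases Basic.mul a b with
    | none => exact hχ.add.map_zero _ _
    | some c =>
      have := h (u ++ c :: w') (by simp; omega)
      rwa [List.map_append, List.map_cons] at this
  | [] => exact hχ.add.map_zero _ _
  | [_] => exact hχ.add.map_zero _ _
  | _ :: _ :: _ :: _ => exact hχ.add.map_zero _ _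

/-- Multiplying neighbours never changes the initial arrow of the first chord, so every term is
again of the kind on which `χ` vanishes. -/
theorem ins_mul2_chord_eq_zero (hχ : Mlin χ) {j : ZMod 4} {m : ℕ} {w : List Basic}
    (h : ∀ m' (w' : List Basic), w'.length + 1 = w.length →
      χ (Alg.of (.chord j m') :: w'.map Alg.of) = 0) :
    ins χ mul2 (Alg.of (.chord j m) :: w.map Alg.of) = 0 := by
  cases w with
  | nil => exact ins_mul2_right_singleton hχ.add _
  | cons b w =>
    rw [List.map_cons, ins_mul2_right_cons hχ.add, of_mul_of, ← List.map_cons,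
      ins_mul2_basic_eq_zero (hχ.cons _) fun w' hw' => h m w' hw', add_zero]
    rcases chord_mul j m b with h' | ⟨m', h'⟩
    · rw [h']
      exact hχ.add.map_zero [] _
    · rw [h']
      exact h m' w (by simp)

/-- Products inside the critical part vanish. The first nonzero product is `ρ_i` times the following
chord, and the remaining products involve only later letters. -/
theorem ins_mul2_arrows_append (hχ : Mlin χ) {c : List (ZMod 4)} {i : ZMod 4}
    (hc : Crit (c ++ [i])) (m : ℕ) (w : List Basic) :
    ins χ mul2 ((arrows c ++ .chord i 0 :: .chord (i + 1) m :: w).map Alg.of) =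
      χ ((arrows c ++ .chord i (m + 1) :: w).map Alg.of) +
        ins (fun L => χ ((arrows (c ++ [i])).map Alg.of ++ L)) mul2
          ((Basic.chord (i + 1) m :: w).map Alg.of) := by
  induction c generalizing χ with
  | nil =>
    simp only [arrows, List.map_nil, List.nil_append, List.map_cons]
    rw [ins_mul2_right_cons hχ.add, of_mul_of, chord_mul_succ]
    rfl
  | cons j c ih =>
    have h1 := ih (hχ.cons (Alg.of (.chord j 0))) hc.tail
    rw [List.cons_append, arrows_cons, List.cons_append, List.map_cons]
    cases c with
    | nil =>
      have hj : i ≠ j + 1 := Crit.rel hc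
      simp only [arrows, List.map_nil, List.nil_append, List.map_cons] at h1 ⊢
      rw [ins_mul2_right_cons hχ.add, h1, of_mul_of, chord_mul_none hj]
      rw [show Alg.ofOption none = 0 from rfl, show χ (0 :: _) = 0 from hχ.add.map_zero [] _,
        zero_add]
      rfl
    | cons j' c =>
      have hj : j' ≠ j + 1 := Crit.rel hc
      simp only [arrows_cons, List.cons_append, List.map_cons] at h1 ⊢
      rw [ins_mul2_right_cons hχ.add, h1, of_mul_of, chord_mul_none hj]
      rw [show Alg.ofOption none = 0 from rfl, show χ (0 :: _) = 0 from hχ.add.map_zero [] _,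
        zero_add]

theorem ins_mul2_arrows (hχ : Mlin χ) {c : List (ZMod 4)} (hc : Crit c) :
    ins χ mul2 ((arrows c).map Alg.of) = 0 := by
  induction c generalizing χ with
  | nil => rfl
  | cons j c ih =>
    have h1 := ih (hχ.cons (Alg.of (.chord j 0))) hc.tail
    cases c with
    | nil => exact ins_mul2_right_singleton hχ.add _
    | cons j' c =>
      have hj : j' ≠ j + 1 := Crit.rel hc
      simp only [arrows_cons, List.map_cons] at h1 ⊢
      rw [ins_mul2_right_cons hχ.add, h1, of_mul_of, chord_mul_none hj, add_zero]
      exact hχ.add.map_zero [] _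

theorem ins_mul2_left_of_eq (φ : List Alg → Alg) {l t f : List Alg} {x y : Alg} (h1 : l = x :: t)
    (h2 : l = f ++ [y]) (ht : t ≠ []) : ins mul2 φ l = x * φ t + φ f * y := by
  obtain ⟨t, z, rfl⟩ := (List.eq_nil_or_concat' t).resolve_left ht
  subst h1
  rw [← List.cons_append] at h2
  obtain ⟨rfl, h3⟩ := List.append_inj' h2 rfl
  obtain rfl : z = y := by simpa using h3
  exact ins_mul2_left φ x z t

/-- Vanishing on the lists of length `n` of arrows with vanishing consecutive products, and on
those in which such arrows are followed by a chord composable with the last one. -/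
structure Reduced (n : ℕ) (χ : List Alg → Alg) : Prop where
  crit : ∀ c, Crit c → c.length = n → χ ((arrows c).map Alg.of) = 0
  split : ∀ c i m (w : List Basic), Crit (c ++ [i]) → c.length + 2 + w.length = n →
    χ ((arrows c ++ .chord i 0 :: .chord (i + 1) m :: w).map Alg.of) = 0

/-- All other terms of the differential evaluate `χ` on critical or split lists. Thus the
differential on a split list recovers the value of `χ` on the list with the long chord reassembled;
an outer product survives only if that chord comes first. -/
theorem delta_split (hχ : Mlin χ) {n : ℕ} (hr : Reduced n χ) {c : List (ZMod 4)} {i : ZMod 4}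
    (hc : Crit (c ++ [i])) {m : ℕ} {w : List Basic} (hn : c.length + 1 + w.length = n) :
    delta χ ((arrows c ++ .chord i 0 :: .chord (i + 1) m :: w).map Alg.of) =
      χ ((arrows c ++ .chord i (m + 1) :: w).map Alg.of) +
      if c = [] then Alg.of (.chord i 0) * χ ((Basic.chord (i + 1) m :: w).map Alg.of) else 0 := by
  have h1 : ins (fun L => χ ((arrows (c ++ [i])).map Alg.of ++ L)) mul2
      ((Basic.chord (i + 1) m :: w).map Alg.of) = 0 := by
    refine ins_mul2_chord_eq_zero ⟨fun xs ys a b => ?_, fun xs ys r a => ?_⟩ fun m' w' hw' => ?_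
    · simp only [← List.append_assoc]
      exact hχ.add _ _ _ _
    · simp only [← List.append_assoc]
      exact hχ.smul _ _ _ _
    · have := hr.split c i m' w' hc (by omega)
      rw [arrows_append]
      simpa [arrows] using this
  rw [delta, ins_mul2_arrows_append hχ hc, h1, add_zero, add_comm]
  congr 1
  -- Omitting the last letter leaves a critical list if `w` is empty and a split list otherwise, so
  -- the right outer term vanishes.
  obtain ⟨f, y, hf, hy⟩ : ∃ f y, (arrows c ++ .chord i 0 :: .chord (i + 1) m :: w).map Alg.of =
      f ++ [y] ∧ χ f = 0 := by
    rcases List.eq_nil_or_concat' w with rfl | ⟨w, b, rfl⟩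
    · refine ⟨(arrows (c ++ [i])).map Alg.of, Alg.of (.chord (i + 1) m), ?_,
        hr.crit _ hc (by simpa using hn)⟩
      simp [arrows]
    · refine ⟨(arrows c ++ .chord i 0 :: .chord (i + 1) m :: w).map Alg.of, Alg.of b, by simp,
        hr.split _ _ _ _ hc ?_⟩
      simp at hn
      omega
  cases c with
  | nil =>
    refine (ins_mul2_left_of_eq χ (x := Alg.of (.chord i 0))
      (t := (Basic.chord (i + 1) m :: w).map Alg.of) rfl hf (by simp)).trans ?_
    rw [hy, zero_mul, add_zero, if_pos rfl]
  | cons j c =>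
    refine (ins_mul2_left_of_eq χ (x := Alg.of (.chord j 0))
      (t := (arrows c ++ .chord i 0 :: .chord (i + 1) m :: w).map Alg.of) rfl hf
      (by simp)).trans ?_
    rw [hy, zero_mul, add_zero, if_neg (by simp)]
    simp only [List.length_cons] at hn
    exact (congrArg _ (hr.split c i m w hc.tail (by omega))).trans (mul_zero _)

/-- A reduced cocycle vanishes. -/
theorem Reduced.eq_zero (hχ : Mlin χ) (hN : IsMultilinear ground χ) (hN' : Normal χ) {n : ℕ}
    (hr : Reduced n χ) (hd : ∀ l : List Alg, l.length = n + 1 → delta χ l = 0) (hn : n ≠ 0)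
    {l : List Alg} (hl : l.length = n) : χ l = 0 := by
  -- If arrows precede the first long chord, the cocycle condition on the split list consists of
  -- this single value.
  have h1 : ∀ c i m (w : List Basic), c ≠ [] → Crit (c ++ [i]) → c.length + 1 + w.length = n →
      χ ((arrows c ++ .chord i (m + 1) :: w).map Alg.of) = 0 := by
    intro c i m w h0 hc hcw
    have := delta_split hχ hr hc hcw (m := m)
    rw [if_neg h0, add_zero, hd _ (by simp [arrows]; omega)] at this
    exact this.symm
  -- If the long chord comes first, the outer product involves a shorter first chord; hence the
  -- induction on its length.
  have h2 : ∀ m i (w : List Basic), w.length + 1 = n →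
      χ ((Basic.chord i m :: w).map Alg.of) = 0 := by
    intro m
    induction m with
    | zero =>
      intro i w hw
      by_cases hx : ∃ x, Basic.idem x ∈ Basic.chord i 0 :: w
      · obtain ⟨x, hx⟩ := hx
        exact eq_zero_of_idem hN hN' hx
      · push Not at hx
        rcases trichotomy _ hx with ⟨c, hc, h⟩ | ⟨c, i', m, w', hc, h⟩ | ⟨c, i', m, w', hc, h⟩
        · rw [h]
          refine hr.crit c hc ?_
          have := congrArg List.length h
          simp [arrows] at this
          omega
        · rw [h]
          refine hr.split c i' m w' hc ?_
          have := congrArg List.length h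
          simp [arrows] at this
          omega
        · rw [h]
          refine h1 c i' m w' ?_ hc ?_
          · rintro rfl
            simp [arrows] at h
          · have := congrArg List.length h
            simp [arrows] at this
            omega
    | succ m ih =>
      intro i w hw
      have := delta_split hχ hr (c := []) (List.isChain_singleton i) (m := m) (w := w)
        (by simp; omega)
      rw [if_pos rfl, ih (i + 1) w hw, mul_zero, add_zero, hd _ (by simp [arrows]; omega)] at this
      exact this.symm
  have h3 : ∀ bs : List Basic, bs.length = n → χ (bs.map Alg.of) = 0 := by
    intro bs hbs
    rcases bs with _ | ⟨b, w⟩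
    · exact absurd hbs.symm hn
    · rcases b with x | ⟨i, m⟩
      · exact eq_zero_of_idem hN hN' (x := x) (by simp)
      · exact h2 m i w hbs
  refine list_induction (Q := fun l => l.length = n → χ l = 0) (fun bs hbs => h3 bs (by simpa using hbs))
    ?_ ?_ l hl
  · intro xs ys a b ha hb hab
    rw [hχ.add, ha (by simpa using hab), hb (by simpa using hab), add_zero]
  · intro xs ys r a ha hab
    rw [hχ.smul, ha (by simpa using hab), smul_zero]

end Homotopy

end Torus

namespace Torus

open AInf

/-! ### The contracting homotopy -/

section Primitive

open Classical in
/-- Split off the first arrow of the first long chord, if the preceding arrows have vanishing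
consecutive products and the first nonzero product does not come earlier. -/
def splitFirst : (List Basic → Alg) → List Basic → Alg
  | F, .chord i 0 :: l =>
    if ∃ m w, l = .chord (i + 1) m :: w then 0 else splitFirst (fun l' => F (.chord i 0 :: l')) l
  | F, .chord i (m + 1) :: l => F (.chord i 0 :: .chord (i + 1) m :: l)
  | _, _ => 0

/-- The value of `contraction` on a list with first entry `chord i m`. -/
def contractionAux (F : List Basic → Alg) (l : List Basic) : ℕ → ZMod 4 → Alg
  | 0, i => splitFirst F (.chord i 0 :: l)
  | m + 1, i => F (.chord i 0 :: .chord (i + 1) m :: l) +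
      Alg.of (.chord i 0) * contractionAux F l m (i + 1)

/-- A contracting homotopy of the Hochschild complex onto the complex of reduced cochains. -/
def contraction (F : List Basic → Alg) : List Basic → Alg
  | .chord i m :: l => contractionAux F l m i
  | _ => 0

variable {F : List Basic → Alg}

theorem splitFirst_crit {c : List (ZMod 4)} (hc : Crit c) : splitFirst F (arrows c) = 0 := by
  induction c generalizing F with
  | nil => rfl
  | cons i c ih =>
    rw [arrows_cons, splitFirst]
    split_ifs
    · rfl
    · exact ih hc.tail

theorem splitFirst_split {c : List (ZMod 4)} {i : ZMod 4} (hc : Crit (c ++ [i])) (m : ℕ)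
    (w : List Basic) : splitFirst F (arrows c ++ .chord i 0 :: .chord (i + 1) m :: w) = 0 := by
  induction c generalizing F with
  | nil =>
    simp only [arrows, List.map_nil, List.nil_append, splitFirst]
    exact if_pos ⟨m, w, rfl⟩
  | cons j c ih =>
    rw [arrows_cons, List.cons_append, splitFirst]
    split_ifs
    · rfl
    · exact ih hc.tail

theorem splitFirst_long {c : List (ZMod 4)} {i : ZMod 4} (hc : Crit (c ++ [i])) (m : ℕ)
    (w : List Basic) : splitFirst F (arrows c ++ .chord i (m + 1) :: w) =
      F (arrows c ++ .chord i 0 :: .chord (i + 1) m :: w) := by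
  induction c generalizing F with
  | nil => rfl
  | cons j c ih =>
    rw [arrows_cons, List.cons_append, splitFirst, if_neg, ih hc.tail]
    · rfl
    · rintro ⟨m', w', h⟩
      cases c with
      | nil =>
        simp only [arrows, List.map_nil, List.nil_append, List.cons.injEq, Basic.chord.injEq] at h
        exact Crit.rel hc h.1.1
      | cons j' c =>
        simp only [arrows_cons, List.cons_append, List.cons.injEq, Basic.chord.injEq] at h
        exact Crit.rel hc h.1.1

theorem contraction_crit {c : List (ZMod 4)} (hc : Crit c) : contraction F (arrows c) = 0 := by
  cases c with
  | nil => rfl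
  | cons i c => exact splitFirst_crit hc

theorem contraction_split {c : List (ZMod 4)} {i : ZMod 4} (hc : Crit (c ++ [i])) (m : ℕ)
    (w : List Basic) : contraction F (arrows c ++ .chord i 0 :: .chord (i + 1) m :: w) = 0 := by
  cases c with
  | nil => exact splitFirst_split hc m w
  | cons j c => exact splitFirst_split hc m w

/-- This is the recursion obtained by solving `delta_split` for the value on the list with the long
chord, when the differential is prescribed to be `F`. -/
theorem contraction_long {c : List (ZMod 4)} {i : ZMod 4} (hc : Crit (c ++ [i])) (m : ℕ)
    (w : List Basic) : contraction F (arrows c ++ .chord i (m + 1) :: w) =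
      F (arrows c ++ .chord i 0 :: .chord (i + 1) m :: w) +
      if c = [] then Alg.of (.chord i 0) * contraction F (.chord (i + 1) m :: w) else 0 := by
  cases c with
  | nil => rw [if_pos rfl]; rfl
  | cons j c =>
    rw [if_neg (by simp), add_zero]
    exact splitFirst_long hc m w

theorem splitFirst_cases {p : Alg → Prop} (h0 : p 0) {l : List Basic}
    (h : ∀ u i m w, l = u ++ .chord i (m + 1) :: w →
      p (F (u ++ .chord i 0 :: .chord (i + 1) m :: w))) : p (splitFirst F l) := by
  induction l generalizing F with
  | nil => exact h0
  | cons b l ih =>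
    match b with
    | .idem x => exact h0
    | .chord i 0 =>
      rw [splitFirst]
      split_ifs
      · exact h0
      · refine ih fun u j m w hl => ?_
        have := h (.chord i 0 :: u) j m w (by rw [hl]; rfl)
        exact this
    | .chord i (m + 1) => exact h [] i m l rfl

theorem contraction_eq_zero {p : List Basic → Prop}
    (h : ∀ u i m w, p (u ++ .chord i (m + 1) :: w) →
      F (u ++ .chord i 0 :: .chord (i + 1) m :: w) = 0)
    (hp : ∀ i m w, p (.chord i (m + 1) :: w) → p (.chord (i + 1) m :: w)) {l : List Basic}
    (hl : p l) : contraction F l = 0 := by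
  match l with
  | [] => rfl
  | .idem x :: l => rfl
  | .chord i m :: l =>
    rw [contraction]
    induction m generalizing i with
    | zero =>
      exact splitFirst_cases (p := (· = 0)) rfl fun u j m w hu => h u j m w (hu ▸ hl)
    | succ m ih =>
      rw [contractionAux, ih _ (hp i m l hl), mul_zero, add_zero]
      exact h [] i m l hl

/-- Reassembling the chord keeps the product of the gradings and removes one input, so `d` drops by
one. -/
theorem Rel.merge {d : ℤ} {u w : List Basic} {i : ZMod 4} {m k : ℕ} {b : Basic}
    (h : Rel d (u ++ .chord i 0 :: .chord (i + 1) m :: w) k b) :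
    Rel (d - 1) (u ++ .chord i (m + 1) :: w) k b := by
  obtain ⟨h1, h2⟩ := h
  constructor
  · obtain ⟨y, hy, rfl, -, hw⟩ := isPath_append.1 h1
    refine isPath_append.2 ⟨_, hy, rfl, ?_⟩
    convert hw using 1
    simp only [tB]
    push_cast
    ring_nf
  · rw [h2]
    have e := gamBasic_chord_split i 0 m
    simp only [Nat.zero_add, Nat.cast_zero, add_zero] at e
    simp only [List.map_append, List.map_cons, List.prod_append, List.prod_cons, e,
      List.length_append, List.length_cons, mul_assoc]
    congr 2
    push_cast
    ring

/-- Lengthening the first chord by `ρ_i` and multiplying the output by `ρ_i` both multiply the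
grading by `γ(ρ_i)` on the left; the number of inputs is unchanged. -/
theorem Rel.mul_left {d : ℤ} {w : List Basic} {i : ZMod 4} {m k : ℕ} {b c : Basic}
    (hb : Basic.mul (.chord i 0) c = some b) (h : Rel d (.chord (i + 1) m :: w) k c) :
    Rel d (.chord i (m + 1) :: w) k b := by
  obtain ⟨⟨-, h1⟩, h2⟩ := h
  obtain ⟨-, h3, h4, h5⟩ := mul_eq_some hb
  refine ⟨⟨h3, ?_⟩, ?_⟩
  · rw [h4]
    convert h1 using 1
    simp only [tB]
    push_cast
    ring_nf
  · have e := gamBasic_chord_split i 0 m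
    simp only [Nat.zero_add, Nat.cast_zero, add_zero] at e
    have hU : ∀ g, Commute (gamU ^ k) g := fun g => (gamU_comm g).pow_left k
    have hL : ∀ z : ℤ, ∀ g, Commute (lam ^ z) g := fun z g => (lam_comm g).zpow_left z
    rw [h5, ← mul_assoc, (hU _).eq, mul_assoc, h2]
    simp only [List.map_cons, List.prod_cons, List.length_cons, e]
    rw [← mul_assoc, ← (hL _ _).eq]
    simp only [mul_assoc]

theorem cf_of_mul {a : Basic} {y : Alg} {b : Basic} {k : ℕ} (h : cf (Alg.of a * y) b k ≠ 0) :
    ∃ c, Basic.mul a c = some b ∧ cf y c k ≠ 0 := by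
  obtain ⟨c, i, j, rfl, hc, hb⟩ := exists_cf_of_linear (LinearMap.mulLeft F2U (Alg.of a)) h
  rw [LinearMap.mulLeft_apply, of_mul_of] at hb
  cases hm : Basic.mul a c with
  | none => rw [hm] at hb; exact absurd (cf_zero b j) hb
  | some c' =>
    rw [hm] at hb
    have hb' : cf (Alg.of c') b j ≠ 0 := hb
    rw [cf_of] at hb'
    obtain ⟨rfl, rfl⟩ : c' = b ∧ j = 0 := by
      by_contra hc
      exact hb' (if_neg hc)
    exact ⟨c, hm, hc⟩

theorem rel_contraction {d : ℤ} (hF : ∀ l b k, cf (F l) b k ≠ 0 → Rel d l k b) {l : List Basic}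
    {b : Basic} {k : ℕ} (h : cf (contraction F l) b k ≠ 0) : Rel (d - 1) l k b := by
  match l with
  | [] => exact absurd (cf_zero b k) h
  | .idem x :: l => exact absurd (cf_zero b k) h
  | .chord i m :: l =>
    rw [contraction] at h
    induction m generalizing i b with
    | zero =>
      by_contra hR
      refine h (splitFirst_cases (p := fun x => cf x b k = 0) (cf_zero b k) fun u j m w hu => ?_)
      by_contra hne
      rw [hu] at hR
      exact hR (hF _ _ _ hne).merge
    | succ m ih =>
      rw [contractionAux, cf_add] at h
      by_cases h1 : cf (F (.chord i 0 :: .chord (i + 1) m :: l)) b k = 0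
      · rw [h1, zero_add] at h
        obtain ⟨c, hc, hc'⟩ := cf_of_mul h
        exact (ih (i + 1) hc').mul_left hc
      · exact Rel.merge (u := []) (hF _ _ _ h1)

/-- Every cochain is, on the lists of arrows with vanishing products followed by a composable
chord, the differential of a reduced cochain. -/
theorem exists_primitive {d : ℤ} {φ : List Alg → Alg} (hφ : Coch d φ) (hN : Normal φ) (n : ℕ) :
    ∃ ψ, Coch (d - 1) ψ ∧ Normal ψ ∧ (∀ l, l.length ≠ n → ψ l = 0) ∧ Reduced n ψ ∧
      ∀ c i m (w : List Basic), Crit (c ++ [i]) → c.length + 1 + w.length = n →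
        delta ψ ((arrows c ++ .chord i 0 :: .chord (i + 1) m :: w).map Alg.of) =
          φ ((arrows c ++ .chord i 0 :: .chord (i + 1) m :: w).map Alg.of) := by
  -- Splitting a chord adds one letter, so restricting `φ` to `n + 1` inputs concentrates the
  -- contraction in `n` inputs.
  let F : List Basic → Alg := fun l => if l.length = n + 1 then φ (l.map Alg.of) else 0
  have hm : Mlin (ext (contraction F)) := mlin_ext _
  have hF : ∀ l : List Basic, l.length = n + 1 → F l = φ (l.map Alg.of) := fun l hl => if_pos hl
  have hlen : ∀ l : List Alg, l.length ≠ n → ext (contraction F) l = 0 := by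
    intro l hl
    refine ext_zero (n := l.length) (fun bs hbs => ?_) rfl
    refine contraction_eq_zero (p := fun bs => bs.length ≠ n) (fun u i m w hp => if_neg ?_)
      (fun i m w hp => hp) (by omega)
    simp at hp ⊢
    omega
  have hred : Reduced n (ext (contraction F)) :=
    ⟨fun c hc _ => by rw [ext_of, contraction_crit hc],
      fun c i m w hc _ => by rw [ext_of, contraction_split hc]⟩
  refine ⟨ext (contraction F), ⟨hm, rfl, fun l b k hb => ?_⟩, ?_, hlen, hred, ?_⟩
  · rw [ext_of] at hb
    refine rel_contraction (fun l b k h => ?_) hb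
    by_cases hl : l.length = n + 1
    · rw [hF l hl] at h
      exact hφ.supp l b k h
    · exact absurd ((congrArg (fun x => cf x b k) (if_neg hl)).trans (cf_zero b k)) h
  · refine normal_of_basic hm fun bs x hx => ?_
    rw [ext_of]
    refine contraction_eq_zero (p := fun bs => Basic.idem x ∈ bs) (fun u i m w hp => ?_)
      (fun i m w hp => by simpa using hp) hx
    by_cases hl : (u ++ .chord i 0 :: .chord (i + 1) m :: w).length = n + 1
    · rw [hF _ hl]
      exact eq_zero_of_idem hφ.isMultilinear hN (x := x) (by simpa using hp)
    · exact if_neg hl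
  · intro c i m w hc hn
    rw [delta_split hm hred hc hn, ext_of, ext_of, contraction_long hc, add_assoc]
    split_ifs
    · rw [add_self, add_zero, hF _ (by simp [arrows]; omega)]
    · rw [add_zero, add_zero, hF _ (by simp [arrows]; omega)]

end Primitive

end Torus

namespace Torus

open AInf

/-! ### Integral coordinates on the grading group -/

section Coordinates

/-- Integral coordinates `(4m, 2a, 2b, w)` of elements `(m; a, b) × w` of `Γ`. -/
abbrev Coord : Type := ℤ × ℤ × ℤ × ℤ

/-- The group law in integral coordinates. -/
def mulCoord (x y : Coord) : Coord :=
  (x.1 + y.1 + x.2.1 * y.2.2.1 - x.2.2.1 * y.2.1, x.2.1 + y.2.1, x.2.2.1 + y.2.2.1,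
    x.2.2.2 + y.2.2.2)

/-- The element `g` has the integral coordinates `x`. -/
def HasCoord (g : Gam) (x : Coord) : Prop :=
  4 * g.1.1.m = x.1 ∧ 2 * g.1.1.a = x.2.1 ∧ 2 * g.1.1.b = x.2.2.1 ∧
    Multiplicative.toAdd g.2 = x.2.2.2

/-- The factor four in the first coordinate turns `ad - bc` into `(2a)(2d) - (2b)(2c)`, an integer.
Comparisons of gradings thus become decidable. -/
theorem HasCoord.mul {g h : Gam} {x y : Coord} (hg : HasCoord g x) (hh : HasCoord h y) :
    HasCoord (g * h) (mulCoord x y) := by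
  obtain ⟨g1, g2, g3, g4⟩ := hg
  obtain ⟨h1, h2, h3, h4⟩ := hh
  refine ⟨?_, ?_, ?_, ?_⟩
  · simp only [Prod.fst_mul, Subgroup.coe_mul, Triple.mul_def, mulCoord]
    push_cast
    rw [← g1, ← h1, ← g2, ← g3, ← h2, ← h3]
    ring
  · simp only [Prod.fst_mul, Subgroup.coe_mul, Triple.mul_def, mulCoord]
    push_cast
    rw [← g2, ← h2]
    ring
  · simp only [Prod.fst_mul, Subgroup.coe_mul, Triple.mul_def, mulCoord]
    push_cast
    rw [← g3, ← h3]
    ring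
  · simp only [Prod.snd_mul, toAdd_mul, g4, h4, mulCoord]

theorem hasCoord_one : HasCoord 1 (0, 0, 0, 0) := by
  refine ⟨?_, ?_, ?_, rfl⟩ <;> simp [Triple.one_def]

theorem HasCoord.unique {g : Gam} {x y : Coord} (hx : HasCoord g x) (hy : HasCoord g y) :
    x = y := by
  obtain ⟨h1, h2, h3, h4⟩ := hx
  obtain ⟨g1, g2, g3, g4⟩ := hy
  rw [h1] at g1
  rw [h2] at g2
  rw [h3] at g3
  rw [h4] at g4
  exact Prod.ext (by exact_mod_cast g1) (Prod.ext (by exact_mod_cast g2)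
    (Prod.ext (by exact_mod_cast g3) g4))

theorem HasCoord.ext {g h : Gam} {x : Coord} (hg : HasCoord g x) (hh : HasCoord h x) : g = h := by
  obtain ⟨h1, h2, h3, h4⟩ := hg
  obtain ⟨g1, g2, g3, g4⟩ := hh
  refine Prod.ext (Subtype.ext (Triple.ext ?_ ?_ ?_)) (h4.trans g4.symm) <;> linarith

/-- The coordinates of `γ(ρ_i)`. -/
def rhoCoord (i : ZMod 4) : Coord :=
  if i = 1 then (-2, 1, -1, 0) else if i = 2 then (-2, 1, 1, 0)
  else if i = 3 then (-2, -1, 1, 0) else (-6, -1, -1, 1)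

theorem hasCoord_rho (i : ZMod 4) : HasCoord (gamRho i) (rhoCoord i) := by
  unfold gamRho rhoCoord
  split_ifs <;> refine ⟨?_, ?_, ?_, rfl⟩ <;> simp only [Gam.mk] <;> norm_num

theorem hasCoord_lam_zpow (z : ℤ) : HasCoord (lam ^ z) (4 * z, 0, 0, 0) := by
  have hn : ∀ n : ℕ, HasCoord (lam ^ n) (4 * n, 0, 0, 0) := by
    intro n
    induction n with
    | zero => exact hasCoord_one
    | succ n ih =>
      have h1 : HasCoord lam (4, 0, 0, 0) := by
        refine ⟨?_, ?_, ?_, rfl⟩ <;> simp only [lam, Gam.mk] <;> norm_num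
      have := ih.mul h1
      rw [pow_succ]
      convert this using 1
      simp [mulCoord]
      ring
  rcases Int.eq_nat_or_neg z with ⟨n, rfl | rfl⟩
  · rw [zpow_natCast]
    exact hn n
  · rw [zpow_neg, zpow_natCast]
    obtain ⟨h1, h2, h3, h4⟩ := hn n
    refine ⟨?_, ?_, ?_, ?_⟩
    · simp only [Prod.fst_inv, Subgroup.coe_inv, Triple.inv_def]
      push_cast at h1 ⊢
      linarith
    · simp only [Prod.fst_inv, Subgroup.coe_inv, Triple.inv_def]
      push_cast at h2 ⊢
      linarith
    · simp only [Prod.fst_inv, Subgroup.coe_inv, Triple.inv_def]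
      push_cast at h3 ⊢
      linarith
    · simp only [Prod.snd_inv, toAdd_inv, h4, neg_zero]

theorem hasCoord_gamU_pow (n : ℕ) : HasCoord (gamU ^ n) (-8 * n, 0, 0, n) := by
  induction n with
  | zero => exact hasCoord_one
  | succ n ih =>
    have h1 : HasCoord gamU (-8, 0, 0, 1) := by
      refine ⟨?_, ?_, ?_, rfl⟩ <;> simp only [gamU, Gam.mk] <;> norm_num
    have := ih.mul h1
    rw [pow_succ]
    convert this using 1
    simp [mulCoord]
    ring

/-- The product of the coordinates of arrows. -/
def prodCoord : List (ZMod 4) → Coord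
  | [] => (0, 0, 0, 0)
  | i :: c => mulCoord (rhoCoord i) (prodCoord c)

theorem hasCoord_prod (c : List (ZMod 4)) : HasCoord (c.map gamRho).prod (prodCoord c) := by
  induction c with
  | nil => exact hasCoord_one
  | cons i c ih => rw [List.map_cons, List.prod_cons]; exact (hasCoord_rho i).mul ih

/-- The indices `j, j - 1, …` of `n` arrows. -/
def dec : ZMod 4 → ℕ → List (ZMod 4)
  | _, 0 => []
  | j, n + 1 => j :: dec (j - 1) n

/-- The indices `i, i + 1, …` of `n` arrows. -/
def inc : ZMod 4 → ℕ → List (ZMod 4)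
  | _, 0 => []
  | i, n + 1 => i :: inc (i + 1) n

theorem length_dec (j : ZMod 4) (n : ℕ) : (dec j n).length = n := by
  induction n generalizing j with
  | zero => rfl
  | succ n ih => rw [dec, List.length_cons, ih]

theorem inc_eq (i : ZMod 4) (n : ℕ) : inc i n = (List.range n).map fun k : ℕ => i + k := by
  induction n generalizing i with
  | zero => rfl
  | succ n ih =>
    rw [inc, ih, List.range_succ_eq_map, List.map_cons, List.map_map, Nat.cast_zero, add_zero]
    congr 2
    funext k
    simp only [Function.comp_apply]
    push_cast
    ring

theorem hasCoord_chord (i : ZMod 4) (n : ℕ) :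
    HasCoord (gamBasic (.chord i n)) (prodCoord (inc i (n + 1))) := by
  have := hasCoord_prod (inc i (n + 1))
  rw [inc_eq, List.map_map] at this
  rw [inc_eq]
  exact this

theorem gamBasic_arrow (i : ZMod 4) : gamBasic (.chord i 0) = gamRho i := by
  simp [gamBasic]

theorem hasCoord_arrows (c : List (ZMod 4)) :
    HasCoord ((arrows c).map gamBasic).prod (prodCoord c) := by
  have := hasCoord_prod c
  rwa [show (arrows c).map gamBasic = c.map gamRho by
    rw [arrows, List.map_map]
    exact List.map_congr_left fun i _ => gamBasic_arrow i]

theorem prodCoord_append (c c' : List (ZMod 4)) :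
    prodCoord (c ++ c') = mulCoord (prodCoord c) (prodCoord c') := by
  induction c with
  | nil => simp [prodCoord, mulCoord]
  | cons i c ih =>
    rw [List.cons_append, prodCoord, prodCoord, ih]
    simp only [mulCoord, Prod.mk.injEq]
    refine ⟨?_, ?_, ?_, ?_⟩ <;> ring

theorem prodCoord_inc_four : ∀ i, prodCoord (inc i 4) = (-8, 0, 0, 1) := by decide

/-- A full descending turn differs from a full ascending turn, and from `γ(U)`, by `λ^(-2)`. Each
descending turn therefore contributes two to `d`, since its four inputs also contribute `λ^4`. -/
theorem prodCoord_dec_four : ∀ j, prodCoord (dec j 4) = (-16, 0, 0, 1) := by decide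

theorem inc_add_four (i : ZMod 4) (n : ℕ) : inc i (n + 4) = inc i 4 ++ inc i n := by
  simp only [inc, List.cons_append, List.nil_append]
  rw [show i + 1 + 1 + 1 + 1 = i by revert i; decide]

theorem dec_add_four (j : ZMod 4) (n : ℕ) : dec j (n + 4) = dec j 4 ++ dec j n := by
  simp only [dec, List.cons_append, List.nil_append]
  rw [show j - 1 - 1 - 1 - 1 = j by revert j; decide]

theorem prodCoord_inc (i : ZMod 4) (p s : ℕ) : prodCoord (inc i (4 * p + s)) =
    ((prodCoord (inc i s)).1 - 8 * p, (prodCoord (inc i s)).2.1, (prodCoord (inc i s)).2.2.1,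
      (prodCoord (inc i s)).2.2.2 + p) := by
  induction p with
  | zero => simp
  | succ p ih =>
    rw [show 4 * (p + 1) + s = (4 * p + s) + 4 by ring, inc_add_four, prodCoord_append, ih,
      prodCoord_inc_four]
    simp only [mulCoord, Prod.mk.injEq]
    push_cast
    refine ⟨?_, ?_, ?_, ?_⟩ <;> ring

theorem prodCoord_dec (i : ZMod 4) (p s : ℕ) : prodCoord (dec i (4 * p + s)) =
    ((prodCoord (dec i s)).1 - 16 * p, (prodCoord (dec i s)).2.1, (prodCoord (dec i s)).2.2.1,
      (prodCoord (dec i s)).2.2.2 + p) := by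
  induction p with
  | zero => simp
  | succ p ih =>
    rw [show 4 * (p + 1) + s = (4 * p + s) + 4 by ring, dec_add_four, prodCoord_append, ih,
      prodCoord_dec_four]
    simp only [mulCoord, Prod.mk.injEq]
    push_cast
    refine ⟨?_, ?_, ?_, ?_⟩ <;> ring

theorem src_eq_src : ∀ i j : ZMod 4, src i = src j ↔ i = j ∨ i = j + 2 := by decide

set_option synthInstance.maxHeartbeats 400000 in
set_option synthInstance.maxSize 4000 in
/-- Comparison of the coordinates of increasing and decreasing sequences of arrows. -/
theorem coord_table : ∀ (i j : ZMod 4) (r s : Fin 4), src i = src j →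
    src (i + (s : ℕ)) = src (j - (r : ℕ)) →
    (prodCoord (inc i s)).2.1 = (prodCoord (dec j r)).2.1 →
    (prodCoord (inc i s)).2.2.1 = (prodCoord (dec j r)).2.2.1 →
    (prodCoord (inc i s)).2.2.2 = (prodCoord (dec j r)).2.2.2 ∧
    (r = 0 ∧ s = 0 ∧ (prodCoord (inc i s)).1 = (prodCoord (dec j r)).1 ∨
      r = 1 ∧ s = 1 ∧ i = j ∧ (prodCoord (inc i s)).1 = (prodCoord (dec j r)).1 ∨
      r = 3 ∧ s = 3 ∧ i = j + 2 ∧ (prodCoord (inc i s)).1 = (prodCoord (dec j r)).1 + 8) := by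
  decide

end Coordinates

/-! ### Which critical lists and outputs the grading allows -/

section Critical

/-- Two arrows start where `ρ_j` ends, namely `ρ_{j+1}` and `ρ_{j-1}`, and criticality excludes the
first. -/
theorem eq_dec_of_isPath {c : List (ZMod 4)} (hc : Crit c) {j : ZMod 4} {y : ZMod 2}
    (h : IsPath (src j) (arrows (j :: c)) y) (hc' : Crit (j :: c)) :
    j :: c = dec j (c.length + 1) ∧ y = src (j - (c.length + 1 : ℕ)) := by
  induction c generalizing j with
  | nil =>
    obtain ⟨-, h2⟩ := h
    refine ⟨rfl, ?_⟩
    have h2 : src (j + (0 : ℕ) + 1) = y := h2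
    rw [← h2]
    have key : ∀ j : ZMod 4, src (j + (0 : ℕ) + 1) = src (j - (0 + 1 : ℕ)) := by decide
    exact key j
  | cons i c ih =>
    obtain ⟨-, h2⟩ := h
    have h3 : src (j + (0 : ℕ) + 1) = src i := h2.1
    have hij : i = j - 1 := by
      have := hc'.rel
      revert h3 this
      clear * -
      revert i j
      decide
    have h2 : IsPath (src (j + (0 : ℕ) + 1)) (arrows (i :: c)) y := h2
    rw [h3] at h2
    obtain ⟨h4, h5⟩ := ih hc.tail h2 hc
    subst hij
    refine ⟨?_, ?_⟩
    · exact congrArg (List.cons j) h4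
    · rw [h5, List.length_cons]
      push_cast
      ring_nf

/-- The possible inputs and outputs of a cochain on arrows with vanishing consecutive products. -/
theorem rel_arrows {d : ℤ} {c : List (ZMod 4)} (hc : Crit c) (h0 : c ≠ []) {k : ℕ} {b : Basic}
    (h : Rel d (arrows c) k b) : ∃ (j : ZMod 4) (q r p s : ℕ), c = dec j (4 * q + r) ∧
      p + k = q ∧ sB b = src j ∧
      ((b = .idem (src j) ∧ p = 0 ∧ s = 0) ∨ ∃ i m, b = .chord i m ∧ m + 1 = 4 * p + s ∧
        src i = src j ∧ (r = 3 → i = j + 2)) ∧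
      (r = 0 ∧ s = 0 ∧ 2 * (q : ℤ) = d ∨ r = 1 ∧ s = 1 ∧ 2 * (q : ℤ) = d - 1 ∨
        r = 3 ∧ s = 3 ∧ 2 * (q : ℤ) = d - 1) := by
  obtain ⟨h1, h2⟩ := h
  cases c with
  | nil => exact absurd rfl h0
  | cons j c =>
    have hs : sB b = src j := h1.1
    rw [hs] at h1
    obtain ⟨h3, h4⟩ := eq_dec_of_isPath hc.tail h1 hc
    rw [h3] at h2 ⊢
    generalize c.length + 1 = n at h2 h4 ⊢
    obtain ⟨q, r, rfl⟩ : ∃ (q : ℕ) (r : Fin 4), n = 4 * q + r :=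
      ⟨n / 4, ⟨n % 4, Nat.mod_lt _ (by norm_num)⟩, (Nat.div_add_mod n 4).symm⟩
    have h4' : tB b = src (j - ((r : ℕ) : ZMod 4)) := by
      rw [h4]
      push_cast
      rw [show (4 : ZMod 4) = 0 from rfl, zero_mul, zero_add]
    obtain ⟨i, p, s, hb, hi, ht, hγ⟩ : ∃ (i : ZMod 4) (p : ℕ) (s : Fin 4),
        ((b = .idem (src j) ∧ p = 0 ∧ s = 0) ∨ ∃ m, b = .chord i m ∧ m + 1 = 4 * p + s) ∧
        src i = src j ∧ tB b = src (i + ((s : ℕ) : ZMod 4)) ∧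
        HasCoord (gamBasic b) (prodCoord (inc i (4 * p + s))) := by
      rcases b with x | ⟨i, m⟩
      · obtain rfl : x = src j := hs
        exact ⟨j, 0, 0, Or.inl ⟨rfl, rfl, rfl⟩, rfl, by simp [tB], hasCoord_one⟩
      · refine ⟨i, (m + 1) / 4, ⟨(m + 1) % 4, Nat.mod_lt _ (by norm_num)⟩, Or.inr ⟨m, rfl, ?_⟩, hs,
          ?_, ?_⟩
        · exact (Nat.div_add_mod _ 4).symm
        · simp only [tB]
          rw [ZMod.natCast_mod, add_assoc]
          push_cast
          rfl
        · rw [Nat.div_add_mod]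
          exact hasCoord_chord i m
    have hL := (hasCoord_gamU_pow k).mul hγ
    have hR := (hasCoord_lam_zpow (((arrows (dec j (4 * q + r))).length : ℤ) - d)).mul
      (hasCoord_arrows (dec j (4 * q + r)))
    rw [← h2] at hR
    have hE := hL.unique hR
    rw [prodCoord_inc, prodCoord_dec, arrows, List.length_map, length_dec] at hE
    simp only [mulCoord, Prod.mk.injEq, zero_mul, add_zero, sub_zero, zero_add] at hE
    push_cast at hE
    obtain ⟨e1, e2, e3, e4⟩ := hE
    -- Full turns affect only the first and last coordinates, so the middle ones concern the
    -- residues `r` and `s` alone, and the finite table applies. The last coordinate then gives `p +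
    -- k = q`, and the first relates `q` to `d`.
    obtain ⟨t1, t2⟩ := coord_table i j r s hi (ht.symm.trans h4') e2 e3
    refine ⟨j, q, r, p, s, rfl, by omega, hs, ?_, ?_⟩
    · rcases hb with ⟨h5, h6, h7⟩ | ⟨m, hm, hm'⟩
      · exact Or.inl ⟨h5, h6, by rw [h7]; rfl⟩
      · refine Or.inr ⟨i, m, hm, hm', hi, fun hr => ?_⟩
        rcases t2 with ⟨hr', -⟩ | ⟨hr', -⟩ | ⟨-, -, hij, -⟩
        · rw [hr'] at hr; exact absurd hr (by decide)
        · rw [hr'] at hr; exact absurd hr (by decide)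
        · exact hij
    · rcases t2 with ⟨rfl, rfl, e5⟩ | ⟨rfl, rfl, -, e5⟩ | ⟨rfl, rfl, -, e5⟩
      · left
        refine ⟨rfl, rfl, ?_⟩
        rw [e5] at e1
        simp only [Fin.val_zero, Nat.cast_zero] at e1
        omega
      · right; left
        refine ⟨rfl, rfl, ?_⟩
        rw [e5] at e1
        simp only [Fin.val_one, Nat.cast_one] at e1
        omega
      · right; right
        refine ⟨rfl, rfl, ?_⟩
        rw [e5] at e1
        simp only [show ((3 : Fin 4) : ℕ) = 3 from rfl, Nat.cast_ofNat] at e1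
        omega

/-- By parity an even `d` leaves only `r = s = 0`, and `d = 2` means one descending turn. The output
is then `U` times an idempotent or one ascending turn. -/
theorem rel_two_arrows {c : List (ZMod 4)} (hc : Crit c) (h0 : c ≠ []) {k : ℕ} {b : Basic}
    (h : Rel 2 (arrows c) k b) : ∃ j, c = dec j 4 ∧
      (k = 1 ∧ b = .idem (src j) ∨ k = 0 ∧ ∃ i, src i = src j ∧ b = .chord i 3) := by
  obtain ⟨j, q, r, p, s, hd, hk, -, hb, h⟩ := rel_arrows hc h0 h
  obtain ⟨rfl, rfl, rfl⟩ : r = 0 ∧ s = 0 ∧ q = 1 := by omega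
  refine ⟨j, hd, ?_⟩
  rcases hb with ⟨h1, rfl, -⟩ | ⟨i, m, rfl, hm, hi, -⟩
  · exact Or.inl ⟨by omega, h1⟩
  · obtain ⟨rfl, rfl⟩ : k = 0 ∧ m = 3 := by omega
    exact Or.inr ⟨rfl, i, hi, rfl⟩

/-- For `d = 3` parity leaves the residues `1` and `3`, again after one full turn. -/
theorem rel_three_arrows {c : List (ZMod 4)} (hc : Crit c) (h0 : c ≠ []) {k : ℕ} {b : Basic}
    (h : Rel 3 (arrows c) k b) :
    (∃ j, c = dec j 5) ∨ ∃ j, c = dec j 7 ∧ ∃ m : ℕ, (m : ZMod 4) = 2 ∧ b = .chord (j + 2) m := by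
  obtain ⟨j, q, r, p, s, rfl, hk, -, hb, h⟩ := rel_arrows hc h0 h
  rcases h with h | ⟨rfl, rfl, h⟩ | ⟨rfl, rfl, h⟩
  · omega
  · obtain rfl : q = 1 := by omega
    exact Or.inl ⟨j, rfl⟩
  · right
    obtain rfl : q = 1 := by omega
    refine ⟨j, rfl, ?_⟩
    rcases hb with ⟨-, -, h1⟩ | ⟨i, m, rfl, hm, -, hi⟩
    · omega
    · obtain rfl : m = 4 * p + 2 := by omega
      refine ⟨_, ?_, by rw [hi rfl]⟩
      push_cast
      rw [show (4 : ZMod 4) = 0 from rfl, zero_mul, zero_add]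

theorem rel_one_arrows {c : List (ZMod 4)} (hc : Crit c) (h0 : c ≠ []) {k : ℕ} {b : Basic}
    (h : Rel 1 (arrows c) k b) : c.length = 1 ∨ c.length = 3 := by
  obtain ⟨j, q, r, p, s, rfl, -, -, -, h⟩ := rel_arrows hc h0 h
  rw [length_dec]
  omega

end Critical

end Torus

namespace Torus

open AInf

/-! ### Coefficients of products with arrows -/

section ArrowProducts

theorem cf_eq_coeff (x : Alg) (b : Basic) (k : ℕ) : cf x b k = (co b x).coeff k := rfl

/-- Two linear functions on the torus algebra which agree on basic elements are equal. -/
theorem linear_ext {L L' : Alg →ₗ[F2U] F2U} (h : ∀ b, L (Alg.of b) = L' (Alg.of b)) (y : Alg) :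
    L y = L' y :=
  congrArg (fun k : Alg →ₗ[F2U] F2U => k y) (Alg.hom_ext h)

/-- Left multiplication by a basic element. -/
def mulLeft (a : Basic) : Alg →ₗ[F2U] Alg where
  toFun y := Alg.of a * y
  map_add' := mul_add _
  map_smul' r y := mul_smul' r _ y

/-- Right multiplication by a basic element. -/
def mulRight (a : Basic) : Alg →ₗ[F2U] Alg where
  toFun y := y * Alg.of a
  map_add' y z := add_mul y z _
  map_smul' r y := smul_mul r y _

theorem co_arrow_mul_succ (i : ZMod 4) (m : ℕ) (y : Alg) :
    co (.chord i (m + 1)) (Alg.of (.chord i 0) * y) = co (.chord (i + 1) m) y := by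
  refine linear_ext (L := (co (.chord i (m + 1))).comp (mulLeft (.chord i 0)))
    (L' := co (.chord (i + 1) m)) (fun b => ?_) y
  change co _ (Alg.of _ * Alg.of b) = _
  rw [of_mul_of]
  rcases b with x | ⟨j, n⟩
  · simp only [Basic.mul]
    split_ifs <;> simp [Alg.ofOption, co_of]
  · simp only [Basic.mul]
    by_cases h : j = i + 1
    · simp [Alg.ofOption, co_of, h]
    · simp [Alg.ofOption, co_of, h]

theorem co_arrow_mul_zero (i : ZMod 4) (y : Alg) :
    co (.chord i 0) (Alg.of (.chord i 0) * y) = co (.idem (src (i + 1))) y := by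
  refine linear_ext (L := (co (.chord i 0)).comp (mulLeft (.chord i 0)))
    (L' := co (.idem (src (i + 1)))) (fun b => ?_) y
  change co _ (Alg.of _ * Alg.of b) = _
  rw [of_mul_of]
  rcases b with x | ⟨j, n⟩
  · simp only [Basic.mul]
    by_cases h : x = src (i + 1)
    · simp [Alg.ofOption, co_of, h]
    · simp [Alg.ofOption, co_of, h]
  · simp only [Basic.mul]
    split_ifs <;> simp [Alg.ofOption, co_of]

theorem co_arrow_mul_of_ne {i j : ZMod 4} (h : i ≠ j) (m : ℕ) (y : Alg) :
    co (.chord j m) (Alg.of (.chord i 0) * y) = 0 := by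
  refine linear_ext (L := (co (.chord j m)).comp (mulLeft (.chord i 0))) (L' := 0) (fun b => ?_) y
  change co _ (Alg.of _ * Alg.of b) = _
  rw [of_mul_of]
  rcases b with x | ⟨j, n⟩ <;>
  · simp only [Basic.mul]
    split_ifs <;> simp [Alg.ofOption, co_of, h]

theorem co_mul_arrow_succ (i a : ZMod 4) (m : ℕ) (y : Alg) :
    co (.chord a (m + 1)) (y * Alg.of (.chord i 0)) =
      if i = a + m + 1 then co (.chord a m) y else 0 := by
  refine linear_ext (L := (co (.chord a (m + 1))).comp (mulRight (.chord i 0)))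
    (L' := if i = a + m + 1 then co (.chord a m) else 0) (fun b => ?_) y |>.trans ?_
  · change co _ (Alg.of b * Alg.of _) = _
    rw [of_mul_of]
    rcases b with x | ⟨j, n⟩
    · simp only [Basic.mul]
      split_ifs <;> simp [Alg.ofOption, co_of]
    · simp only [Basic.mul]
      by_cases h : j = a ∧ n = m
      · obtain ⟨rfl, rfl⟩ := h
        split_ifs <;> simp [Alg.ofOption, co_of]
      · split_ifs <;> simp [Alg.ofOption, co_of, h]
  · split_ifs <;> rfl

theorem co_mul_arrow_zero (i : ZMod 4) (y : Alg) :
    co (.chord i 0) (y * Alg.of (.chord i 0)) = co (.idem (src i)) y := by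
  refine linear_ext (L := (co (.chord i 0)).comp (mulRight (.chord i 0)))
    (L' := co (.idem (src i))) (fun b => ?_) y
  change co _ (Alg.of b * Alg.of _) = _
  rw [of_mul_of]
  rcases b with x | ⟨j, n⟩
  · simp only [Basic.mul]
    by_cases h : x = src i
    · simp [Alg.ofOption, co_of, h]
    · simp [Alg.ofOption, co_of, h]
  · simp only [Basic.mul]
    split_ifs <;> simp [Alg.ofOption, co_of]

end ArrowProducts

/-! ### Correction of a cocycle that vanishes on critical lists -/

section Correction

theorem dec_succ_append (j : ZMod 4) (n : ℕ) : dec j (n + 1) = dec j n ++ [j - n] := by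
  induction n generalizing j with
  | zero => simp [dec]
  | succ n ih =>
    rw [dec, ih, dec, List.cons_append]
    congr 3
    push_cast
    ring

theorem crit_dec (j : ZMod 4) (n : ℕ) : Crit (dec j n) := by
  induction n generalizing j with
  | zero => exact List.isChain_nil
  | succ n ih =>
    cases n with
    | zero => exact List.isChain_singleton _
    | succ n =>
      refine List.isChain_cons_cons.2 ⟨?_, ih (j - 1)⟩
      revert j
      decide

variable {χ : List Alg → Alg}

theorem delta_arrows (hχ : Mlin χ) {c c' : List (ZMod 4)} {i j : ZMod 4} (hc : Crit (i :: c))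
    (h : i :: c = c' ++ [j]) (h0 : c ≠ []) : delta χ ((arrows (i :: c)).map Alg.of) =
      Alg.of (.chord i 0) * χ ((arrows c).map Alg.of) +
        χ ((arrows c').map Alg.of) * Alg.of (.chord j 0) := by
  rw [delta, ins_mul2_arrows hχ hc, add_zero]
  refine ins_mul2_left_of_eq χ rfl ?_ (by simpa [arrows] using h0)
  rw [h]
  simp [arrows]

theorem delta_arrows_dec (hχ : Mlin χ) (j : ZMod 4) (n : ℕ) :
    delta χ ((arrows (dec j (n + 2))).map Alg.of) =
      Alg.of (.chord j 0) * χ ((arrows (dec (j - 1) (n + 1))).map Alg.of) +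
        χ ((arrows (dec j (n + 1))).map Alg.of) * Alg.of (.chord (j - (n + 1 : ℕ)) 0) :=
  delta_arrows hχ (crit_dec j (n + 2)) (dec_succ_append j (n + 1)) (by simp [dec])

/-- On a critical list only the outer products remain, and omitting an end letter leaves a critical
list. Corrections by reduced cochains thus never disturb critical values of the obstruction. -/
theorem Reduced.delta_arrows_eq_zero {n : ℕ} (hr : Reduced n χ) (hχ : Mlin χ) (hn : n ≠ 0)
    {c : List (ZMod 4)} (hc : Crit c) (hl : c.length = n + 1) :
    delta χ ((arrows c).map Alg.of) = 0 := by
  cases c with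
  | nil => simp at hl
  | cons i c =>
    obtain ⟨c', j, hcj⟩ : ∃ c' j, i :: c = c' ++ [j] :=
      ⟨(i :: c).dropLast, (i :: c).getLast (by simp), (List.dropLast_append_getLast _).symm⟩
    have hlen := congrArg List.length hcj
    simp only [List.length_cons, List.length_append, List.length_nil] at hl hlen
    have h0 : c ≠ [] := by
      rintro rfl
      simp at hl
      omega
    have hc' : Crit c' := by
      rw [hcj] at hc
      exact hc.left
    rw [delta_arrows hχ hc hcj h0, hr.crit c hc.tail (by omega), hr.crit c' hc' (by omega),
      mul_zero, zero_mul, add_zero]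

/-- A cochain can be changed in length `n + 1`, by the differential of a reduced cochain, so that it
vanishes in this length if it is a cocycle and vanishes on lists of arrows with vanishing
consecutive products. -/
theorem exists_correction {d : ℤ} {φ : List Alg → Alg} (hφ : Coch d φ) (hN : Normal φ) (n : ℕ) :
    ∃ ψ, Coch (d - 1) ψ ∧ Normal ψ ∧ (∀ l, l.length ≠ n → ψ l = 0) ∧ Reduced n ψ ∧
      ∀ χ, Coch d χ → Normal χ → (∀ l, l.length = n + 1 → χ l = φ l + delta ψ l) →
        (∀ l, l.length = n + 2 → delta χ l = 0) →
        (∀ c, Crit c → c.length = n + 1 → χ ((arrows c).map Alg.of) = 0) →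
        ∀ l, l.length = n + 1 → χ l = 0 := by
  obtain ⟨ψ, h1, h2, h3, h4, h5⟩ := exists_primitive hφ hN n
  refine ⟨ψ, h1, h2, h3, h4, fun χ hχ hχN hχφ hχd hχc l hl => ?_⟩
  refine Reduced.eq_zero hχ.mlin hχ.isMultilinear hχN (n := n + 1) ⟨hχc, fun c i m w hc hn => ?_⟩
    hχd (by omega) hl
  rw [hχφ _ (by simp [arrows]; omega), h5 c i m w hc (by omega), add_self]

end Correction

/-! ### The grading of `U` -/

section GradingOfU

/-- The normalization determines the grading of `U`. -/
theorem eq_gamU_of_isNormalized {D : TorusDeformation} {u : Gam}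
    (h : D.IsGraded (IsHomogeneous u) lam) (hD : IsNormalized D) : u = gamU := by
  have h1 := hD.1
  -- The coefficient of `U ι_1` in `μ_4(ρ_4, ρ_3, ρ_2, ρ_1)` is nonzero, so `γ(U)` is `λ^2` times
  -- the grading of a descending turn.
  have h2 := hasDegree_basic (l := arrows (dec 4 4)) (b := .idem 1) (k := 1) h (by
    change cf (D.μ [rho 4, rho 3, rho 2, rho 1]) _ _ ≠ 0
    rw [h1, iota, cf_smul_of]
    simp)
  have h3 := (hasCoord_lam_zpow (((arrows (dec 4 4)).length : ℤ) - 2)).mul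
    (hasCoord_arrows (dec 4 4))
  rw [← h2, prodCoord_dec_four, arrows, List.length_map, length_dec, pow_one, gamBasic, mul_one] at h3
  have h4 := hasCoord_gamU_pow 1
  rw [pow_one] at h4
  exact h3.ext h4

end GradingOfU

end Torus

namespace Torus

open AInf

/-! ### Cochains supported on one list -/

section Single

open Classical in
/-- The multilinear extension of the function which is `x` on the list `l₀` of basic elements and
zero on all other such lists. -/
def single (l₀ : List Basic) (x : Alg) : List Alg → Alg := ext fun l => if l = l₀ then x else 0

open Classical in
theorem single_of (l₀ : List Basic) (x : Alg) (l : List Basic) :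
    single l₀ x (l.map Alg.of) = if l = l₀ then x else 0 := ext_of _ l

theorem single_eq_zero (l₀ : List Basic) (x : Alg) {l : List Alg} (hl : l.length ≠ l₀.length) :
    single l₀ x l = 0 :=
  ext_zero (fun bs hbs => if_neg fun h => hl (by rw [← hbs, h])) rfl

theorem coch_single {d : ℤ} {l₀ : List Basic} {x : Alg} (h0 : l₀ ≠ [])
    (hx : ∀ b k, cf x b k ≠ 0 → Rel d l₀ k b) : Coch d (single l₀ x) where
  mlin := mlin_ext _
  nil := if_neg (Ne.symm h0)
  supp l b k h := by
    rw [single_of] at h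
    split_ifs at h with hl
    · rw [hl]
      exact hx b k h
    · exact absurd (cf_zero b k) h

theorem normal_single {c : List (ZMod 4)} (x : Alg) : Normal (single (arrows c) x) :=
  normal_of_basic (mlin_ext _) fun bs y hy => by
    rw [single_of, if_neg]
    rintro rfl
    simp [arrows] at hy

theorem rel_dec_four (j : ZMod 4) : Rel 2 (arrows (dec j 4)) 1 (.idem (src j)) := by
  constructor
  · simp only [arrows, dec, List.map_cons, List.map_nil, IsPath, sB, tB]
    revert j
    decide
  · have h1 := (hasCoord_gamU_pow 1).mul hasCoord_one
    have h2 := (hasCoord_lam_zpow (((arrows (dec j 4)).length : ℤ) - 2)).mul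
      (hasCoord_arrows (dec j 4))
    rw [prodCoord_dec_four, arrows, List.length_map, length_dec] at h2
    exact h1.ext h2

/-- The grading permits a homomorphism component sending `(ρ_1, ρ_4, ρ_3)` to `ρ_{3,4,1}`. This
freedom is used for `zeta`. -/
theorem rel_dec_three : Rel 1 (arrows (dec 1 3)) 0 (.chord 3 2) := by
  constructor
  · simp only [arrows, dec, List.map_cons, List.map_nil, IsPath, sB, tB]
    decide
  · have h1 := (hasCoord_gamU_pow 0).mul (hasCoord_chord 3 2)
    have h2 := (hasCoord_lam_zpow (((arrows (dec 1 3)).length : ℤ) - 1)).mul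
      (hasCoord_arrows (dec 1 3))
    exact h1.ext h2

end Single

/-! ### The four operations with value `U ι` -/

section FirstOrder

/-- The first order part of the deformation. -/
def kappa (l : List Alg) : Alg :=
  (single (arrows (dec 0 4)) ((X : F2U) • iota (src 0)) l +
    single (arrows (dec 1 4)) ((X : F2U) • iota (src 1)) l) +
  (single (arrows (dec 2 4)) ((X : F2U) • iota (src 2)) l +
    single (arrows (dec 3 4)) ((X : F2U) • iota (src 3)) l)

theorem coch_single_dec_four (j : ZMod 4) :
    Coch 2 (single (arrows (dec j 4)) ((X : F2U) • iota (src j))) := by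
  refine coch_single (by simp [arrows, dec]) fun b k h => ?_
  rw [iota, cf_smul_of] at h
  split_ifs at h with hb
  · rw [coeff_X] at h
    split_ifs at h with hk
    · subst hb hk
      exact rel_dec_four j
    · exact absurd rfl h
  · exact absurd rfl h

theorem coch_kappa : Coch 2 kappa :=
  ((coch_single_dec_four 0).sum (coch_single_dec_four 1)).sum
    ((coch_single_dec_four 2).sum (coch_single_dec_four 3))

theorem normal_kappa : Normal kappa :=
  ((normal_single _).add (normal_single _)).add ((normal_single _).add (normal_single _))

theorem kappa_of_length {l : List Alg} (hl : l.length ≠ 4) : kappa l = 0 := by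
  simp only [kappa]
  rw [single_eq_zero _ _ hl, single_eq_zero _ _ hl, single_eq_zero _ _ hl, single_eq_zero _ _ hl]
  simp

theorem zmod_four_cases : ∀ j : ZMod 4, j = 0 ∨ j = 1 ∨ j = 2 ∨ j = 3 := by decide

theorem kappa_dec (j : ZMod 4) :
    kappa ((arrows (dec j 4)).map Alg.of) = (X : F2U) • iota (src j) := by
  have key : ∀ i, arrows (dec j 4) = arrows (dec i 4) ↔ j = i := fun i => by
    refine ⟨fun h => ?_, fun h => by rw [h]⟩
    simp only [arrows, dec, List.map_cons, List.cons.injEq, Basic.chord.injEq] at h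
    exact h.1.1
  simp only [kappa, single_of, key]
  rcases zmod_four_cases j with rfl | rfl | rfl | rfl
  all_goals
    rw [if_pos rfl, if_neg (by decide), if_neg (by decide), if_neg (by decide)]
    simp only [add_zero, zero_add]

end FirstOrder

/-! ### Existence of the deformation -/

section Existence

theorem preDeformation_mul2 : PreDeformation (mul2 : List Alg → Alg) where
  additive := mul2_additive
  nil := rfl
  one _ := rfl
  two _ _ := rfl
  normal _ _ hl := mul2_of_length hl

theorem _root_.AInf.PreDeformation.perturb {μ ψ : List Alg → Alg} (h : PreDeformation μ) (ha : Additive ψ)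
    (hN : Normal ψ) {m : ℕ} (hm : 3 ≤ m) (hψ : ∀ l, l.length ≠ m → ψ l = 0) :
    PreDeformation fun l => μ l + ψ l where
  additive := h.additive.add ha
  nil := by rw [h.nil, hψ _ (by simp; omega), add_zero]
  one a := by rw [h.one, hψ _ (by simp; omega), add_zero]
  two a b := by rw [h.two, hψ _ (by simp; omega), add_zero]
  normal l hl hl' := by rw [h.normal l hl hl', hN l hl, add_zero]

/-- The `A∞` relations hold for at most `n` inputs. -/
structure Partial (n : ℕ) (μ : List Alg → Alg) : Prop where
  pre : PreDeformation μ
  coch : Coch 2 μ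
  four : ∀ j, μ ((arrows (dec j 4)).map Alg.of) = (X : F2U) • iota (src j)
  relation : ∀ l, l.length ≤ n → ins μ μ l = 0
  five : ∀ c, Crit c → c.length = 5 → ins μ μ ((arrows c).map Alg.of) = 0

/-- Five descending arrows begin and end with `ρ_j`. Both outer products equal `U ρ_j`, because
`kappa` has the same shape `U ι` on all four cyclic lists. -/
theorem delta_kappa_dec_five (j : ZMod 4) :
    delta kappa ((arrows (dec j 5)).map Alg.of) = 0 := by
  rw [delta_arrows_dec coch_kappa.mlin j 3, kappa_dec, kappa_dec, mul_smul', smul_mul]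
  have h1 : Alg.of (.chord j 0) * iota (src (j - 1)) = Alg.of (.chord j 0) := by
    rw [iota, of_mul_of, Basic.mul, if_pos]
    · rfl
    · revert j
      decide
  have h2 : j - (3 + 1 : ℕ) = j := by
    clear h1
    revert j
    decide
  have h3 : iota (src j) * Alg.of (.chord j 0) = Alg.of (.chord j 0) := by
    rw [iota, of_mul_of, Basic.mul, if_pos rfl]
    rfl
  rw [h2, h1, h3, add_self]

theorem partial_four : Partial 4 fun l => mul2 l + kappa l := by
  have hψ : ∀ l : List Alg, l.length ≠ 4 → kappa l = 0 := fun l => kappa_of_length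
  have key : ∀ l : List Alg, l.length ≤ 5 →
      ins (fun l => mul2 l + kappa l) (fun l => mul2 l + kappa l) l = delta kappa l := fun l hl => by
    rw [preDeformation_mul2.ins_perturb coch_kappa.mlin.add (by norm_num) hψ hl,
      ins_mul2_mul2 add_self, zero_add]
  have hc : Coch 2 fun l => mul2 l + kappa l := coch_mul2.sum coch_kappa
  refine ⟨preDeformation_mul2.perturb coch_kappa.mlin.add normal_kappa (by norm_num) hψ, hc,
    fun j => ?_, fun l hl => ?_, fun c hcrit hl => ?_⟩
  · rw [kappa_dec, mul2_of_length (by simp [arrows, dec]), zero_add]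
  · rw [key l (by omega), delta_of_length_le coch_kappa.mlin.add hψ hl]
  · refine eq_zero_of_cf fun b k => ?_
    by_contra hb
    rcases rel_three_arrows hcrit (by rintro rfl; simp at hl) ((hc.ins hc).supp _ b k hb) with
      ⟨j, rfl⟩ | ⟨j, rfl, -⟩
    · rw [key _ (by simp [arrows, dec]), delta_kappa_dec_five] at hb
      exact hb (cf_zero b k)
    · simp [dec] at hl

/-- Seven arrows from `ρ_j` on can only yield chords starting with `ρ_{j+2}` and continued by the
eighth arrow `ρ_{j+1}`. In the cocycle condition on eight arrows, the left product starts with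
`ρ_j`, so it cannot cancel the right one, and right multiplication loses none of these coefficients.
-/
theorem eq_zero_on_crit {χ : List Alg → Alg} (hχ : Coch 3 χ) {c : List (ZMod 4)} (hc : Crit c)
    (h0 : c ≠ []) (h5 : c.length ≠ 5)
    (hd : c.length = 7 → ∀ l : List Alg, l.length = 8 → delta χ l = 0) :
    χ ((arrows c).map Alg.of) = 0 := by
  refine eq_zero_of_cf fun b k => ?_
  by_contra hb
  rcases rel_three_arrows hc h0 (hχ.supp _ b k hb) with ⟨j, rfl⟩ | ⟨j, rfl, m, hm, rfl⟩
  · exact h5 (length_dec j 5)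
  · have h1 := hd (length_dec j 7) ((arrows (dec j 8)).map Alg.of) (by simp [arrows, length_dec])
    rw [delta_arrows_dec hχ.mlin j 6] at h1
    have h2 := congrArg (co (.chord (j + 2) (m + 1))) h1
    rw [map_add, co_arrow_mul_of_ne (by clear * -; revert j; decide), zero_add, map_zero, co_mul_arrow_succ,
      if_pos] at h2
    · exact hb (by rw [cf_eq_coeff, h2, coeff_zero])
    · rw [hm]
      clear * -
      revert j
      decide

theorem Partial.step {n : ℕ} (hn : 4 ≤ n) {μ : List Alg → Alg} (h : Partial n μ) :
    ∃ μ', Partial (n + 1) μ' ∧ ∀ l, l.length ≠ n → μ' l = μ l := by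
  have ho : Coch 3 (ins μ μ) := h.coch.ins h.coch
  obtain ⟨ψ, h1, h2, h3, h4, h5⟩ := exists_correction ho (h.pre.normal_ins add_self) n
  have hp := h.pre.perturb h1.mlin.add h2 (by omega) h3
  have hc : Coch 2 fun l => μ l + ψ l := h.coch.sum h1
  have key : ∀ l : List Alg, l.length ≤ n + 1 →
      ins (fun l => μ l + ψ l) (fun l => μ l + ψ l) l = ins μ μ l + delta ψ l := fun l hl =>
    h.pre.ins_perturb h1.mlin.add (by omega) h3 hl
  have hle : ∀ l : List Alg, l.length ≤ n →
      ins (fun l => μ l + ψ l) (fun l => μ l + ψ l) l = 0 := fun l hl => by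
    rw [key l (by omega), h.relation l hl, delta_of_length_le h1.mlin.add h3 hl, add_zero]
  have hfive : ∀ c, Crit c → c.length = 5 →
      ins (fun l => μ l + ψ l) (fun l => μ l + ψ l) ((arrows c).map Alg.of) = 0 := by
    intro c hcrit hl
    -- For `n = 4` the correction is reduced, hence invisible on critical lists. For larger `n` the
    -- relation in five inputs is already settled.
    rcases hn.eq_or_lt with rfl | hn'
    · rw [key _ (by simp [arrows, hl]), h.five c hcrit hl,
        h4.delta_arrows_eq_zero h1.mlin (by norm_num) hcrit hl, add_zero]
    · exact hle _ (by simp [arrows]; omega)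
  have hd : ∀ l : List Alg, l.length = n + 2 →
      delta (ins (fun l => μ l + ψ l) (fun l => μ l + ψ l)) l = 0 := fun l hl =>
    hp.delta_ins add_self (n := n + 1) (fun l hl => hle l (by omega)) hl
  refine ⟨_, ⟨hp, hc, fun j => ?_, fun l hl => ?_, hfive⟩, fun l hl => by rw [h3 l hl, add_zero]⟩
  · rcases hn.eq_or_lt with rfl | hn'
    · rw [h4.crit _ (crit_dec j 4) (length_dec j 4), h.four, add_zero]
    · rw [h3 _ (by simp [arrows, length_dec]; omega), h.four, add_zero]
  · rcases hl.eq_or_lt with hl | hl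
    · refine h5 _ (hc.ins hc) (hp.normal_ins add_self) (fun l hl => key l hl.le) hd
        (fun c hcrit hcl => ?_) l hl
      by_cases hc5 : c.length = 5
      · exact hfive c hcrit hc5
      -- If there are `n + 1 = 7` arrows, the cocycle condition in `n + 2` inputs is the one in
      -- eight inputs.
      · refine eq_zero_on_crit (hc.ins hc) hcrit (by rintro rfl; simp at hcl) hc5 fun h7 l hl => ?_
        exact hd l (by omega)
    · exact hle l (by omega)

theorem exists_deformation : ∃ D : TorusDeformation,
    D.IsGraded (IsHomogeneous gamU) lam ∧ IsNormalized D := by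
  obtain ⟨μ, -, hμ⟩ := exists_limit partial_four fun n hn f hf => hf.step hn
  have agree : ∀ m, ∃ ν, Partial m ν ∧ ∀ l, l.length ≤ m → μ l = ν l := by
    intro m
    obtain ⟨n, hmn, -, ν, hν, h⟩ := hμ (m + 1)
    exact ⟨ν, ⟨hν.pre, hν.coch, hν.four, fun l hl => hν.relation l (by omega), hν.five⟩,
      fun l hl => h l (by omega)⟩
  have hc : Coch 2 μ := Coch.congr fun m => by
    obtain ⟨ν, hν, h⟩ := agree m
    exact ⟨ν, hν.coch, h⟩
  have hp : PreDeformation μ := by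
    refine ⟨hc.mlin.add, hc.nil, fun a => ?_, fun a b => ?_, fun l hl hl' => ?_⟩
    · obtain ⟨ν, hν, h⟩ := agree 1
      rw [h _ le_rfl, hν.pre.one]
    · obtain ⟨ν, hν, h⟩ := agree 2
      rw [h _ le_rfl, hν.pre.two]
    · obtain ⟨ν, hν, h⟩ := agree l.length
      rw [h _ le_rfl, hν.pre.normal l hl hl']
  have hr : ∀ l, ins μ μ l = 0 := by
    intro l
    obtain ⟨ν, hν, h⟩ := agree l.length
    have h' : ∀ v : List Alg, v.length < l.length + 1 → μ v = ν v := fun v hv => h v (by omega)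
    rw [ins_congr_of_length h' h' (Nat.lt_succ_self _), hν.relation l le_rfl]
  have hfour : ∀ j, μ ((arrows (dec j 4)).map Alg.of) = (X : F2U) • iota (src j) := by
    intro j
    obtain ⟨ν, hν, h⟩ := agree 4
    rw [h _ (by simp [arrows, length_dec]), hν.four]
  -- In `ZMod 4` the lists `dec 4 4` and `dec 3 4` are `ρ_4, ρ_3, ρ_2, ρ_1` and `ρ_3, ρ_2, ρ_1,
  -- ρ_4`, starting at `ι_1` and `ι_0` respectively.
  exact ⟨toDeformation hp hc hr, hc.hasDegree, hfour 4, hfour 3⟩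

end Existence

end Torus

namespace AInf

/-! ### Perturbation and composition of homomorphisms -/

section

variable {A B : Type} [AddCommGroup B]

/-- The composition with `f` only depends on the values of `f` on the blocks of the input. -/
theorem cmp_congr_block {φ : List A → B} {f f' : List A → A} {l : List A}
    (h : ∀ u v w, v ≠ [] → u ++ (v ++ w) = l → f v = f' v) : cmp φ f l = cmp φ f' l := by
  induction hl : l.length using Nat.strong_induction_on generalizing φ l with
  | _ n ih =>
    subst hl
    cases l with
    | nil => rfl
    | cons x l =>
      rw [cmp_cons, cmp_cons]
      refine splitSum_congr fun u w huw => ?_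
      rw [h [] (x :: u) w (by simp) (by simp [huw])]
      refine ih w.length (by rw [← huw]; simp) (fun u' v w' hv huv => ?_) rfl
      exact h (x :: u ++ u') v w' hv (by rw [List.append_assoc, huv, List.cons_append, huw])

end

variable {A : Type} [Ring A] {f : List A → A}

theorem PreHom.perturb (h : PreHom f) {ψ : List A → A} (ha : Additive ψ) (hN : Normal ψ) {m : ℕ}
    (hm : 2 ≤ m) (hψ : ∀ l, l.length ≠ m → ψ l = 0) : PreHom fun l => f l + ψ l where
  additive := h.additive.add ha
  nil := by rw [h.nil, hψ _ (by simp; omega), add_zero]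
  one a := by rw [h.one, hψ _ (by simp; omega), add_zero]
  normal l hl hl' := by rw [h.normal l hl hl', hN l hl, add_zero]

theorem PreHom.idHom : PreHom (idHom : List A → A) where
  additive := idHom_additive
  nil := rfl
  one _ := rfl
  normal _ _ hl := idHom_of_length hl

theorem PreHom.normal_cmp {g : List A → A} (hg : PreHom g) (hf : PreHom f) {l : List A}
    (hl : 1 ∈ l) (hl' : l.length ≠ 1) : AInf.cmp g f l = 0 := by
  have h1 : g = fun l => AInf.idHom l + (g l - AInf.idHom l) := by
    funext l
    abel
  rw [h1, cmp_add_left, cmp_idHom hf.nil, hf.normal l hl hl', zero_add]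
  exact hg.normal_sub.cmp (hg.additive.sub idHom_additive) hf.normal (hf.one 1) l hl

end AInf

namespace Torus

open AInf

/-! ### Graded inverses -/

section Inverse

theorem Coch.restrict {d : ℤ} {φ : List Alg → Alg} (hφ : Coch d φ) (n : ℕ) :
    Coch d fun l => if l.length = n then φ l else 0 where
  mlin := by
    constructor
    · intro xs ys a b
      simp only [List.length_append, List.length_cons]
      split_ifs
      · exact hφ.mlin.add xs ys a b
      · rw [add_zero]
    · intro xs ys r a
      simp only [List.length_append, List.length_cons]
      split_ifs
      · exact hφ.mlin.smul xs ys r a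
      · rw [smul_zero]
  nil := by rw [hφ.nil, ite_self]
  supp l b k h := by
    beta_reduce at h
    split_ifs at h
    · exact hφ.supp l b k h
    · exact absurd (cf_zero b k) h

theorem sub_eq_add (x y : Alg) : x - y = x + y := by
  rw [sub_eq_iff_eq_add, add_assoc, add_self, add_zero]

theorem preHom_of_agree {f : List Alg → Alg} {P : (List Alg → Alg) → Prop}
    (hP : ∀ g, P g → PreHom g ∧ Coch 1 g)
    (h : ∀ m, ∃ g, P g ∧ ∀ l, l.length ≤ m → f l = g l) : PreHom f ∧ Coch 1 f := by
  have hc : Coch 1 f := Coch.congr fun m => by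
    obtain ⟨g, hg, h⟩ := h m
    exact ⟨g, (hP g hg).2, h⟩
  refine ⟨⟨hc.mlin.add, hc.nil, fun a => ?_, fun l hl hl' => ?_⟩, hc⟩
  · obtain ⟨g, hg, h⟩ := h 1
    rw [h _ le_rfl, (hP g hg).1.one]
  · obtain ⟨g, hg, h⟩ := h l.length
    rw [h _ le_rfl, (hP g hg).1.normal l hl hl']

theorem exists_left_inverse {f : List Alg → Alg} (hf : PreHom f) (hc : Coch 1 f) :
    ∃ g, PreHom g ∧ Coch 1 g ∧ cmp g f = idHom := by
  obtain ⟨g, h1, h2⟩ := exists_cmp_eq_idHom hf.one (Q := fun g => PreHom g ∧ Coch 1 g)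
    ⟨PreHom.idHom, coch_idHom⟩ (by
      rintro n hn g ⟨hg, hgc⟩ -
      have hψ : Coch 1 fun l => if l.length = n then idHom l - cmp g f l else 0 := by
        simp only [sub_eq_add]
        exact (coch_idHom.sum (hgc.cmp hc)).restrict n
      refine ⟨hg.perturb hψ.mlin.add (fun l hl => ?_) hn fun l hl => if_neg hl, hgc.sum hψ⟩
      split_ifs with hln
      · rw [idHom_of_length (by omega), hg.normal_cmp hf hl (by omega), sub_zero]
      · rfl)
  obtain ⟨h3, h4⟩ := preHom_of_agree (fun g hg => hg) h2
  exact ⟨g, h3, h4, h1⟩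

theorem exists_inverse {f : List Alg → Alg} (hf : PreHom f) (hc : Coch 1 f) :
    ∃ g, PreHom g ∧ Coch 1 g ∧ cmp g f = idHom ∧ cmp f g = idHom := by
  obtain ⟨g, hg, hgc, hgf⟩ := exists_left_inverse hf hc
  obtain ⟨h, hh, -, hhg⟩ := exists_left_inverse hg hgc
  refine ⟨g, hg, hgc, hgf, ?_⟩
  -- The left inverse `g` has itself a left inverse `h`, and associativity gives `h = h ∘ (g ∘ f) =
  -- f`.
  have : h = f := by
    funext l
    rw [← cmp_idHom_right hh.additive l, ← hgf, ← cmp_cmp hh.additive, hhg, cmp_idHom hf.nil]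
  rw [← this, hhg]

/-- A graded homomorphism with identical linear part is an isomorphism. -/
theorem gradedIsomorphic_of_hom {D E : TorusDeformation} {f : List Alg → Alg} (hf : PreHom f)
    (hc : Coch 1 f) (h : ins f D.μ = cmp E.μ f) :
    GradedIsomorphic (IsHomogeneous gamU) lam D E := by
  obtain ⟨g, hg, hgc, hgf, hfg⟩ := exists_inverse hf hc
  refine ⟨f, g, isHom_of_ins_eq_cmp hf hc h, isHom_of_ins_eq_cmp hg hgc ?_, hc.hasDegree,
    hgc.hasDegree, hf.one, ?_, ?_⟩
  · exact ins_eq_cmp_of_inverse hg.additive (preDeformation E).additive (preDeformation D).nil hgf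
      hfg h
  · funext l
    rw [compose_eq_cmp, hgf]
  · funext l
    rw [compose_eq_cmp, hfg]

end Inverse

/-! ### Uniqueness up to isomorphism -/

section Uniqueness

theorem coch_homObs {f D E : List Alg → Alg} (hf : Coch 1 f) (hD : Coch 2 D) (hE : Coch 2 E) :
    Coch 2 (homObs f D E) := by
  have h := (hf.ins hD).sum (show Coch (1 + 2 - 1) _ from hE.cmp hf)
  exact h

/-- The obstruction in four inputs for a partial homomorphism with two components. -/
theorem homObs_arrows_four {f D E : List Alg → Alg} (hf : PreHom f) (hfc : Coch 1 f)
    (hD : Coch 2 D) (hE : Coch 2 E) (h3 : ∀ l, 3 ≤ l.length → f l = 0) {c : List (ZMod 4)}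
    (hc : Crit c) (hl : c.length = 4) : homObs f D E ((arrows c).map Alg.of) =
      D ((arrows c).map Alg.of) + E ((arrows c).map Alg.of) := by
  have hblock : ∀ u v w, v ≠ [] → u ++ (v ++ w) = (arrows c).map Alg.of →
      ∃ c' : List (ZMod 4), Crit c' ∧ c' ≠ [] ∧ v = (arrows c').map Alg.of := by
    intro u v w hv huvw
    rw [arrows, List.map_map] at huvw
    obtain ⟨c₁, c₂, rfl, rfl, h1⟩ := List.append_eq_map_iff.1 huvw
    obtain ⟨c₃, c₄, rfl, rfl, rfl⟩ := List.map_eq_append_iff.1 h1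
    refine ⟨c₃, (List.IsChain.right_of_append hc).left_of_append, by simpa using hv, ?_⟩
    rw [arrows, List.map_map]
  -- In the degree of a homomorphism only one or three critical arrows give a nonzero value. The
  -- binary component vanishes on such blocks, and the ternary one is zero by `h3`.
  have hid : ∀ c' : List (ZMod 4), Crit c' → c' ≠ [] →
      f ((arrows c').map Alg.of) = idHom ((arrows c').map Alg.of) := by
    intro c' hc' h0
    by_cases h1 : c'.length = 1
    · exact hf.eq_idHom (by simpa [arrows] using h1)
    · rw [idHom_of_length (by simpa [arrows] using h1)]
      by_cases hl3 : 3 ≤ c'.length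
      · exact h3 _ (by simpa [arrows] using hl3)
      · refine eq_zero_of_cf fun b k => ?_
        by_contra hb
        have := rel_one_arrows hc' h0 (hfc.supp _ b k hb)
        omega
  have hDf : ins f D ((arrows c).map Alg.of) = D ((arrows c).map Alg.of) := by
    have h1 : f = fun l => idHom l + (f l - idHom l) := by
      funext l
      abel
    have h0 : (arrows c).map Alg.of ≠ [] := by
      intro h
      simp [arrows] at h
      simp [h] at hl
    rw [h1, ins_add_left, ins_idHom D h0, ins_eq_zero, add_zero]
    intro u v w hv huvw
    obtain ⟨c', hc', h0', rfl⟩ := hblock u v w hv huvw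
    -- For reasons of degree `D` is nonzero only on blocks of four critical arrows, that is, on the
    -- whole list; there `f` and the identity agree.
    by_cases h4 : c'.length = 4
    · have := congrArg List.length huvw
      simp only [List.length_append, arrows, List.length_map] at this
      have hu : u = [] := List.length_eq_zero_iff.1 (by omega)
      have hw : w = [] := List.length_eq_zero_iff.1 (by omega)
      subst hu hw
      exact sub_eq_zero.2 (hf.eq_idHom rfl)
    · have hz : D ((arrows c').map Alg.of) = 0 := by
        refine eq_zero_of_cf fun b k => ?_
        by_contra hb
        obtain ⟨j, rfl, -⟩ := rel_two_arrows hc' h0' (hD.supp _ b k hb)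
        exact h4 (length_dec j 4)
      rw [hz]
      exact (hf.additive.sub idHom_additive).map_zero u w
  rw [homObs, hDf, cmp_congr_block (f' := idHom), cmp_idHom_right hE.mlin.add]
  intro u v w hv huvw
  obtain ⟨c', hc', h0', rfl⟩ := hblock u v w hv huvw
  exact hid c' hc' h0'

/-- On each of the four cyclic lists the value has three possible coefficients, those of `U ι_{src
j}` and of the chords of length four starting with `ρ_j` or `ρ_{j+2}`. The cocycle condition links
neighbouring lists. Starting from the lists at `0` and `3`, it leaves open only one coefficient,
shared by `ρ_{2,3,4,1}` on the list at `2` and `ρ_{3,4,1,2}` on the list at `1`. -/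
theorem eq_zero_on_crit_four {χ : List Alg → Alg} (hχ : Coch 2 χ)
    (hd : ∀ j, delta χ ((arrows (dec j 5)).map Alg.of) = 0)
    (h0 : χ ((arrows (dec 0 4)).map Alg.of) = 0) (h3 : χ ((arrows (dec 3 4)).map Alg.of) = 0)
    (h2 : cf (χ ((arrows (dec 2 4)).map Alg.of)) (.chord 2 3) 0 = 0) {c : List (ZMod 4)}
    (hc : Crit c) (hc0 : c ≠ []) : χ ((arrows c).map Alg.of) = 0 := by
  obtain ⟨v, hv⟩ : ∃ v : ZMod 4 → Alg, v = fun j => χ ((arrows (dec j 4)).map Alg.of) := ⟨_, rfl⟩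
  have hvj : ∀ j, χ ((arrows (dec j 4)).map Alg.of) = v j := fun j => by rw [hv]
  have hd' : ∀ j, Alg.of (.chord j 0) * v (j - 1) + v j * Alg.of (.chord j 0) = 0 := by
    intro j
    have := hd j
    rw [delta_arrows_dec hχ.mlin j 3, hvj, hvj] at this
    rwa [show j - (3 + 1 : ℕ) = j by clear * -; revert j; decide] at this
  have hx : ∀ j, co (.idem (src (j + 1))) (v (j - 1)) + co (.idem (src j)) (v j) = 0 := by
    intro j
    have := congrArg (co (.chord j 0)) (hd' j)
    rwa [map_add, co_arrow_mul_zero, co_mul_arrow_zero, map_zero] at this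
  -- The chord `ρ_{j,…,j+4}` arises from a chord of length four both by left and by right
  -- multiplication with `ρ_j`.
  have hy : ∀ j, co (.chord (j + 1) 3) (v (j - 1)) + co (.chord j 3) (v j) = 0 := by
    intro j
    have := congrArg (co (.chord j 4)) (hd' j)
    rwa [map_add, co_arrow_mul_succ, co_mul_arrow_succ, if_pos (by clear * -; revert j; decide),
      map_zero] at this
  rw [hvj] at h0 h3 h2
  have x1 : co (.idem (src 1)) (v 1) = 0 := by
    have := hx 1
    rwa [show (1 : ZMod 4) - 1 = 0 from rfl, h0, map_zero, zero_add] at this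
  have x2 : co (.idem (src 2)) (v 2) = 0 := by
    have := hx 2
    rwa [show (2 : ZMod 4) - 1 = 1 from rfl, show src (2 + 1) = src 1 from rfl, x1, zero_add]
      at this
  have y1 : co (.chord 1 3) (v 1) = 0 := by
    have := hy 1
    rwa [show (1 : ZMod 4) - 1 = 0 from rfl, h0, map_zero, zero_add] at this
  have y0 : co (.chord 0 3) (v 2) = 0 := by
    have := hy 3
    rwa [show (3 : ZMod 4) - 1 = 2 from rfl, h3, map_zero, add_zero] at this
  have y3 : cf (v 1) (.chord 3 3) 0 = 0 := by
    have := congrArg (fun p : F2U => p.coeff 0) (hy 2)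
    change cf (v 1) (.chord 3 3) 0 + cf (v 2) (.chord 2 3) 0 = 0 at this
    rwa [h2, add_zero] at this
  refine eq_zero_of_cf fun b k => ?_
  by_contra hb
  obtain ⟨j, rfl, hj⟩ := rel_two_arrows hc hc0 (hχ.supp _ b k hb)
  rw [hvj] at hb
  rcases zmod_four_cases j with rfl | rfl | rfl | rfl
  · exact hb (by rw [h0, cf_zero])
  · rcases hj with ⟨rfl, rfl⟩ | ⟨rfl, i, hi, rfl⟩
    · exact hb (by rw [cf_eq_coeff, x1, coeff_zero])
    · rcases (src_eq_src i 1).1 hi with rfl | rfl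
      · exact hb (by rw [cf_eq_coeff, y1, coeff_zero])
      · exact hb y3
  · rcases hj with ⟨rfl, rfl⟩ | ⟨rfl, i, hi, rfl⟩
    · exact hb (by rw [cf_eq_coeff, x2, coeff_zero])
    · rcases (src_eq_src i 2).1 hi with rfl | rfl
      · exact hb h2
      · exact hb ((congrArg (fun p : F2U => p.coeff 0) y0).trans (coeff_zero 0))
  · exact hb (by rw [h3, cf_zero])

/-- The cochain which corrects the last obstruction in four inputs. -/
def zeta (z : ZMod 2) : List Alg → Alg :=
  single (arrows (dec 1 3)) ((C z : F2U) • Alg.of (.chord 3 2))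

variable (z : ZMod 2)

theorem coch_zeta : Coch 1 (zeta z) := by
  refine coch_single (by simp [arrows, dec]) fun b k h => ?_
  rw [cf_smul_of] at h
  split_ifs at h with hb
  · rw [coeff_C] at h
    split_ifs at h with hk
    · subst hb hk
      exact rel_dec_three
    · exact absurd rfl h
  · exact absurd rfl h

theorem zeta_of_length {l : List Alg} (hl : l.length ≠ 3) : zeta z l = 0 :=
  single_eq_zero _ _ (by simpa [arrows, dec] using hl)

theorem zeta_dec_of_ne {j : ZMod 4} (hj : j ≠ 1) : zeta z ((arrows (dec j 3)).map Alg.of) = 0 := by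
  rw [zeta, single_of, if_neg]
  intro h
  simp only [arrows, dec, List.map_cons, List.cons.injEq, Basic.chord.injEq] at h
  exact hj h.1.1

theorem delta_zeta_zero : delta (zeta z) ((arrows (dec 0 4)).map Alg.of) = 0 := by
  rw [delta_arrows_dec (coch_zeta z).mlin 0 2, zeta_dec_of_ne z (by decide),
    zeta_dec_of_ne z (by decide), mul_zero, zero_mul, add_zero]

theorem delta_zeta_three : delta (zeta z) ((arrows (dec 3 4)).map Alg.of) = 0 := by
  rw [delta_arrows_dec (coch_zeta z).mlin 3 2, zeta_dec_of_ne z (by decide),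
    zeta_dec_of_ne z (by decide), mul_zero, zero_mul, add_zero]

/-- The coefficient comes from the outer product of `ρ_2` with `ρ_{3,4,1}`. -/
theorem cf_delta_zeta : cf (delta (zeta z) ((arrows (dec 2 4)).map Alg.of)) (.chord 2 3) 0 = z := by
  rw [delta_arrows_dec (coch_zeta z).mlin 2 2, zeta_dec_of_ne z (j := 2) (by decide), zero_mul,
    add_zero, show (2 : ZMod 4) - 1 = 1 from rfl, zeta, single_of, if_pos rfl, mul_smul', of_mul_of,
    Basic.mul, if_pos (by decide)]
  change cf ((C z : F2U) • Alg.of (.chord 2 3)) _ _ = _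
  rw [cf_smul_of, if_pos rfl, coeff_C_zero]

variable {D E : TorusDeformation}

/-- The homomorphism relations hold for at most `n` inputs, and only components with fewer than `n`
inputs are nonzero. -/
structure PartialHom (D E : TorusDeformation) (n : ℕ) (f : List Alg → Alg) : Prop where
  pre : PreHom f
  coch : Coch 1 f
  relation : ∀ l, l.length ≤ n → homObs f D.μ E.μ l = 0
  vanish : ∀ l, n ≤ l.length → f l = 0

theorem partialHom_two : PartialHom D E 2 idHom where
  pre := PreHom.idHom
  coch := coch_idHom
  relation l hl := by
    rw [homObs, cmp_idHom_right (preDeformation E).additive,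
      (preDeformation E).eq_mul2 hl]
    cases l with
    | nil => exact add_zero 0
    | cons x l =>
      rw [ins_idHom _ (by simp), (preDeformation D).eq_mul2 hl, add_self]
  vanish l hl := idHom_of_length (by omega)

/-- Correction of a partial homomorphism in `n` inputs, if the obstruction of the corrected
homomorphism vanishes on lists of arrows with vanishing consecutive products. -/
theorem PartialHom.step_of_crit (hD : D.IsGraded (IsHomogeneous gamU) lam)
    (hE : E.IsGraded (IsHomogeneous gamU) lam) {n : ℕ} (hn : 2 ≤ n) {f : List Alg → Alg}
    (hf : PreHom f) (hc : Coch 1 f) (hr : ∀ l, l.length ≤ n → homObs f D.μ E.μ l = 0)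
    (hv : ∀ l, n < l.length → f l = 0)
    (hcrit : ∀ χ, Coch 2 χ → (∀ l, l.length = n + 2 → delta χ l = 0) →
      (∀ c, Crit c → c.length = n + 1 →
        χ ((arrows c).map Alg.of) = homObs f D.μ E.μ ((arrows c).map Alg.of)) →
      ∀ c, Crit c → c.length = n + 1 → χ ((arrows c).map Alg.of) = 0) :
    ∃ g, PartialHom D E (n + 1) g ∧ ∀ l, l.length ≠ n → g l = f l := by
  have hDp := preDeformation D
  have hEp := preDeformation E
  obtain ⟨ψ, h1, h2, h3, h4, h5⟩ := exists_correction
    (coch_homObs hc (coch_of_isGraded hD) (coch_of_isGraded hE))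
    (hf.normal_homObs add_self hDp hEp) n
  have h1 : Coch 1 ψ := h1
  have hp := hf.perturb h1.mlin.add h2 hn h3
  have hgc : Coch 1 fun l => f l + ψ l := hc.sum h1
  have hχ := coch_homObs hgc (coch_of_isGraded hD) (coch_of_isGraded hE)
  have key : ∀ l : List Alg, l.length ≤ n + 1 →
      homObs (fun l => f l + ψ l) D.μ E.μ l = homObs f D.μ E.μ l + delta ψ l := fun l hl =>
    hf.homObs_perturb hDp hEp hn h3 hl
  have hle : ∀ l : List Alg, l.length ≤ n → homObs (fun l => f l + ψ l) D.μ E.μ l = 0 :=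
    fun l hl => by
      rw [key l (by omega), hr l hl, delta_of_length_le h1.mlin.add h3 hl, add_zero]
  have hd : ∀ l : List Alg, l.length = n + 2 →
      delta (homObs (fun l => f l + ψ l) D.μ E.μ) l = 0 := fun l hl =>
    hp.delta_homObs add_self hDp hEp (ins_self_eq_zero D) (ins_self_eq_zero E) (n := n + 1)
      (fun l hl => hle l (by omega)) hl
  refine ⟨_, ⟨hp, hgc, fun l hl => ?_, fun l hl => ?_⟩, fun l hl => by rw [h3 l hl, add_zero]⟩
  · rcases hl.eq_or_lt with hl | hl
    · refine h5 _ hχ (hp.normal_homObs add_self hDp hEp) (fun l hl => key l hl.le) hd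
        (hcrit _ hχ hd fun c hc hcl => ?_) l hl
      rw [key _ (by simp [arrows, hcl]), h4.delta_arrows_eq_zero h1.mlin (by omega) hc hcl,
        add_zero]
    · exact hle l (by omega)
  · rw [hv l (by omega), h3 l (by omega), add_zero]

theorem PartialHom.step (hD : D.IsGraded (IsHomogeneous gamU) lam) (hDn : IsNormalized D)
    (hE : E.IsGraded (IsHomogeneous gamU) lam) (hEn : IsNormalized E) {n : ℕ} (hn : 2 ≤ n)
    {f : List Alg → Alg} (h : PartialHom D E n f) :
    ∃ g, PartialHom D E (n + 1) g ∧ ∀ l, l.length ≠ n → g l = f l := by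
  -- The step from `n = 3` treats the obstruction in four inputs, the only arity in which the
  -- grading allows a nonzero critical value.
  by_cases h3 : n = 3
  · subst h3
    -- The scalar `z` is the one coefficient not controlled by the normalization. Adding `zeta z` to
    -- `f` cancels it and leaves the values on the two normalized lists unchanged.
    obtain ⟨z, hz⟩ : ∃ z, z = cf (homObs f D.μ E.μ ((arrows (dec 2 4)).map Alg.of)) (.chord 2 3) 0 :=
      ⟨_, rfl⟩
    have hζ := coch_zeta z
    have hζl : ∀ l : List Alg, l.length ≠ 3 → zeta z l = 0 := fun l => zeta_of_length z
    have hp : PreHom fun l => f l + zeta z l :=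
      h.pre.perturb hζ.mlin.add (normal_single _) (by norm_num) hζl
    have key : ∀ l : List Alg, l.length ≤ 4 →
        homObs (fun l => f l + zeta z l) D.μ E.μ l = homObs f D.μ E.μ l + delta (zeta z) l :=
      fun l hl => h.pre.homObs_perturb (preDeformation D) (preDeformation E) (by norm_num) hζl hl
    have hnorm : ∀ j, D.μ ((arrows (dec j 4)).map Alg.of) = E.μ ((arrows (dec j 4)).map Alg.of) →
        homObs f D.μ E.μ ((arrows (dec j 4)).map Alg.of) = 0 := fun j hj => by
      rw [homObs_arrows_four h.pre h.coch (coch_of_isGraded hD) (coch_of_isGraded hE) h.vanish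
        (crit_dec j 4) (length_dec j 4), hj, add_self]
    have hlen : ∀ j, ((arrows (dec j 4)).map Alg.of).length ≤ 4 := fun j => by
      simp [arrows, length_dec]
    obtain ⟨g, hg, hgf⟩ := PartialHom.step_of_crit hD hE hn hp (h.coch.sum hζ)
      (fun l hl => by
        rw [key l (by omega), h.relation l hl, delta_of_length_le hζ.mlin.add hζl hl, add_zero])
      (fun l hl => by rw [h.vanish l hl.le, hζl l (by omega), add_zero])
      (fun χ hχ hd hcrit c hc hcl => by
        refine eq_zero_on_crit_four hχ (fun j => hd _ (by simp [arrows, length_dec])) ?_ ?_ ?_ hc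
          (by rintro rfl; simp at hcl)
        · rw [hcrit _ (crit_dec 0 4) (length_dec 0 4), key _ (hlen 0), delta_zeta_zero, add_zero]
          exact hnorm 0 (hDn.1.trans hEn.1.symm)
        · rw [hcrit _ (crit_dec 3 4) (length_dec 3 4), key _ (hlen 3), delta_zeta_three, add_zero]
          exact hnorm 3 (hDn.2.trans hEn.2.symm)
        · rw [hcrit _ (crit_dec 2 4) (length_dec 2 4), key _ (hlen 2), cf_add, cf_delta_zeta, ← hz]
          exact CharTwo.add_self_eq_zero z)
    exact ⟨g, hg, fun l hl => by rw [hgf l hl, hζl l hl, add_zero]⟩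
  · refine PartialHom.step_of_crit hD hE hn h.pre h.coch h.relation
      (fun l hl => h.vanish l hl.le) fun χ hχ _ _ c hc hcl => eq_zero_of_cf fun b k => ?_
    by_contra hb
    obtain ⟨j, rfl, -⟩ := rel_two_arrows hc (by rintro rfl; simp at hcl) (hχ.supp _ b k hb)
    rw [length_dec] at hcl
    omega

theorem gradedIsomorphic (hD : D.IsGraded (IsHomogeneous gamU) lam) (hDn : IsNormalized D)
    (hE : E.IsGraded (IsHomogeneous gamU) lam) (hEn : IsNormalized E) :
    GradedIsomorphic (IsHomogeneous gamU) lam D E := by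
  obtain ⟨f, -, hf⟩ := exists_limit (partialHom_two (D := D) (E := E))
    fun n hn f h => h.step hD hDn hE hEn hn
  have agree : ∀ m, ∃ g, (PreHom g ∧ Coch 1 g ∧ ∀ l, l.length ≤ m → homObs g D.μ E.μ l = 0) ∧
      ∀ l, l.length ≤ m → f l = g l := by
    intro m
    obtain ⟨n, hmn, -, g, hg, h⟩ := hf (m + 1)
    exact ⟨g, ⟨hg.pre, hg.coch, fun l hl => hg.relation l (by omega)⟩, fun l hl => h l (by omega)⟩
  obtain ⟨hp, hc⟩ := preHom_of_agree (P := fun g => PreHom g ∧ Coch 1 g) (fun g hg => hg)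
    fun m => (agree m).imp fun g hg => ⟨⟨hg.1.1, hg.1.2.1⟩, hg.2⟩
  refine gradedIsomorphic_of_hom hp hc (funext fun l => ?_)
  obtain ⟨g, ⟨-, -, hr⟩, hg⟩ := agree l.length
  have h1 : ins f D.μ l = ins g D.μ l := ins_congr_of_length (n := l.length + 1)
    (fun v hv => hg v (by omega)) (fun _ _ => rfl) (Nat.lt_succ_self _)
  have h2 : cmp E.μ f l = cmp E.μ g l := cmp_congr fun v _ hv => hg v hv
  rw [h1, h2, ← sub_eq_zero, sub_eq_add]
  exact hr l le_rfl

end Uniqueness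

end Torus

end

theorem mainTheorem2 :
    (∃ D : Torus.TorusDeformation,
      D.IsGraded (Torus.IsHomogeneous Torus.gamU) Torus.lam ∧ Torus.IsNormalized D) ∧
    (∀ (D : Torus.TorusDeformation) (u : Torus.Gam),
      D.IsGraded (Torus.IsHomogeneous u) Torus.lam → Torus.IsNormalized D → u = Torus.gamU) ∧
    (∀ D E : Torus.TorusDeformation,
      D.IsGraded (Torus.IsHomogeneous Torus.gamU) Torus.lam → Torus.IsNormalized D →
      E.IsGraded (Torus.IsHomogeneous Torus.gamU) Torus.lam → Torus.IsNormalized E →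
      AInf.GradedIsomorphic (Torus.IsHomogeneous Torus.gamU) Torus.lam D E) :=
  ⟨Torus.exists_deformation, fun _ _ => Torus.eq_gamU_of_isNormalized,
    fun _ _ => Torus.gradedIsomorphic⟩
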